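/- Let $\mathbf F$ be an algebraically closed field of characteristic $p>2$ and let $n\ge 0$. Let $\Lambda(n)$ be the exterior algebra over $\mathbf F$ on $\xi_1,\dots,\xi_n$, with its $\mathbf Z_2$-grading, let $D_i$ be the odd superderivation of $\Lambda(n)$ with $D_i(\xi_j)=\delta_{ij}$, and let $W(n)=\sum_{i=1}^n\Lambda(n)D_i$, a restricted Lie superalgebra of operators on $\Lambda(n)$ with the supercommutator as bracket and the $p$-th power of even operators as $p$-mapping. For $k\ge -1$ let $W(n)_k$ be the span of all $fD_i$ with $f\in\Lambda(n)$ of degree $k+1$, and put $W(n)^k=\sum_{j\ge k}W(n)_j$. For a restricted Lie superalgebra $\mathfrak g$ let $u(\mathfrak g)$ be its restricted universal enveloping algebra. Modules are $\mathbf Z_2$-graded, and simple means nonzero and without $\mathbf Z_2$-graded submodules other than $0$ and the whole module. Let $\eta_1,\dots,\eta_n$ be the basis dual to the basis $\xi_1D_1,\dots,\xi_nD_n$ of the Cartan subalgebra $H$. Let $\lambda\in H^*=\mathbf F\eta_1\oplus\dots\oplus\mathbf F\eta_n$ and let $M(\lambda)$ be a simple $u(W(n)_0)$-module with a maximal vector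 of weight $\lambda$, that is, a nonzero homogeneous vector $v$ with $(\xi_iD_j)v=0$ for $i<j$ and $(\xi_iD_i)v=\lambda(\xi_iD_i)v$ for all $i$. Regard $M(\lambda)$ as a simple $u(W(n)^0)$-module by letting $W(n)^1M(\lambda)=0$. Then the induced module $$I(\lambda)=u(W(n))\otimes_{u(W(n)^0)}M(\lambda)$$ is simple if and only if $\lambda\notin\Lambda^a$, where $$\Lambda^a=\{a\eta_i+\eta_{i+1}+\dots+\eta_n\mid 1\le i\le n,\ a\in\mathbf F_p\}.$$ -/

import Mathlib

/-! ### Restricted Lie superalgebras of operators and their restricted enveloping algebras -/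

/-- The sign `(-1) ^ (i j)` attached to two parities. -/
def superSign (i j : ZMod 2) : ℤ := if i = 1 ∧ j = 1 then -1 else 1

/-- A restricted Lie sub-superalgebra of an associative algebra `A` equipped with a family
`𝒜 0, 𝒜 1` of even and odd subspaces: a `ℤ/2`-graded subspace, closed under the supercommutator
`[x, y] = x y - (-1)^{|x||y|} y x` of homogeneous elements, and closed under `x ↦ x ^ p` for
even `x`; this `p`-th power is the `p`-mapping. -/
structure RestrictedLieSub (p : ℕ) {F A : Type*} [Field F] [Ring A] [Algebra F A]
    (𝒜 : ZMod 2 → Submodule F A) where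
  carrier : Submodule F A
  graded : ∀ x ∈ carrier, ∃ y ∈ carrier, ∃ z ∈ carrier, y ∈ 𝒜 0 ∧ z ∈ 𝒜 1 ∧ x = y + z
  bracket_mem : ∀ i j : ZMod 2, ∀ x ∈ carrier, ∀ y ∈ carrier, x ∈ 𝒜 i → y ∈ 𝒜 j →
    x * y - superSign i j • (y * x) ∈ carrier
  pow_mem : ∀ x ∈ carrier, x ∈ 𝒜 0 → x ^ p ∈ carrier

namespace RestrictedLieSub

variable {p : ℕ} {F A : Type*} [Field F] [Ring A] [Algebra F A] {𝒜 : ZMod 2 → Submodule F A}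

/-- The defining relations, inside the tensor algebra, of the restricted enveloping algebra:
`x y - (-1)^{|x||y|} y x = [x, y]` for homogeneous `x, y`, and `x ^ p = x^{[p]}` for even `x`. -/
inductive EnvRel (L : RestrictedLieSub p 𝒜) :
    TensorAlgebra F L.carrier → TensorAlgebra F L.carrier → Prop
  | bracket (i j : ZMod 2) (x y : L.carrier) (hx : (x : A) ∈ 𝒜 i) (hy : (y : A) ∈ 𝒜 j) :
      EnvRel L
        (TensorAlgebra.ι F x * TensorAlgebra.ι F y -
          superSign i j • (TensorAlgebra.ι F y * TensorAlgebra.ι F x))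
        (TensorAlgebra.ι F ⟨(x : A) * y - superSign i j • ((y : A) * x),
          L.bracket_mem i j x x.2 y y.2 hx hy⟩)
  | pow (x : L.carrier) (hx : (x : A) ∈ 𝒜 0) :
      EnvRel L (TensorAlgebra.ι F x ^ p) (TensorAlgebra.ι F ⟨(x : A) ^ p, L.pow_mem x x.2 hx⟩)

/-- The restricted universal enveloping algebra `u(L)`. -/
def Env (L : RestrictedLieSub p 𝒜) : Type _ := RingQuot (EnvRel L)

noncomputable instance (L : RestrictedLieSub p 𝒜) : Ring (Env L) :=
  inferInstanceAs (Ring (RingQuot (EnvRel L)))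

noncomputable instance (L : RestrictedLieSub p 𝒜) : Algebra F (Env L) :=
  inferInstanceAs (Algebra F (RingQuot (EnvRel L)))

/-- The canonical map `L → u(L)`. -/
noncomputable def ι (L : RestrictedLieSub p 𝒜) : L.carrier →ₗ[F] Env L :=
  (RingQuot.mkAlgHom F (EnvRel L)).toLinearMap ∘ₗ TensorAlgebra.ι F

theorem ι_bracket (L : RestrictedLieSub p 𝒜) (i j : ZMod 2) (x y : L.carrier)
    (hx : (x : A) ∈ 𝒜 i) (hy : (y : A) ∈ 𝒜 j) :
    L.ι x * L.ι y - superSign i j • (L.ι y * L.ι x) =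
      L.ι ⟨(x : A) * y - superSign i j • ((y : A) * x), L.bracket_mem i j x x.2 y y.2 hx hy⟩ := by
  have h := RingQuot.mkAlgHom_rel F (EnvRel.bracket (L := L) i j x y hx hy)
  simp only [map_sub, map_mul, map_zsmul] at h
  exact h

theorem ι_pow (L : RestrictedLieSub p 𝒜) (x : L.carrier) (hx : (x : A) ∈ 𝒜 0) :
    L.ι x ^ p = L.ι ⟨(x : A) ^ p, L.pow_mem x x.2 hx⟩ := by
  have h := RingQuot.mkAlgHom_rel F (EnvRel.pow (L := L) x hx)
  simp only [map_pow] at h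
  exact h

/-- The algebra homomorphism `u(L₁) → u(L₂)` induced by an inclusion `L₁ ⊆ L₂`. -/
noncomputable def envMap {L₁ L₂ : RestrictedLieSub p 𝒜} (h : L₁.carrier ≤ L₂.carrier) :
    Env L₁ →ₐ[F] Env L₂ :=
  RingQuot.liftAlgHom F
    ⟨TensorAlgebra.lift F (L₂.ι ∘ₗ Submodule.inclusion h), by
      intro a b hab
      cases hab with
      | bracket i j x y hx hy =>
        simp only [map_sub, map_mul, map_zsmul, TensorAlgebra.lift_ι_apply, LinearMap.comp_apply]
        exact L₂.ι_bracket i j (Submodule.inclusion h x) (Submodule.inclusion h y) hx hy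
      | pow x hx =>
        simp only [map_pow, TensorAlgebra.lift_ι_apply, LinearMap.comp_apply]
        exact L₂.ι_pow (Submodule.inclusion h x) hx⟩

/-- The part of parity `k` of `u(L)`: the span of the products `x₁ ⋯ x_r` of homogeneous elements
of `L` whose parities add up to `k`. -/
noncomputable def envParity (L : RestrictedLieSub p 𝒜) (k : ZMod 2) : Submodule F (Env L) :=
  Submodule.span F {u | ∃ l : List (ZMod 2 × L.carrier),
    (∀ q ∈ l, (q.2 : A) ∈ 𝒜 q.1) ∧ (l.map Prod.fst).sum = k ∧ (l.map fun q => L.ι q.2).prod = u}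

/-- `M = M₀ ⊕ M₁` is a `ℤ/2`-graded `u(L)`-module. -/
structure IsSupermodule (L : RestrictedLieSub p 𝒜) {M : Type*} [AddCommGroup M] [Module F M]
    [Module (Env L) M] (𝓜 : ZMod 2 → Submodule F M) : Prop where
  isInternal : DirectSum.IsInternal 𝓜
  smul_mem : ∀ (i j : ZMod 2) (x : L.carrier) (m : M),
    (x : A) ∈ 𝒜 i → m ∈ 𝓜 j → L.ι x • m ∈ 𝓜 (i + j)

end RestrictedLieSub

/-- A module with a `ℤ/2`-grading is simple if it is nonzero and has no `ℤ/2`-graded submodules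
besides `0` and itself. -/
def IsSimpleSupermodule {F : Type*} [Field F] (R : Type*) [Ring R] {M : Type*} [AddCommGroup M]
    [Module F M] [Module R M] (𝓜 : ZMod 2 → Submodule F M) : Prop :=
  Nontrivial M ∧ ∀ N : Submodule R M,
    (∀ x ∈ N, ∃ y ∈ N, ∃ z ∈ N, y ∈ 𝓜 0 ∧ z ∈ 𝓜 1 ∧ x = y + z) → N = ⊥ ∨ N = ⊤

section Induced

open scoped TensorProduct

variable {F : Type*} [Field F] {B U : Type*} [Ring B] [Algebra F B] [Ring U] [Algebra F U]

/-- The relations `(a b) ⊗ m = a ⊗ (b m)` cutting out `U ⊗_B M` from `U ⊗_F M`. -/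
def inducedRel (φ : B →ₐ[F] U) (M : Type*) [AddCommGroup M] [Module F M] [Module B M] :
    Submodule U (U ⊗[F] M) :=
  Submodule.span U {z | ∃ (a : U) (b : B) (m : M), z = (a * φ b) ⊗ₜ[F] m - a ⊗ₜ[F] (b • m)}

/-- The induced left `U`-module `U ⊗_B M`, where `U` is a right `B`-module through `φ : B → U`. -/
abbrev InducedModule (φ : B →ₐ[F] U) (M : Type*) [AddCommGroup M] [Module F M] [Module B M] :
    Type _ :=
  (U ⊗[F] M) ⧸ inducedRel φ M

/-- The part of parity `k` of `U ⊗_B M`: the span of all `a ⊗ m` with `|a| + |m| = k`. -/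
def inducedParity (φ : B →ₐ[F] U) (𝒰 : ZMod 2 → Submodule F U) {M : Type*} [AddCommGroup M]
    [Module F M] [Module B M] (𝓜 : ZMod 2 → Submodule F M) (k : ZMod 2) :
    Submodule F (InducedModule φ M) :=
  Submodule.span F {z | ∃ (i j : ZMod 2) (a : U) (m : M), i + j = k ∧ a ∈ 𝒰 i ∧ m ∈ 𝓜 j ∧
    z = (inducedRel φ M).mkQ (a ⊗ₜ[F] m)}

end Induced

/-! ### The Witt superalgebra `W(n)` -/

namespace WittSuper

open CliffordAlgebra (evenOdd)

variable (F : Type*) [Field F] (n : ℕ)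

/-- The exterior algebra `Λ(n)` on `n` generators. -/
abbrev Lam : Type _ := ExteriorAlgebra F (Fin n → F)

/-- The `ℤ/2`-grading of `Λ(n)`: sums of monomials of even, respectively odd, length. -/
abbrev lamParity (k : ZMod 2) : Submodule F (Lam F n) :=
  evenOdd (0 : QuadraticForm F (Fin n → F)) k

variable {n}

/-- The generators `ξ_i` of `Λ(n)`. -/
noncomputable def xi (i : Fin n) : Lam F n := ExteriorAlgebra.ι F (Pi.single i (1 : F))

/-- The odd superderivation `D_i` of `Λ(n)`, determined by `D_i 1 = 0` and
`D_i (v g) = v_i g - v D_i g` for `v` in the span of the generators. -/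
noncomputable def D (i : Fin n) : Module.End F (Lam F n) :=
  CliffordAlgebra.contractLeft (Q := (0 : QuadraticForm F (Fin n → F))) (LinearMap.proj i)

/-- The operator `f D_i : g ↦ f · D_i g` on `Λ(n)`. -/
noncomputable def fD (f : Lam F n) (i : Fin n) : Module.End F (Lam F n) :=
  LinearMap.mulLeft F f * D F i

variable (n)

/-- The operators on `Λ(n)` of parity `k`. -/
def endParity (k : ZMod 2) : Submodule F (Module.End F (Lam F n)) where
  carrier := {T | ∀ j, ∀ f ∈ lamParity F n j, T f ∈ lamParity F n (k + j)}
  add_mem' := fun hS hT j f hf => Submodule.add_mem _ (hS j f hf) (hT j f hf)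
  zero_mem' := fun _ _ _ => Submodule.zero_mem _
  smul_mem' := fun c _ hT j f hf => Submodule.smul_mem _ c (hT j f hf)

/-- The subspace `W(n) = ∑ Λ(n) D_i` of the operators on `Λ(n)`. -/
def wittSpace : Submodule F (Module.End F (Lam F n)) :=
  Submodule.span F {T | ∃ (f : Lam F n) (i : Fin n), T = fD F f i}

/-- The component `W(n)_k`: the span of the `f D_i` with `f ∈ Λ(n)` of degree `k + 1`. -/
def wittComp (k : ℤ) : Submodule F (Module.End F (Lam F n)) :=
  Submodule.span F {T | ∃ (d : ℕ) (f : Lam F n) (i : Fin n),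
    (d : ℤ) = k + 1 ∧ f ∈ ⋀[F]^d (Fin n → F) ∧ T = fD F f i}

/-- The subspace `W(n)^k = ∑_{j ≥ k} W(n)_j`. -/
def wittFil (k : ℤ) : Submodule F (Module.End F (Lam F n)) :=
  ⨆ j : {j : ℤ // k ≤ j}, wittComp F n j

/-! #### Closure of `W(n)` and `W(n)^0` under brackets and even `p`-th powers -/

theorem zmod_two (i : ZMod 2) : i = 0 ∨ i = 1 := by
  revert i; decide

theorem superSign_zero_right (i : ZMod 2) : superSign i 0 = 1 := by
  revert i; decide

theorem superSign_zero_left (i : ZMod 2) : superSign 0 i = 1 := by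
  revert i; decide

theorem superSign_succ (i : ZMod 2) : superSign (i + 1) 1 = -superSign i 1 := by
  revert i; decide

theorem one_add_one_add (i : ZMod 2) : 1 + (1 + i) = i := by
  revert i; decide

theorem superSign_swap (i j : ZMod 2) : superSign i j = superSign j i := by
  revert i j; decide

theorem superSign_mul_self (i j : ZMod 2) : superSign i j * superSign i j = 1 := by
  revert i j; decide

theorem superSign_add (i j k : ZMod 2) :
    superSign (i + j) k = superSign i k * superSign j k := by
  revert i j k; decide

variable {F n}

theorem exists_parity (f : Lam F n) :
    ∃ a ∈ lamParity F n 0, ∃ b ∈ lamParity F n 1, f = a + b := by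
  have h := (CliffordAlgebra.evenOdd_isCompl (0 : QuadraticForm F (Fin n → F))).sup_eq_top
  have hf : f ∈ lamParity F n 0 ⊔ lamParity F n 1 := by rw [h]; trivial
  obtain ⟨a, ha, b, hb, hab⟩ := Submodule.mem_sup.1 hf
  exact ⟨a, ha, b, hb, hab.symm⟩

theorem parity_unique {f : Lam F n} (h0 : f ∈ lamParity F n 0) (h1 : f ∈ lamParity F n 1) :
    f = 0 :=
  Submodule.disjoint_def.1
    (CliffordAlgebra.evenOdd_isCompl (0 : QuadraticForm F (Fin n → F))).disjoint f h0 h1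

theorem endParity_unique {T : Module.End F (Lam F n)} (h0 : T ∈ endParity F n 0)
    (h1 : T ∈ endParity F n 1) : T = 0 := by
  have key : ∀ j, ∀ f ∈ lamParity F n j, T f = 0 := by
    intro j f hf
    have a := h0 j f hf
    have b := h1 j f hf
    rcases zmod_two j with rfl | rfl
    · exact parity_unique (by simpa using a) (by simpa using b)
    · have e : (1 : ZMod 2) + 1 = 0 := rfl
      rw [e] at b
      exact parity_unique b (by simpa using a)
  refine LinearMap.ext fun f => ?_
  obtain ⟨a, ha, b, hb, rfl⟩ := exists_parity f
  simp [key 0 a ha, key 1 b hb]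

theorem endParity_mul {i j : ZMod 2} {S T : Module.End F (Lam F n)} (hS : S ∈ endParity F n i)
    (hT : T ∈ endParity F n j) : S * T ∈ endParity F n (i + j) := by
  intro k f hf
  have := hS _ _ (hT k f hf)
  rwa [← add_assoc] at this

theorem mem_parity_of_mem_power {d : ℕ} {f : Lam F n} (hf : f ∈ ⋀[F]^d (Fin n → F)) :
    f ∈ lamParity F n (d : ZMod 2) :=
  Submodule.mem_iSup_of_mem
    (p := fun j : {m : ℕ // (m : ZMod 2) = (d : ZMod 2)} =>
      LinearMap.range (CliffordAlgebra.ι (0 : QuadraticForm F (Fin n → F))) ^ (j : ℕ))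
    ⟨d, rfl⟩ hf

theorem D_ι_mul (i : Fin n) (v : Fin n → F) (g : Lam F n) :
    D F i (ExteriorAlgebra.ι F v * g) = v i • g - ExteriorAlgebra.ι F v * D F i g :=
  CliffordAlgebra.contractLeft_ι_mul _ _ _

theorem D_algebraMap (i : Fin n) (r : F) : D F i (algebraMap F (Lam F n) r) = 0 :=
  CliffordAlgebra.contractLeft_algebraMap _ _ _

theorem ι_mem_parity (v : Fin n → F) : ExteriorAlgebra.ι F v ∈ lamParity F n 1 :=
  CliffordAlgebra.ι_mem_evenOdd_one _ _

theorem D_parity (i : Fin n) : D F i ∈ endParity F n 1 := by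
  intro j f hf
  induction f, hf using CliffordAlgebra.evenOdd_induction with
  | range_ι_pow v h =>
    have hj := zmod_two j
    rcases hj with rfl | rfl
    · have hv : v ∈ (1 : Submodule F (Lam F n)) := by simpa using h
      obtain ⟨r, rfl⟩ := Submodule.mem_one.1 hv
      rw [D_algebraMap]; exact Submodule.zero_mem _
    · have hv : v ∈ LinearMap.range
          (CliffordAlgebra.ι (0 : QuadraticForm F (Fin n → F))) := by
        have e : (1 : ZMod 2).val = 1 := rfl
        rw [e, pow_one] at h; exact h
      obtain ⟨w, rfl⟩ := hv
      have e : D F i (ExteriorAlgebra.ι F w) = algebraMap F _ (w i) :=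
        CliffordAlgebra.contractLeft_ι _ _ _
      have e2 : (1 : ZMod 2) + 1 = 0 := rfl
      rw [e2]
      change D F i (ExteriorAlgebra.ι F w) ∈ _
      rw [e]
      exact CliffordAlgebra.one_le_evenOdd_zero _ (Submodule.mem_one.2 ⟨_, rfl⟩)
  | add x y hx hy ihx ihy => rw [map_add]; exact Submodule.add_mem _ ihx ihy
  | ι_mul_ι_mul v w x hx ih =>
    have key : ∀ (k : ZMod 2) (u : Fin n → F) (y : Lam F n), y ∈ lamParity F n k →
        D F i y ∈ lamParity F n (1 + k) →
        D F i (ExteriorAlgebra.ι F u * y) ∈ lamParity F n k := by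
      intro k u y hy hDy
      rw [D_ι_mul]
      refine Submodule.sub_mem _ (Submodule.smul_mem _ _ hy) ?_
      have := SetLike.mul_mem_graded (ι_mem_parity u) hDy
      have e := one_add_one_add k
      rwa [e] at this
    have h1 := key j w x hx ih
    have h2 := SetLike.mul_mem_graded (ι_mem_parity w) hx
    have e := one_add_one_add j
    have h3 := key (1 + j) v _ h2 (by rwa [e])
    rw [mul_assoc]
    exact h3

theorem fD_parity {k : ZMod 2} {f : Lam F n} (hf : f ∈ lamParity F n k) (i : Fin n) :
    fD F f i ∈ endParity F n (k + 1) :=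
  endParity_mul (fun _ _ hg => SetLike.mul_mem_graded hf hg) (D_parity i)

theorem ι_comm {k : ZMod 2} (v : Fin n → F) {f : Lam F n} (hf : f ∈ lamParity F n k) :
    f * ExteriorAlgebra.ι F v = superSign k 1 • (ExteriorAlgebra.ι F v * f) := by
  have inv : ∀ f : Lam F n, CliffordAlgebra.involute f * ExteriorAlgebra.ι F v =
      ExteriorAlgebra.ι F v * f := by
    intro f
    induction f using CliffordAlgebra.left_induction with
    | algebraMap r => simpa using (Algebra.commutes r _)
    | add x y hx hy => simp [add_mul, mul_add, hx, hy]
    | ι_mul x w hx =>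
      have h := ExteriorAlgebra.ι_add_mul_swap (R := F) v w
      have h' : ExteriorAlgebra.ι F v * ExteriorAlgebra.ι F w =
        -(ExteriorAlgebra.ι F w * ExteriorAlgebra.ι F v) := eq_neg_of_add_eq_zero_left h
      rw [map_mul, CliffordAlgebra.involute_ι, mul_assoc, hx, ← mul_assoc, ← mul_assoc]
      change -ExteriorAlgebra.ι F w * ExteriorAlgebra.ι F v * x =
        ExteriorAlgebra.ι F v * ExteriorAlgebra.ι F w * x
      rw [h', neg_mul]
  have hk := zmod_two k
  have e := inv f
  rcases hk with rfl | rfl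
  · rw [CliffordAlgebra.involute_eq_of_mem_even hf] at e
    simpa [superSign] using e
  · rw [CliffordAlgebra.involute_eq_of_mem_odd hf] at e
    simp only [superSign, and_self, if_true, neg_smul, one_smul]
    rw [← e, neg_mul, neg_neg]

/-- Superderivations of parity `k` of `Λ(n)`. -/
def IsSuperDer (k : ZMod 2) (T : Module.End F (Lam F n)) : Prop :=
  T ∈ endParity F n k ∧ ∀ j, ∀ f ∈ lamParity F n j, ∀ g : Lam F n,
    T (f * g) = T f * g + superSign k j • (f * T g)

theorem isSuperDer_of_ι {k : ZMod 2} {T : Module.End F (Lam F n)} (hT : T ∈ endParity F n k)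
    (h1 : T 1 = 0)
    (h : ∀ (v : Fin n → F) (g : Lam F n), T (ExteriorAlgebra.ι F v * g) =
      T (ExteriorAlgebra.ι F v) * g + superSign k 1 • (ExteriorAlgebra.ι F v * T g)) :
    IsSuperDer k T := by
  have hr : ∀ r : F, T (algebraMap F _ r) = 0 := fun r => by
    rw [Algebra.algebraMap_eq_smul_one, map_smul, h1, smul_zero]
  have key : ∀ (j : ZMod 2) (v : Fin n → F) (f : Lam F n),
      (∀ g, T (f * g) = T f * g + superSign k j • (f * T g)) →
      ∀ g, T (ExteriorAlgebra.ι F v * f * g) = T (ExteriorAlgebra.ι F v * f) * g +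
        superSign k (1 + j) • (ExteriorAlgebra.ι F v * f * T g) := by
    intro j v f hf g
    rw [mul_assoc, h, hf g, h v f, superSign_swap k (1 + j), superSign_add, superSign_swap 1 k,
      superSign_swap j k]
    simp only [mul_add, add_mul, mul_assoc, smul_add, smul_mul_assoc, mul_smul_comm, smul_smul,
      add_assoc]
  refine ⟨hT, fun j f hf => ?_⟩
  induction f, hf using CliffordAlgebra.evenOdd_induction with
  | range_ι_pow v hv =>
    have hj := zmod_two j
    rcases hj with rfl | rfl
    · have hv : v ∈ (1 : Submodule F (Lam F n)) := by simpa using hv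
      obtain ⟨r, rfl⟩ := Submodule.mem_one.1 hv
      intro g
      rw [hr, ← Algebra.smul_def, map_smul, ← Algebra.smul_def, zero_mul, zero_add]
      have e := superSign_zero_right k
      rw [e, one_smul]
    · have e : (1 : ZMod 2).val = 1 := rfl
      rw [e, pow_one] at hv
      obtain ⟨w, rfl⟩ := hv
      exact fun g => h w g
  | add x y hx hy ihx ihy =>
    intro g
    rw [add_mul, map_add, ihx, ihy, map_add, add_mul, add_mul, smul_add]
    abel
  | ι_mul_ι_mul v w x hx ih =>
    intro g
    have h1 := key _ v _ (key j w x ih) g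
    have e := one_add_one_add j
    rw [e] at h1
    rw [mul_assoc (CliffordAlgebra.ι _ v)]
    exact h1

theorem fD_isSuperDer {k : ZMod 2} {f : Lam F n} (hf : f ∈ lamParity F n k) (i : Fin n) :
    IsSuperDer (k + 1) (fD F f i) := by
  have h1 : D F i (1 : Lam F n) = 0 := CliffordAlgebra.contractLeft_one _ _
  refine isSuperDer_of_ι (fD_parity hf i) ?_ fun v g => ?_
  · change f * D F i 1 = 0
    rw [h1, mul_zero]
  · have e : D F i (ExteriorAlgebra.ι F v) = algebraMap F _ (v i) :=
      CliffordAlgebra.contractLeft_ι _ _ _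
    change f * D F i (ExteriorAlgebra.ι F v * g) = f * D F i (ExteriorAlgebra.ι F v) * g +
      superSign (k + 1) 1 • (ExteriorAlgebra.ι F v * (f * D F i g))
    rw [D_ι_mul, e, mul_sub, ← mul_assoc f, ι_comm v hf, superSign_add]
    have e1 : superSign 1 1 = -1 := by decide
    rw [e1, ← Algebra.commutes, ← Algebra.smul_def, mul_smul_comm, smul_mul_assoc, mul_neg_one,
      neg_smul, smul_mul_assoc, mul_assoc, sub_eq_add_neg]

theorem xi_sum (v : Fin n → F) : ExteriorAlgebra.ι F v = ∑ i, v i • xi F i := by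
  conv_lhs => rw [pi_eq_sum_univ' v]
  rw [map_sum]
  refine Finset.sum_congr rfl fun i _ => ?_
  rw [map_smul]
  rfl

theorem IsSuperDer.eq_sum {k : ZMod 2} {T : Module.End F (Lam F n)} (hT : IsSuperDer k T) :
    T = ∑ i, fD F (T (xi F i)) i := by
  have h1 : T 1 = 0 := by
    have := hT.2 0 1 (SetLike.one_mem_graded _) 1
    have e := superSign_zero_right k
    rw [e, one_smul, mul_one, mul_one, one_mul] at this
    exact left_eq_add.1 this
  refine LinearMap.ext fun g => ?_
  rw [LinearMap.sum_apply]
  change T g = ∑ i, T (xi F i) * D F i g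
  induction g using CliffordAlgebra.left_induction with
  | algebraMap r =>
    have e : ∀ i : Fin n, D F i (algebraMap F (Lam F n) r) = 0 := fun i => D_algebraMap i r
    simp only [e, mul_zero, Finset.sum_const_zero]
    rw [Algebra.algebraMap_eq_smul_one, map_smul, h1, smul_zero]
  | add x y hx hy => simp only [map_add, mul_add, Finset.sum_add_distrib, hx, hy]
  | ι_mul x v hx =>
    have e1 := hT.2 1 _ (ι_mem_parity v) x
    change T (ExteriorAlgebra.ι F v * x) = ∑ i, T (xi F i) * D F i (ExteriorAlgebra.ι F v * x)
    rw [e1, hx]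
    simp only [D_ι_mul, mul_sub, Finset.sum_sub_distrib]
    have e2 : T (ExteriorAlgebra.ι F v) * x = ∑ i, T (xi F i) * v i • x := by
      rw [xi_sum v, map_sum, Finset.sum_mul]
      refine Finset.sum_congr rfl fun i _ => ?_
      rw [map_smul, smul_mul_assoc, mul_smul_comm]
    rw [e2, sub_eq_add_neg, ← Finset.sum_neg_distrib, Finset.mul_sum, Finset.smul_sum]
    congr 1
    refine Finset.sum_congr rfl fun i _ => ?_
    have hp : T (xi F i) ∈ lamParity F n (k + 1) := hT.1 1 _ (ι_mem_parity _)
    have hs := superSign_succ k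
    rw [← mul_assoc (T (xi F i)), ι_comm v hp, hs, neg_smul, neg_mul, neg_neg, smul_mul_assoc,
      mul_assoc]

theorem IsSuperDer.mem {k : ZMod 2} {T : Module.End F (Lam F n)} (hT : IsSuperDer k T) :
    T ∈ wittSpace F n := by
  rw [hT.eq_sum]
  exact Submodule.sum_mem _ fun i _ => Submodule.subset_span ⟨_, _, rfl⟩

theorem IsSuperDer.add {k : ZMod 2} {S T : Module.End F (Lam F n)} (hS : IsSuperDer k S)
    (hT : IsSuperDer k T) : IsSuperDer k (S + T) := by
  refine ⟨Submodule.add_mem _ hS.1 hT.1, fun j f hf g => ?_⟩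
  simp only [LinearMap.add_apply, hS.2 j f hf g, hT.2 j f hf g, add_mul, mul_add, smul_add]
  abel

theorem isSuperDer_zero (k : ZMod 2) : IsSuperDer k (0 : Module.End F (Lam F n)) :=
  ⟨Submodule.zero_mem _, fun j f hf g => by simp⟩

theorem IsSuperDer.smul {k : ZMod 2} {T : Module.End F (Lam F n)} (c : F)
    (hT : IsSuperDer k T) : IsSuperDer k (c • T) := by
  refine ⟨Submodule.smul_mem _ _ hT.1, fun j f hf g => ?_⟩
  simp only [LinearMap.smul_apply, hT.2 j f hf g, smul_add, smul_mul_assoc, mul_smul_comm]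
  rw [smul_comm c]

theorem exists_superDer {T : Module.End F (Lam F n)} (hT : T ∈ wittSpace F n) :
    ∃ S₀ S₁, IsSuperDer 0 S₀ ∧ IsSuperDer 1 S₁ ∧ T = S₀ + S₁ := by
  induction hT using Submodule.span_induction with
  | mem x hx =>
    obtain ⟨f, i, rfl⟩ := hx
    obtain ⟨a, ha, b, hb, rfl⟩ := exists_parity f
    refine ⟨fD F b i, fD F a i, fD_isSuperDer hb i, by simpa using fD_isSuperDer ha i, ?_⟩
    refine LinearMap.ext fun g => ?_
    change (a + b) * D F i g = b * D F i g + a * D F i g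
    rw [add_mul, add_comm]
  | zero => exact ⟨0, 0, isSuperDer_zero _, isSuperDer_zero _, by simp⟩
  | add x y _ _ hx hy =>
    obtain ⟨a, b, ha, hb, rfl⟩ := hx
    obtain ⟨c, d, hc, hd, rfl⟩ := hy
    exact ⟨a + c, b + d, ha.add hc, hb.add hd, by abel⟩
  | smul c x _ hx =>
    obtain ⟨a, b, ha, hb, rfl⟩ := hx
    exact ⟨c • a, c • b, ha.smul c, hb.smul c, by rw [smul_add]⟩

theorem isSuperDer_of_mem {k : ZMod 2} {T : Module.End F (Lam F n)} (hT : T ∈ wittSpace F n)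
    (hk : T ∈ endParity F n k) : IsSuperDer k T := by
  obtain ⟨a, b, ha, hb, rfl⟩ := exists_superDer hT
  have hk' := zmod_two k
  rcases hk' with rfl | rfl
  · have : b ∈ endParity F n 0 := by simpa using Submodule.sub_mem _ hk ha.1
    rw [endParity_unique this hb.1, add_zero]; exact ha
  · have : a ∈ endParity F n 1 := by simpa using Submodule.sub_mem _ hk hb.1
    rw [endParity_unique ha.1 this, zero_add]; exact hb

theorem IsSuperDer.bracket {k l : ZMod 2} {S T : Module.End F (Lam F n)} (hS : IsSuperDer k S)
    (hT : IsSuperDer l T) : IsSuperDer (k + l) (S * T - superSign k l • (T * S)) := by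
  refine ⟨Submodule.sub_mem _ (endParity_mul hS.1 hT.1) ?_, fun j f hf g => ?_⟩
  · refine zsmul_mem ?_ _
    rw [add_comm]
    exact endParity_mul hT.1 hS.1
  · simp only [LinearMap.sub_apply, LinearMap.smul_apply, Module.End.mul_apply,
      hT.2 j f hf, hS.2 j f hf, map_add, map_zsmul, hS.2 _ _ (hT.1 j f hf),
      hT.2 _ _ (hS.1 j f hf)]
    have hk := zmod_two k
    have hl := zmod_two l
    have hj := zmod_two j
    have s00 : superSign 0 0 = 1 := by decide
    have s01 : superSign 0 1 = 1 := by decide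
    have s10 : superSign 1 0 = 1 := by decide
    have s11 : superSign 1 1 = -1 := by decide
    have e : (1 : ZMod 2) + 1 = 0 := rfl
    rcases hk with rfl | rfl <;> rcases hl with rfl | rfl <;> rcases hj with rfl | rfl <;>
      simp only [e, add_zero, zero_add, s00, s01, s10, s11, neg_smul, one_smul] <;>
      noncomm_ring

theorem IsSuperDer.pow_char (p : ℕ) [Fact p.Prime] [CharP F p] {T : Module.End F (Lam F n)}
    (hT : IsSuperDer 0 T) : IsSuperDer 0 (T ^ p) := by
  have hL : ∀ f g : Lam F n, T (f * g) = T f * g + f * T g := by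
    intro f g
    obtain ⟨a, ha, b, hb, rfl⟩ := exists_parity f
    have s00 : superSign 0 0 = 1 := by decide
    have s01 : superSign 0 1 = 1 := by decide
    have h0 := hT.2 0 a ha g
    have h1 := hT.2 1 b hb g
    rw [s00, one_smul] at h0
    rw [s01, one_smul] at h1
    rw [add_mul, map_add, h0, h1, map_add, add_mul, add_mul]
    abel
  have hpar : ∀ r : ℕ, T ^ r ∈ endParity F n 0 := by
    intro r
    induction r with
    | zero => intro j f hf; simpa using hf
    | succ r ih => rw [pow_succ]; simpa using endParity_mul ih hT.1
  let R := Module.End F (Module.End F (Lam F n))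
  let adT : R := LinearMap.mulLeft F T - LinearMap.mulRight F T
  have had : ∀ (r : ℕ) (f : Lam F n),
      (adT ^ r) (LinearMap.mulLeft F f) = LinearMap.mulLeft F ((T ^ r) f) := by
    intro r
    induction r with
    | zero => intro f; rfl
    | succ r ih =>
      intro f
      rw [pow_succ, Module.End.mul_apply, pow_succ, Module.End.mul_apply, ← ih]
      congr 1
      refine LinearMap.ext fun g => ?_
      change T (f * g) - f * T g = T f * g
      rw [hL]; abel
  have : CharP R p := charP_of_injective_algebraMap (algebraMap F R).injective p
  have hc : Commute (LinearMap.mulLeft F T : R) (LinearMap.mulRight F T) :=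
    LinearMap.commute_mulLeft_right T T
  have hp : adT ^ p = LinearMap.mulLeft F (T ^ p) - LinearMap.mulRight F (T ^ p) := by
    rw [← LinearMap.pow_mulLeft, ← LinearMap.pow_mulRight]
    exact sub_pow_char_of_commute (R := R) p hc
  refine ⟨hpar p, fun j f hf g => ?_⟩
  have h := LinearMap.congr_fun (had p f) g
  rw [hp] at h
  change (T ^ p) (f * g) - f * (T ^ p) g = (T ^ p) f * g at h
  have s := superSign_zero_left j
  rw [s, one_smul, ← h]
  abel

theorem wittFil_le (k : ℤ) : wittFil F n k ≤ wittSpace F n := by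
  refine iSup_le fun j => Submodule.span_mono ?_
  rintro _ ⟨d, f, i, -, -, rfl⟩
  exact ⟨f, i, rfl⟩

theorem wittFil_graded {k : ℤ} {T : Module.End F (Lam F n)} (hT : T ∈ wittFil F n k) :
    ∃ y ∈ wittFil F n k, ∃ z ∈ wittFil F n k,
      y ∈ endParity F n 0 ∧ z ∈ endParity F n 1 ∧ T = y + z := by
  have h : wittFil F n k ≤
      (wittFil F n k ⊓ endParity F n 0) ⊔ (wittFil F n k ⊓ endParity F n 1) := by
    refine iSup_le fun j => Submodule.span_le.2 ?_
    rintro _ ⟨d, f, i, hd, hf, rfl⟩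
    have hm : fD F f i ∈ wittFil F n k :=
      Submodule.mem_iSup_of_mem j (Submodule.subset_span ⟨d, f, i, hd, hf, rfl⟩)
    have hp := fD_parity (mem_parity_of_mem_power hf) i
    rcases zmod_two ((d : ZMod 2) + 1) with hk | hk <;> rw [hk] at hp
    · exact Submodule.mem_sup_left ⟨hm, hp⟩
    · exact Submodule.mem_sup_right ⟨hm, hp⟩
  obtain ⟨y, hy, z, hz, hyz⟩ := Submodule.mem_sup.1 (h hT)
  exact ⟨y, hy.1, z, hz.1, hy.2, hz.2, hyz.symm⟩

theorem fD_mem_wittFil {f : Lam F n} (hf : ExteriorAlgebra.algebraMapInv f = 0) (i : Fin n) :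
    fD F f i ∈ wittFil F n 0 := by
  classical
  let lin : Lam F n →ₗ[F] Module.End F (Lam F n) :=
    LinearMap.mulRight F (D F i) ∘ₗ LinearMap.mul F (Lam F n)
  have hlin : ∀ g, lin g = fD F g i := fun g => rfl
  have hd : ∀ d : ℕ, 1 ≤ d → ∀ g ∈ ⋀[F]^d (Fin n → F), fD F g i ∈ wittFil F n 0 := by
    intro d hd g hg
    refine Submodule.mem_iSup_of_mem
      (⟨(d : ℤ) - 1, by omega⟩ : {j : ℤ // (0 : ℤ) ≤ j}) (Submodule.subset_span ?_)
    exact ⟨d, g, i, by simp, hg, rfl⟩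
  have hpos : ∀ d : ℕ, 1 ≤ d → ∀ g ∈ ⋀[F]^d (Fin n → F),
      ExteriorAlgebra.algebraMapInv g = 0 := by
    intro d hd g hg
    obtain ⟨d, rfl⟩ : ∃ e, d = e + 1 := ⟨d - 1, by omega⟩
    change g ∈ LinearMap.range (ExteriorAlgebra.ι F (M := Fin n → F)) ^ (d + 1) at hg
    rw [pow_succ] at hg
    induction hg using Submodule.mul_induction_on' with
    | mem_mul_mem a _ b hb =>
      obtain ⟨v, rfl⟩ := hb
      simp [ExteriorAlgebra.algebraMapInv]
    | add x _ y _ hx hy => rw [map_add, hx, hy, add_zero]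
  have hsum := DirectSum.sum_support_decompose (fun i : ℕ => ⋀[F]^i (Fin n → F)) f
  rw [← hlin, ← hsum, map_sum]
  refine Submodule.sum_mem _ fun d _ => ?_
  rcases Nat.eq_zero_or_pos d with rfl | hdp
  · have h0 : (DirectSum.decompose (fun i : ℕ => ⋀[F]^i (Fin n → F)) f 0 : Lam F n) = 0 := by
      have hmem := (DirectSum.decompose (fun i : ℕ => ⋀[F]^i (Fin n → F)) f 0).2
      have hmem' : (DirectSum.decompose (fun i : ℕ => ⋀[F]^i (Fin n → F)) f 0 : Lam F n) ∈
          (1 : Submodule F (Lam F n)) := by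
        simpa using hmem
      obtain ⟨r, hr⟩ := Submodule.mem_one.1 hmem'
      have hz : ∀ d : ℕ, d ≠ 0 → ExteriorAlgebra.algebraMapInv
          (DirectSum.decompose (fun i : ℕ => ⋀[F]^i (Fin n → F)) f d : Lam F n) = 0 :=
        fun d hd => hpos d (Nat.one_le_iff_ne_zero.2 hd) _
          (DirectSum.decompose (fun i : ℕ => ⋀[F]^i (Fin n → F)) f d).2
      have h2 : ExteriorAlgebra.algebraMapInv
          (DirectSum.decompose (fun i : ℕ => ⋀[F]^i (Fin n → F)) f 0 : Lam F n) = 0 := by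
        have h3 := hf
        rw [← hsum, map_sum] at h3
        by_cases hs : 0 ∈ (DirectSum.decompose (fun i : ℕ => ⋀[F]^i (Fin n → F)) f).support
        · rwa [Finset.sum_eq_single_of_mem 0 hs fun d _ hd => hz d hd] at h3
        · rw [DFinsupp.notMem_support_iff] at hs
          rw [hs]; simp
      rw [← hr] at h2 ⊢
      rw [ExteriorAlgebra.algebraMap_leftInverse (R := F) (Fin n → F) r] at h2
      rw [h2, map_zero]
    rw [h0, map_zero]
    exact Submodule.zero_mem _
  · rw [hlin]
    exact hd d hdp _ (DirectSum.decompose (fun i : ℕ => ⋀[F]^i (Fin n → F)) f d).2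

theorem algebraMapInv_of_mem {T : Module.End F (Lam F n)} (hT : T ∈ wittFil F n 0)
    (g : Lam F n) : ExteriorAlgebra.algebraMapInv (T g) = 0 := by
  have hle : wittFil F n 0 ≤
      LinearMap.ker (((ExteriorAlgebra.algebraMapInv (R := F) (M := Fin n → F)).toLinearMap ∘ₗ
        LinearMap.applyₗ g : Module.End F (Lam F n) →ₗ[F] F)) := by
    refine iSup_le fun j => Submodule.span_le.2 ?_
    rintro _ ⟨d, f, i, hd, hf, rfl⟩
    have hj := j.2
    obtain ⟨d, rfl⟩ : ∃ e, d = e + 1 := ⟨d - 1, by omega⟩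
    change ExteriorAlgebra.algebraMapInv (f * D F i g) = 0
    rw [map_mul]
    have : ExteriorAlgebra.algebraMapInv f = 0 := by
      change f ∈ LinearMap.range (ExteriorAlgebra.ι F (M := Fin n → F)) ^ (d + 1) at hf
      rw [pow_succ] at hf
      induction hf using Submodule.mul_induction_on' with
      | mem_mul_mem a _ b hb =>
        obtain ⟨v, rfl⟩ := hb
        simp [ExteriorAlgebra.algebraMapInv]
      | add x _ y _ hx hy => rw [map_add, hx, hy, add_zero]
    rw [this, zero_mul]
  exact hle hT

theorem IsSuperDer.mem_wittFil {k : ZMod 2} {T : Module.End F (Lam F n)} (hT : IsSuperDer k T)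
    (h : ∀ g, ExteriorAlgebra.algebraMapInv (T g) = 0) : T ∈ wittFil F n 0 := by
  rw [hT.eq_sum]
  exact Submodule.sum_mem _ fun i _ => fD_mem_wittFil (h _) i

variable (F n) (p : ℕ) [Fact p.Prime] [CharP F p]

/-- The restricted Lie superalgebra `W(n)`. -/
def W : RestrictedLieSub p (endParity F n) where
  carrier := wittSpace F n
  graded := fun x hx => by
    obtain ⟨a, b, ha, hb, rfl⟩ := exists_superDer hx
    exact ⟨a, ha.mem, b, hb.mem, ha.1, hb.1, rfl⟩
  bracket_mem := fun i j x hx y hy hi hj =>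
    ((isSuperDer_of_mem hx hi).bracket (isSuperDer_of_mem hy hj)).mem
  pow_mem := fun x hx h0 => ((isSuperDer_of_mem hx h0).pow_char p).mem

/-- The restricted Lie sub-superalgebra `W(n)^0 = ∑_{j ≥ 0} W(n)_j` of `W(n)`. -/
def W0 : RestrictedLieSub p (endParity F n) where
  carrier := wittFil F n 0
  graded := fun x hx => wittFil_graded hx
  bracket_mem := fun i j x hx y hy hi hj =>
    ((isSuperDer_of_mem (wittFil_le 0 hx) hi).bracket
      (isSuperDer_of_mem (wittFil_le 0 hy) hj)).mem_wittFil fun g => by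
        rw [LinearMap.sub_apply, LinearMap.smul_apply, map_sub, map_zsmul]
        simp [algebraMapInv_of_mem hx, algebraMapInv_of_mem hy]
  pow_mem := fun x hx h0 =>
    ((isSuperDer_of_mem (wittFil_le 0 hx) h0).pow_char p).mem_wittFil fun g => by
      obtain ⟨q, hq⟩ : ∃ q, p = q + 1 :=
        ⟨p - 1, by have := (Fact.out : p.Prime).pos; omega⟩
      rw [hq, pow_succ']
      exact algebraMapInv_of_mem hx _

/-- The inclusion `W(n)^0 ⊆ W(n)`. -/
theorem W0_le_W : (W0 F n p).carrier ≤ (W F n p).carrier := wittFil_le 0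

variable {n}

/-- The element `ξ_i D_j` of `W(n)^0`. -/
noncomputable def xiD (i j : Fin n) : (W0 F n p).carrier :=
  ⟨fD F (xi F i) j, fD_mem_wittFil (by simp [xi, ExteriorAlgebra.algebraMapInv]) j⟩

variable {F p}

/-- `v` is a maximal vector of weight `wt`: a nonzero homogeneous vector killed by all `ξ_i D_j`
with `i < j`, such that `(ξ_i D_i) v = wt i • v`. Here `wt i` is the coordinate of the weight at
`η_i`, where `η_1, …, η_n` is the basis dual to `ξ_1 D_1, …, ξ_n D_n`. -/
structure IsMaximalVector {M : Type*} [AddCommGroup M] [Module F M]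
    [Module (RestrictedLieSub.Env (W0 F n p)) M] (𝓜 : ZMod 2 → Submodule F M)
    (wt : Fin n → F) (v : M) : Prop where
  ne_zero : v ≠ 0
  homogeneous : v ∈ 𝓜 0 ∨ v ∈ 𝓜 1
  raising : ∀ i j : Fin n, i < j → (W0 F n p).ι (xiD F p i j) • v = 0
  weight : ∀ i : Fin n, (W0 F n p).ι (xiD F p i i) • v = wt i • v

variable (F n p)

/-- The weights `a η_i + η_{i+1} + ⋯ + η_n` with `1 ≤ i ≤ n` and `a` in the prime field `𝔽_p`. -/
def atypicalWeights : Set (Fin n → F) :=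
  {wt | ∃ (i : Fin n) (a : ZMod p),
    wt = ZMod.castHom (dvd_refl p) F a • Pi.single i 1 + ∑ j ∈ Finset.Ioi i, Pi.single j 1}

/-- The induced module `I(M) = u(W(n)) ⊗_{u(W(n)^0)} M`. -/
abbrev KacModule (M : Type*) [AddCommGroup M] [Module F M]
    [Module (RestrictedLieSub.Env (W0 F n p)) M] : Type _ :=
  InducedModule (RestrictedLieSub.envMap (W0_le_W F n p)) M

/-- The `ℤ/2`-grading of the induced module. -/
noncomputable def kacParity {M : Type*} [AddCommGroup M] [Module F M]
    [Module (RestrictedLieSub.Env (W0 F n p)) M] (𝓜 : ZMod 2 → Submodule F M) (k : ZMod 2) :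
    Submodule F (KacModule F n p M) :=
  inducedParity (RestrictedLieSub.envMap (W0_le_W F n p)) (W F n p).envParity 𝓜 k

end WittSuper

/-! The induced module is realised by tensor fields. Since `W(n)_0 ≅ gl_n` is even and `W(n)^1`
kills `M`, the module `M` is a representation `E i j` of `gl_n`, and `W(n)` acts on `Λ(n) ⊗ M` by `T
↦ T ⊗ 1 + ∑ (Jacobian entry i j of T) ⊗ E j i` (`tensorField_bracket`). If `E i i` is first lowered
by `1` (`elemShift`), the subspace `ξ_1⋯ξ_n ⊗ M` becomes a copy of `M` as a `W(n)^0`-module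
(`tensorField_lamTop`). So `1 ⊗ m ↦ ξ_1⋯ξ_n ⊗ m` extends to a map from `I(λ)` to the tensor fields.
It is bijective (`toTensor_bijective`): the elements `g(D_1, …, D_n) ⊗ m` span `I(λ)`, and `g ↦
g(D_1, …, D_n)(ξ_1⋯ξ_n)` is a bijection of `Λ(n)`. The action respects `p`-th powers
(`tensorField_pow`), so it is one of `u(W(n))`.

The weight has coordinates in `𝔽_p`. For `n > 0` it is atypical exactly when `λ_i = 0` or `λ_j = 1`
for all `i < j` (`mem_atypicalWeights_iff`); for `n = 0` there are no atypical weights.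

Typical case (`eq_top_of_typical`). A nonzero stable subspace contains a nonzero field killed by all
`D_i`, hence a constant one, hence `1 ⊗ M` by simplicity of `M`. If `λ_i ≠ 0` and `λ_j ≠ 1` with `i
< j`, then `ξ_i ξ_j D_j` takes `1 ⊗ v` to `(λ_j - 1) ξ_i ⊗ v`, and the fields `ξ_a ξ_i D_i` multiply
`f ξ_i ⊗ v` by `λ_i ξ_a`. This reaches `ξ_1⋯ξ_n ⊗ v`, then `ξ_1⋯ξ_n ⊗ M`, and the `D_i` produce
everything else.

Atypical case (`exists_stable_of_atypical`). The twisted weight `μ = λ - 1` has the form `(-1, …,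
-1, b, 0, …, 0)`, so the monomial `y^{(μ)}` is a maximal vector in the truncated divided powers, and
the twisted `M` embeds there. The tensor fields thus lie in the de Rham complex in the even
variables `y_a = dξ_a`. Its differential `d = ∑ D_a ⊗ y_a` commutes with `W(n)` up to signs, so `ker
d` cuts out a stable subspace. It contains `1 ⊗ v`, and it omits `ξ_a ⊗ v` when `μ_a ≠ -1`. If every
`μ_a` is `-1`, then `λ = 0`, `M` is one-dimensional and the fields are volume forms; there the
divergences `∑ im D_i` form a proper nonzero stable subspace. -/

open CliffordAlgebra (evenOdd)

/-! ### Calculus in `Λ(n)`: parity, augmentation, left and right derivatives. -/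

namespace WittSuper

variable {F : Type*} [Field F] {n : ℕ}

/-- The grading involution of `Λ(n)`. -/
noncomputable abbrev lamInv : Lam F n →ₐ[F] Lam F n :=
  CliffordAlgebra.involute (Q := (0 : QuadraticForm F (Fin n → F)))

/-- The augmentation of `Λ(n)`. -/
noncomputable abbrev eps : Lam F n →ₐ[F] F := ExteriorAlgebra.algebraMapInv

theorem lamInv_ι (v : Fin n → F) :
    lamInv (ExteriorAlgebra.ι F v) = -ExteriorAlgebra.ι F v :=
  CliffordAlgebra.involute_ι _

theorem lamInv_xi (i : Fin n) : lamInv (xi F i) = -xi F i := lamInv_ι _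

theorem eps_ι (v : Fin n → F) : eps (ExteriorAlgebra.ι F v) = 0 := by
  simp [ExteriorAlgebra.algebraMapInv]

theorem eps_xi (i : Fin n) : eps (xi F i) = 0 := eps_ι _

theorem eps_algebraMap (r : F) : eps (algebraMap F (Lam F n) r) = r :=
  ExteriorAlgebra.algebraMap_leftInverse (R := F) (Fin n → F) r

theorem lam_induction {P : Lam F n → Prop} (hr : ∀ r, P (algebraMap F _ r))
    (ha : ∀ x y, P x → P y → P (x + y)) (hm : ∀ i x, P x → P (xi F i * x)) (x : Lam F n) :
    P x := by
  have hs : ∀ c : F, P (c • x) := by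
    induction x using CliffordAlgebra.left_induction with
    | algebraMap r => intro c; rw [Algebra.smul_def, ← map_mul]; exact hr _
    | add x y hx hy => intro c; rw [smul_add]; exact ha _ _ (hx c) (hy c)
    | ι_mul x v hx =>
      intro c
      have e : c • (ExteriorAlgebra.ι F v * x) = ∑ i, xi F i * ((c * v i) • x) := by
        rw [xi_sum v, Finset.sum_mul, Finset.smul_sum]
        refine Finset.sum_congr rfl fun i _ => ?_
        rw [smul_mul_assoc, mul_smul_comm, smul_smul]
      change P (c • (ExteriorAlgebra.ι F v * x))
      rw [e]
      exact Finset.sum_induction _ P ha (by simpa using hr 0) fun i _ => hm i _ (hx _)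
  simpa using hs 1

theorem D_one (i : Fin n) : D F i (1 : Lam F n) = 0 := CliffordAlgebra.contractLeft_one _ _

theorem D_ι (i : Fin n) (v : Fin n → F) :
    D F i (ExteriorAlgebra.ι F v) = algebraMap F _ (v i) := CliffordAlgebra.contractLeft_ι _ _ _

theorem D_xi (i j : Fin n) : D F i (xi F j) = if i = j then 1 else 0 := by
  rw [xi, D_ι, Pi.single_apply]; split <;> simp

theorem D_xi_mul (i j : Fin n) (g : Lam F n) :
    D F i (xi F j * g) = (if i = j then g else 0) - xi F j * D F i g := by
  rw [xi, D_ι_mul, Pi.single_apply]; split <;> simp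

theorem D_D (i j : Fin n) (g : Lam F n) : D F i (D F j g) = -D F j (D F i g) :=
  CliffordAlgebra.contractLeft_comm _ _ _

theorem D_D_self (i : Fin n) (g : Lam F n) : D F i (D F i g) = 0 :=
  CliffordAlgebra.contractLeft_contractLeft _ _

theorem ι_mul_ι (v w : Fin n → F) : ExteriorAlgebra.ι F v * ExteriorAlgebra.ι F w =
    -(ExteriorAlgebra.ι F w * ExteriorAlgebra.ι F v) :=
  eq_neg_of_add_eq_zero_left (ExteriorAlgebra.ι_add_mul_swap (R := F) v w)

theorem xi_mul_xi (i j : Fin n) : xi F i * xi F j = -(xi F j * xi F i) := ι_mul_ι _ _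

theorem xi_mul_xi_self (i : Fin n) : xi F i * xi F i = 0 := ExteriorAlgebra.ι_sq_zero _

theorem D_mul (i : Fin n) (f g : Lam F n) :
    D F i (f * g) = D F i f * g + lamInv f * D F i g := by
  induction f using CliffordAlgebra.left_induction with
  | algebraMap r =>
    rw [D_algebraMap, ← Algebra.smul_def, map_smul, AlgHom.commutes, Algebra.smul_def]; simp
  | add x y hx hy => simp only [add_mul, map_add, hx, hy]; abel
  | ι_mul x v hx =>
    change D F i (ExteriorAlgebra.ι F v * x * g) = D F i (ExteriorAlgebra.ι F v * x) * g +
      lamInv (ExteriorAlgebra.ι F v * x) * D F i g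
    rw [mul_assoc, D_ι_mul, hx, D_ι_mul, map_mul, lamInv_ι]
    simp only [mul_add, sub_mul, neg_mul, smul_mul_assoc, mul_assoc]
    abel

theorem lamInv_D (i : Fin n) (f : Lam F n) : lamInv (D F i f) = -D F i (lamInv f) := by
  induction f using CliffordAlgebra.left_induction with
  | algebraMap r => simp [D_algebraMap]
  | add x y hx hy => simp only [map_add, hx, hy]; abel
  | ι_mul x v hx =>
    change lamInv (D F i (ExteriorAlgebra.ι F v * x)) =
      -D F i (lamInv (ExteriorAlgebra.ι F v * x))
    rw [D_ι_mul, map_mul, lamInv_ι, map_sub, map_smul, map_mul, lamInv_ι, hx, neg_mul, neg_mul,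
      map_neg, D_ι_mul]
    simp

theorem lamInv_lamInv (f : Lam F n) : lamInv (lamInv f) = f := CliffordAlgebra.involute_involute _

theorem eps_lamInv (f : Lam F n) : eps (lamInv f) = eps f := by
  induction f using CliffordAlgebra.left_induction with
  | algebraMap r => simp
  | add x y hx hy => simp only [map_add, hx, hy]
  | ι_mul x v hx =>
    change eps (lamInv (ExteriorAlgebra.ι F v * x)) = eps (ExteriorAlgebra.ι F v * x)
    rw [map_mul, map_mul, map_mul, lamInv_ι, map_neg, eps_ι]; simp

theorem mul_ι_eq (f : Lam F n) (v : Fin n → F) :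
    f * ExteriorAlgebra.ι F v = ExteriorAlgebra.ι F v * lamInv f := by
  induction f using CliffordAlgebra.left_induction with
  | algebraMap r => simpa using (Algebra.commutes r _)
  | add x y hx hy => simp [add_mul, mul_add, hx, hy]
  | ι_mul x w hx =>
    change ExteriorAlgebra.ι F w * x * ExteriorAlgebra.ι F v =
      ExteriorAlgebra.ι F v * lamInv (ExteriorAlgebra.ι F w * x)
    rw [map_mul, lamInv_ι, mul_assoc, hx, ← mul_assoc, ι_mul_ι w v, neg_mul, neg_mul, mul_neg,
      mul_assoc]

theorem mul_xi_eq (f : Lam F n) (i : Fin n) : f * xi F i = xi F i * lamInv f := mul_ι_eq f _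

theorem lamInv_of_mem {k : ZMod 2} {f : Lam F n} (hf : f ∈ lamParity F n k) :
    lamInv f = superSign k 1 • f := by
  have hk := zmod_two k
  rcases hk with rfl | rfl
  · rw [CliffordAlgebra.involute_eq_of_mem_even hf]; simp [superSign]
  · rw [CliffordAlgebra.involute_eq_of_mem_odd hf]; simp [superSign]

theorem lam_supercomm {k l : ZMod 2} {f g : Lam F n} (hf : f ∈ lamParity F n k)
    (hg : g ∈ lamParity F n l) : f * g = superSign k l • (g * f) := by
  induction g, hg using CliffordAlgebra.evenOdd_induction with
  | range_ι_pow v hv =>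
    have hl := zmod_two l
    rcases hl with rfl | rfl
    · have hv : v ∈ (1 : Submodule F (Lam F n)) := by simpa using hv
      obtain ⟨r, rfl⟩ := Submodule.mem_one.1 hv
      have e := superSign_zero_right k
      rw [e, one_smul]
      exact (Algebra.commutes r f).symm
    · have e : (1 : ZMod 2).val = 1 := rfl
      rw [e, pow_one] at hv
      obtain ⟨w, rfl⟩ := hv
      exact ι_comm w hf
  | add x y hx hy ihx ihy => rw [mul_add, ihx, ihy, add_mul, smul_add]
  | ι_mul_ι_mul v w x hx ih =>
    change f * (ExteriorAlgebra.ι F v * ExteriorAlgebra.ι F w * x) =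
      superSign k l • (ExteriorAlgebra.ι F v * ExteriorAlgebra.ι F w * x * f)
    rw [mul_assoc, ← mul_assoc f, mul_ι_eq, mul_assoc, ← mul_assoc (lamInv f), mul_ι_eq,
      lamInv_lamInv, mul_assoc _ f, ih, mul_smul_comm, mul_smul_comm]
    simp only [mul_assoc]

/-- The odd twisted derivation `α ∘ D_j`. -/
noncomputable def tD (j : Fin n) : Module.End F (Lam F n) := lamInv.toLinearMap * D F j

theorem tD_apply (j : Fin n) (f : Lam F n) : tD j f = lamInv (D F j f) := rfl

theorem tD_mem {k : ZMod 2} {j : Fin n} {f : Lam F n} (hf : f ∈ lamParity F n k) :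
    tD j f ∈ lamParity F n (1 + k) := by
  rw [tD_apply, lamInv_of_mem (D_parity j k f hf)]
  exact zsmul_mem (D_parity j k f hf) _

theorem witt_apply {T : Module.End F (Lam F n)} (hT : T ∈ wittSpace F n) (f : Lam F n) :
    T f = ∑ i, T (xi F i) * D F i f := by
  induction hT using Submodule.span_induction with
  | mem x hx =>
    obtain ⟨g, i, rfl⟩ := hx
    change g * D F i f = ∑ j, g * D F i (xi F j) * D F j f
    simp [D_xi]
  | zero => simp
  | add x y _ _ hx hy => simp only [LinearMap.add_apply, add_mul, Finset.sum_add_distrib, hx, hy]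
  | smul c x _ hx => rw [LinearMap.smul_apply, hx, Finset.smul_sum]; simp

/-- `tD j` is the partial derivative from the right. Vector fields act from the left, so the chain
rule for the two carries no sign. This is why the Jacobian below is built from `tD` and not from
`D`. -/
theorem tD_witt {T : Module.End F (Lam F n)} (hT : T ∈ wittSpace F n) (j : Fin n) (f : Lam F n) :
    tD j (T f) = ∑ i, tD j (T (xi F i)) * tD i f + T (tD j f) := by
  rw [witt_apply hT f, witt_apply hT (tD j f), map_sum, ← Finset.sum_add_distrib]
  refine Finset.sum_congr rfl fun i _ => ?_
  simp only [tD_apply, D_mul, map_add, map_mul, lamInv_lamInv]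
  rw [D_D j i, map_neg, lamInv_D i (D F j f)]
  simp

/-! ### Hodge duality on `Λ(n)`: exchanging multiplication by `ξ_i` with `D_i`. -/

/-- The ordered product of the generators with indices in a list. -/
noncomputable def xiProd (l : List (Fin n)) : Lam F n := (l.map (xi F)).prod

theorem xi_mul_xiProd {l : List (Fin n)} {i : Fin n} (h : i ∈ l) :
    xi F i * xiProd l = 0 := by
  induction l with
  | nil => simp at h
  | cons a l ih =>
    rw [xiProd, List.map_cons, List.prod_cons, ← mul_assoc]
    by_cases hi : i = a
    · rw [hi, xi_mul_xi_self, zero_mul]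
    · rw [xi_mul_xi, neg_mul, mul_assoc]
      have := ih (by simpa [hi] using h)
      rw [xiProd] at this
      rw [this, mul_zero, neg_zero]

theorem D_xiProd {l : List (Fin n)} {i : Fin n} (h : i ∉ l) : D F i (xiProd l) = 0 := by
  induction l with
  | nil => exact D_one i
  | cons a l ih =>
    rw [List.mem_cons, not_or] at h
    rw [xiProd, List.map_cons, List.prod_cons, D_xi_mul, if_neg h.1]
    have := ih h.2
    rw [xiProd] at this
    rw [this, mul_zero, sub_zero]

theorem lamInv_xiProd (l : List (Fin n)) :
    lamInv (xiProd l : Lam F n) = (-1) ^ l.length * xiProd l := by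
  induction l with
  | nil => simp [xiProd]
  | cons a l ih =>
    rw [xiProd] at ih
    rw [xiProd, List.map_cons, List.prod_cons, map_mul, ih, lamInv_xi, List.length_cons, pow_succ]
    rw [← mul_assoc, ← mul_assoc]
    congr 1
    rw [mul_neg_one, neg_mul, neg_mul]
    congr 1
    exact ((Commute.neg_one_left (xi F a)).pow_left _).eq.symm

/-- The algebra homomorphism `Λ(n) → End Λ(n)` taking `ξ_i` to `D_i`. -/
noncomputable def dOp : Lam F n →ₐ[F] Module.End F (Lam F n) :=
  ExteriorAlgebra.lift F ⟨∑ i, LinearMap.smulRight (LinearMap.proj i) (D F i), fun v => by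
    refine LinearMap.ext fun g => ?_
    have e : (∑ i, LinearMap.smulRight (LinearMap.proj i) (D F i) :
        (Fin n → F) →ₗ[F] Module.End F (Lam F n)) v =
        CliffordAlgebra.contractLeft (Q := (0 : QuadraticForm F (Fin n → F)))
          (∑ i, v i • LinearMap.proj i) := by
      simp [D]
    rw [e]
    exact CliffordAlgebra.contractLeft_contractLeft _ _⟩

theorem dOp_xi (i : Fin n) : dOp (xi F i) = D F i := by
  rw [xi, dOp, ExteriorAlgebra.lift_ι_apply, LinearMap.sum_apply]
  rw [Finset.sum_eq_single i]
  · simp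
  · intro b _ hb; simp [hb]
  · simp

/-- The Hodge-type operator `g ↦ g(D_1, …, D_n) (ξ_{l_1} ξ_{l_2} ⋯)`. -/
noncomputable def hodgeOp (l : List (Fin n)) : Module.End F (Lam F n) :=
  LinearMap.applyₗ (xiProd l) ∘ₗ dOp.toLinearMap

theorem hodgeOp_apply (l : List (Fin n)) (g : Lam F n) : hodgeOp l g = dOp g (xiProd l) := rfl

theorem hodgeOp_xi_mul (l : List (Fin n)) (i : Fin n) (g : Lam F n) :
    hodgeOp l (xi F i * g) = D F i (hodgeOp l g) := by
  rw [hodgeOp_apply, map_mul, dOp_xi]; rfl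

theorem hodgeOp_algebraMap (l : List (Fin n)) (r : F) :
    hodgeOp l (algebraMap F (Lam F n) r) = algebraMap F (Lam F n) r * xiProd l := by
  rw [hodgeOp_apply, AlgHom.commutes, Module.algebraMap_end_apply, Algebra.smul_def]

/-- On constants both sides vanish, because every `ξ_i` kills a product in which all generators
occur. The induction step uses that `D_i` and multiplication by `ξ_j` satisfy the Clifford
relations, which are symmetric in the two families. -/
theorem hodgeOp_D {l : List (Fin n)} (hl : ∀ i, i ∈ l) (i : Fin n) (g : Lam F n) :
    hodgeOp l (D F i g) = xi F i * hodgeOp l g := by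
  induction g using lam_induction with
  | hr r =>
    rw [D_algebraMap, map_zero, hodgeOp_algebraMap, ← mul_assoc, ← Algebra.commutes, mul_assoc,
      xi_mul_xiProd (hl i), mul_zero]
  | ha x y hx hy => simp only [map_add, hx, hy, mul_add]
  | hm j x hx =>
    rw [D_xi_mul, map_sub, hodgeOp_xi_mul, hodgeOp_xi_mul, hx, D_xi_mul]
    by_cases h : i = j
    · simp [h]
    · simp [h, Ne.symm h]

theorem hodgeOp_reverse_xiProd {l : List (Fin n)} (hl : l.Nodup) :
    hodgeOp l (xiProd l.reverse) = (1 : Lam F n) := by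
  induction l with
  | nil => simp [hodgeOp_apply, xiProd]
  | cons a l ih =>
    rw [List.nodup_cons] at hl
    have e1 : (xiProd (a :: l) : Lam F n) = xi F a * xiProd l := by simp [xiProd]
    have e2 : (xiProd (a :: l).reverse : Lam F n) = xiProd l.reverse * xi F a := by simp [xiProd]
    have := ih hl.2
    rw [hodgeOp_apply] at this ⊢
    rw [e1, e2, map_mul dOp, dOp_xi, Module.End.mul_apply, D_xi_mul, if_pos rfl, D_xiProd hl.1,
      mul_zero, sub_zero, this]

/-- Exchanging `ξ_i` and `D_i` twice commutes with every multiplication by `ξ_i`, so the composite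
is determined by its value at `1`. Reversing the list removes the sign there. -/
theorem hodgeOp_hodgeOp {l l' : List (Fin n)} (h : hodgeOp l' (xiProd l) = (1 : Lam F n))
    (g : Lam F n) (hl' : ∀ i, i ∈ l') : hodgeOp l' (hodgeOp l g) = g := by
  induction g using lam_induction with
  | hr r =>
    rw [hodgeOp_algebraMap, ← Algebra.smul_def, map_smul, h, Algebra.algebraMap_eq_smul_one]
  | ha x y hx hy => simp only [map_add, hx, hy]
  | hm j x hx => rw [hodgeOp_xi_mul, hodgeOp_D hl', hx]

variable (F n) in
/-- The top element `ξ_1 ⋯ ξ_n`. -/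
noncomputable def lamTop : Lam F n := xiProd (List.finRange n)

/-- The Hodge-type operator `g ↦ g(D_1, …, D_n) (ξ_1 ⋯ ξ_n)`. -/
noncomputable def hodge : Lam F n ≃ₗ[F] Lam F n :=
  LinearEquiv.ofLinearMap (hodgeOp (List.finRange n)) (hodgeOp (List.finRange n).reverse)
    (LinearMap.ext fun g => hodgeOp_hodgeOp
      (hodgeOp_reverse_xiProd (List.nodup_finRange n)) g (by simp))
    (LinearMap.ext fun g => hodgeOp_hodgeOp
      (by simpa using hodgeOp_reverse_xiProd (F := F) (List.nodup_reverse.2 (List.nodup_finRange n)))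
      g (by simp))

theorem hodge_one : hodge (1 : Lam F n) = lamTop F n := by
  change dOp 1 (xiProd _) = _
  rw [map_one]; rfl

theorem hodge_xi_mul (i : Fin n) (g : Lam F n) : hodge (xi F i * g) = D F i (hodge g) :=
  hodgeOp_xi_mul _ i g

theorem xi_mul_lamTop (i : Fin n) : xi F i * lamTop F n = 0 := xi_mul_xiProd (by simp)

theorem mul_lamTop (f : Lam F n) : f * lamTop F n = eps f • lamTop F n := by
  induction f using lam_induction with
  | hr r => rw [eps_algebraMap, Algebra.smul_def]
  | ha x y hx hy => rw [add_mul, hx, hy, map_add, add_smul]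
  | hm j x hx => rw [mul_assoc, hx, mul_smul_comm, xi_mul_lamTop, map_mul, eps_xi]; simp

/-- Differentiate `α(f) ξ_1⋯ξ_n`, which vanishes when `f` has no constant term. This produces the
trace by which `W(n)^0` scales the top element. -/
theorem mul_D_lamTop {f : Lam F n} (hf : eps f = 0) (i : Fin n) :
    f * D F i (lamTop F n) = eps (tD i f) • lamTop F n := by
  have h := D_mul i (lamInv f) (lamTop F n)
  rw [mul_lamTop, eps_lamInv, hf, zero_smul, map_zero, lamInv_lamInv, mul_lamTop] at h
  rw [tD_apply, lamInv_D, map_neg, neg_smul]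
  exact eq_neg_of_add_eq_zero_right h.symm

theorem lamTop_eq_mul_xi (i : Fin n) : ∃ f : Lam F n, lamTop F n = f * xi F i := by
  refine ⟨lamInv (D F i (lamTop F n)), ?_⟩
  rw [mul_xi_eq, lamInv_lamInv]
  have h := D_xi_mul i i (lamTop F n)
  rw [xi_mul_lamTop, map_zero, if_pos rfl] at h
  exact sub_eq_zero.1 h.symm

theorem lamInv_lamTop : lamInv (lamTop F n) = (-1 : F) ^ n • lamTop F n := by
  rw [lamTop, lamInv_xiProd, List.length_finRange, Algebra.smul_def]; simp

/-- Used to compare the parity of the induced module with that of tensor fields. -/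
theorem lamInv_hodge (g : Lam F n) : lamInv (hodge g) = (-1 : F) ^ n • hodge (lamInv g) := by
  induction g using lam_induction with
  | hr r =>
    rw [AlgHom.commutes, Algebra.algebraMap_eq_smul_one, map_smul, map_smul, hodge_one,
      lamInv_lamTop, smul_comm]
  | ha x y hx hy => simp only [map_add, hx, hy, smul_add]
  | hm j x hx =>
    rw [hodge_xi_mul, lamInv_D, hx, map_mul, lamInv_xi, map_smul, neg_mul, map_neg, hodge_xi_mul,
      smul_neg]

end WittSuper

/-! ### Tensor fields `Λ(n) ⊗ M` and the action of vector fields on them. -/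

namespace WittSuper
open scoped TensorProduct

variable {F : Type*} [Field F] {n : ℕ} {M : Type*} [AddCommGroup M] [Module F M]

variable (F n M) in
/-- The tensor fields `Λ(n) ⊗ M`. -/
def TensorFields : Type _ := Lam F n ⊗[F] M

noncomputable instance : AddCommGroup (TensorFields F n M) :=
  inferInstanceAs (AddCommGroup (Lam F n ⊗[F] M))

noncomputable instance : Module F (TensorFields F n M) :=
  inferInstanceAs (Module F (Lam F n ⊗[F] M))

variable (F n M) in
/-- The bilinear map `(f, m) ↦ f ⊗ m`. -/
noncomputable def tmulₗ : Lam F n →ₗ[F] M →ₗ[F] TensorFields F n M := TensorProduct.mk F _ _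

/-- The tensor field `f ⊗ m`. -/
noncomputable abbrev tf (f : Lam F n) (m : M) : TensorFields F n M := tmulₗ F n M f m

section

variable (f g : Lam F n) (m m' : M)

@[simp] theorem add_tf : tf (f + g) m = tf f m + tf g m := by rw [tf, map_add]; rfl
@[simp] theorem sub_tf : tf (f - g) m = tf f m - tf g m := by rw [tf, map_sub]; rfl
@[simp] theorem neg_tf : tf (-f) m = -tf f m := by rw [tf, map_neg]; rfl
@[simp] theorem zero_tf : tf (0 : Lam F n) m = 0 := by rw [tf, map_zero]; rfl
@[simp] theorem smul_tf (c : F) : tf (c • f) m = c • tf f m := by rw [tf, map_smul]; rfl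
@[simp] theorem tf_add : tf f (m + m') = tf f m + tf f m' := map_add _ _ _
@[simp] theorem tf_sub : tf f (m - m') = tf f m - tf f m' := map_sub _ _ _
@[simp] theorem tf_zero : tf f (0 : M) = 0 := map_zero _
@[simp] theorem tf_smul (c : F) : tf f (c • m) = c • tf f m := map_smul _ _ _

theorem zsmul_tf (c : ℤ) : tf (c • f) m = c • tf f m := by
  rw [← Int.cast_smul_eq_zsmul F c f, smul_tf, Int.cast_smul_eq_zsmul]

theorem sum_tf {κ : Type*} (s : Finset κ) (f : κ → Lam F n) :
    tf (∑ i ∈ s, f i) m = ∑ i ∈ s, tf (f i) m := by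
  rw [tf, map_sum, LinearMap.sum_apply]

theorem tf_sum {κ : Type*} (s : Finset κ) (m : κ → M) :
    tf f (∑ i ∈ s, m i) = ∑ i ∈ s, tf f (m i) := map_sum _ _ _

end

/-- Linear maps out of `Λ(n) ⊗ M` are given by bilinear maps. -/
noncomputable def tfLift {N : Type*} [AddCommGroup N] [Module F N]
    (φ : Lam F n →ₗ[F] M →ₗ[F] N) : TensorFields F n M →ₗ[F] N :=
  TensorProduct.lift φ

theorem tf_induction {P : TensorFields F n M → Prop} (h0 : P 0) (ht : ∀ f m, P (tf f m))
    (ha : ∀ x y, P x → P y → P (x + y)) (x : TensorFields F n M) : P x :=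
  TensorProduct.induction_on (R := F) x h0 ht ha

theorem tf_ext {N : Type*} [AddCommGroup N] [Module F N] {φ ψ : TensorFields F n M →ₗ[F] N}
    (h : ∀ f m, φ (tf f m) = ψ (tf f m)) : φ = ψ :=
  LinearMap.ext fun x => tf_induction (P := fun x => φ x = ψ x) (by simp) h (fun x y hx hy => by simp [hx, hy]) x

variable (F n M) in
/-- The operators `T ⊗ X` on `Λ(n) ⊗ M`. -/
noncomputable def mapTens :
    Module.End F (Lam F n) →ₗ[F] Module.End F M →ₗ[F] Module.End F (TensorFields F n M) :=
  LinearMap.mk₂ F (fun T X => tfLift ((tmulₗ F n M).compl₁₂ T X))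
    (fun _ _ _ => tf_ext fun _ _ => add_tf _ _ _) (fun _ _ _ => tf_ext fun _ _ => smul_tf _ _ _)
    (fun _ _ _ => tf_ext fun _ _ => tf_add _ _ _) (fun _ _ _ => tf_ext fun _ _ => tf_smul _ _ _)

@[simp] theorem mapTens_tf (T : Module.End F (Lam F n)) (X : Module.End F M) (f : Lam F n) (m : M) :
    mapTens F n M T X (tf f m) = tf (T f) (X m) := rfl

variable (F n M) in
/-- The operators `(f ·) ⊗ X` on `Λ(n) ⊗ M`. -/
noncomputable def mulTens :
    Lam F n →ₗ[F] Module.End F M →ₗ[F] Module.End F (TensorFields F n M) :=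
  mapTens F n M ∘ₗ LinearMap.mul F (Lam F n)

@[simp] theorem mulTens_tf (f : Lam F n) (X : Module.End F M) (g : Lam F n) (m : M) :
    mulTens F n M f X (tf g m) = tf (f * g) (X m) := rfl

variable (F n M) in
/-- The operators `T ⊗ 1` on `Λ(n) ⊗ M`. -/
noncomputable def opTens : Module.End F (Lam F n) →ₗ[F] Module.End F (TensorFields F n M) :=
  (mapTens F n M).flip 1

@[simp] theorem opTens_tf (T : Module.End F (Lam F n)) (g : Lam F n) (m : M) :
    opTens F n M T (tf g m) = tf (T g) m := rfl

theorem opTens_mul (S T : Module.End F (Lam F n)) :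
    opTens F n M (S * T) = opTens F n M S * opTens F n M T :=
  tf_ext fun x m => by simp

theorem mulTens_mul (f g : Lam F n) (X Y : Module.End F M) :
    mulTens F n M f X * mulTens F n M g Y = mulTens F n M (f * g) (X * Y) :=
  tf_ext fun x m => by simp [mul_assoc]

theorem opTens_mul_mulTens {k l : ZMod 2} {T : Module.End F (Lam F n)} (hT : IsSuperDer k T)
    {f : Lam F n} (hf : f ∈ lamParity F n l) (X : Module.End F M) :
    opTens F n M T * mulTens F n M f X =
      mulTens F n M (T f) X + superSign k l • (mulTens F n M f X * opTens F n M T) :=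
  tf_ext fun x m => by
    simp only [Module.End.mul_apply, mulTens_tf, opTens_tf, hT.2 l f hf, add_tf, zsmul_tf,
      LinearMap.add_apply, LinearMap.smul_apply]

/-- The coefficients `α (D_j (T ξ_i))` of the Jacobian matrix of `T`. -/
noncomputable def jac (i j : Fin n) : Module.End F (Lam F n) →ₗ[F] Lam F n :=
  tD j ∘ₗ LinearMap.applyₗ (xi F i)

theorem jac_apply (i j : Fin n) (T : Module.End F (Lam F n)) : jac i j T = tD j (T (xi F i)) := rfl

theorem jac_mem {k : ZMod 2} {T : Module.End F (Lam F n)} (hT : T ∈ endParity F n k)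
    (i j : Fin n) : jac i j T ∈ lamParity F n k := by
  have h := tD_mem (j := j) (hT 1 _ (ι_mem_parity (Pi.single i 1)))
  rw [add_comm k 1, one_add_one_add] at h
  exact h

theorem jac_mul {T : Module.End F (Lam F n)} (hT : T ∈ wittSpace F n)
    (S : Module.End F (Lam F n)) (i j : Fin n) :
    jac i j (T * S) = ∑ q, jac q j T * jac i q S + T (jac i j S) :=
  tD_witt hT j _

/-- The Jacobian part of the action on tensor fields. -/
noncomputable def jacTens (E : Fin n → Fin n → Module.End F M) :
    Module.End F (Lam F n) →ₗ[F] Module.End F (TensorFields F n M) :=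
  ∑ i, ∑ j, (mulTens F n M).flip (E j i) ∘ₗ jac i j

theorem jacTens_apply (E : Fin n → Fin n → Module.End F M) (T : Module.End F (Lam F n)) :
    jacTens E T = ∑ i, ∑ j, mulTens F n M (jac i j T) (E j i) := by
  simp [jacTens, LinearMap.sum_apply]

/-- The action of vector fields on the tensor fields `Λ(n) ⊗ M`, where `E i j` is the action on `M`
of the elementary matrices. -/
noncomputable def tensorField (E : Fin n → Fin n → Module.End F M) :
    Module.End F (Lam F n) →ₗ[F] Module.End F (TensorFields F n M) :=
  opTens F n M + jacTens E

theorem tensorField_tf (E : Fin n → Fin n → Module.End F M) (T : Module.End F (Lam F n))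
    (g : Lam F n) (m : M) :
    tensorField E T (tf g m) = tf (T g) m + ∑ i, ∑ j, tf (jac i j T * g) (E j i m) := by
  simp [tensorField, jacTens_apply, LinearMap.sum_apply]

/-- The commutation relations of the elementary matrices. -/
def IsGlRep (E : Fin n → Fin n → Module.End F M) : Prop :=
  ∀ i j k l, E i j * E k l - E k l * E i j =
    (if j = k then E i l else 0) - (if i = l then E k j else 0)

theorem opTens_mul_jacTens (E : Fin n → Fin n → Module.End F M) {k l : ZMod 2}
    {T S : Module.End F (Lam F n)} (hT : IsSuperDer k T) (hS : IsSuperDer l S) :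
    opTens F n M T * jacTens E S = ∑ i, ∑ j, mulTens F n M (T (jac i j S)) (E j i) +
      superSign k l • (jacTens E S * opTens F n M T) := by
  simp only [jacTens_apply, Finset.mul_sum, Finset.sum_mul, Finset.smul_sum,
    ← Finset.sum_add_distrib]
  exact Finset.sum_congr rfl fun i _ => Finset.sum_congr rfl fun j _ =>
    opTens_mul_mulTens hT (jac_mem hS.1 i j) _

/-- The operators `E i j` are even, so only the Jacobian entries produce signs, and these have the
parity of their vector field (`jac_mem`). Supercommuting the entries turns the bracket into one of
elementary matrices, and the `gl_n` relations leave the two products of Jacobian matrices. -/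
theorem jacTens_bracket {E : Fin n → Fin n → Module.End F M} (hE : IsGlRep E) {k l : ZMod 2}
    {T S : Module.End F (Lam F n)} (hT : IsSuperDer k T) (hS : IsSuperDer l S) :
    jacTens E T * jacTens E S - superSign k l • (jacTens E S * jacTens E T) =
      ∑ i, ∑ j, mulTens F n M (∑ q, jac q j T * jac i q S) (E j i) -
      superSign k l • ∑ i, ∑ j, mulTens F n M (∑ q, jac q j S * jac i q T) (E j i) := by
  have hs : ∀ i j q r, superSign k l • (jac q r S * jac i j T) = jac i j T * jac q r S :=
    fun i j q r => (lam_supercomm (jac_mem hT.1 i j) (jac_mem hS.1 q r)).symm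
  have e1 : superSign k l • (jacTens E S * jacTens E T) = ∑ i, ∑ j, ∑ q, ∑ r,
      mulTens F n M (jac i j T * jac q r S) (E r q * E j i) := by
    simp only [jacTens_apply, Finset.mul_sum, Finset.sum_mul, mulTens_mul, Finset.smul_sum]
    refine Finset.sum_congr rfl fun i _ => Finset.sum_congr rfl fun j _ =>
      Finset.sum_congr rfl fun q _ => Finset.sum_congr rfl fun r _ => ?_
    rw [← hs, map_zsmul, LinearMap.smul_apply]
  have e2 : jacTens E T * jacTens E S = ∑ i, ∑ j, ∑ q, ∑ r,
      mulTens F n M (jac i j T * jac q r S) (E j i * E r q) := by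
    simp only [jacTens_apply, Finset.sum_mul]
    simp only [Finset.mul_sum, mulTens_mul]
  rw [e1, e2]
  simp only [← Finset.sum_sub_distrib, ← map_sub]
  have e3 : ∀ i j q r, mulTens F n M (jac i j T * jac q r S) (E j i * E r q - E r q * E j i) =
      (if i = r then mulTens F n M (jac i j T * jac q r S) (E j q) else 0) -
      (if j = q then mulTens F n M (jac i j T * jac q r S) (E r i) else 0) := by
    intro i j q r
    rw [hE, map_sub]
    split_ifs <;> simp
  simp only [e3, Finset.sum_sub_distrib]
  congr 1
  · simp only [Finset.sum_ite_eq, Finset.mem_univ, if_true, map_sum, LinearMap.sum_apply]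
    exact (Finset.sum_congr rfl fun i _ => Finset.sum_comm).trans
      (Finset.sum_comm.trans (Finset.sum_congr rfl fun q _ => Finset.sum_comm))
  · have e4 : ∀ i j, (∑ q, ∑ r, if j = q then
        mulTens F n M (jac i j T * jac q r S) (E r i) else 0) =
        ∑ r, mulTens F n M (jac i j T * jac j r S) (E r i) := by
      intro i j
      rw [Finset.sum_comm]
      simp
    simp only [e4, map_sum, LinearMap.sum_apply, Finset.smul_sum]
    refine Finset.sum_congr rfl fun i _ => ?_
    rw [Finset.sum_comm]
    refine Finset.sum_congr rfl fun r _ => Finset.sum_congr rfl fun j _ => ?_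
    rw [← hs, map_zsmul, LinearMap.smul_apply]

/-- By the chain rule `jac_mul`, the Jacobian of `T S` is a matrix product plus `T` applied to the
entries of `S`. The matrix products come from `jacTens_bracket`, the other terms from commuting `T ⊗
1` past the Jacobian part. -/
theorem tensorField_bracket {E : Fin n → Fin n → Module.End F M} (hE : IsGlRep E) {k l : ZMod 2}
    {T S : Module.End F (Lam F n)} (hT : IsSuperDer k T) (hS : IsSuperDer l S) :
    tensorField E T * tensorField E S - superSign k l • (tensorField E S * tensorField E T) =
      tensorField E (T * S - superSign k l • (S * T)) := by
  have h1 := opTens_mul_jacTens E hT hS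
  have h2 := opTens_mul_jacTens E hS hT
  have h3 := jacTens_bracket hE hT hS
  have h4 : jacTens E (T * S - superSign k l • (S * T)) =
      (∑ i, ∑ j, mulTens F n M (∑ q, jac q j T * jac i q S) (E j i) +
        ∑ i, ∑ j, mulTens F n M (T (jac i j S)) (E j i)) -
      superSign k l • (∑ i, ∑ j, mulTens F n M (∑ q, jac q j S * jac i q T) (E j i) +
        ∑ i, ∑ j, mulTens F n M (S (jac i j T)) (E j i)) := by
    rw [map_sub, map_zsmul]
    simp only [jacTens_apply, jac_mul hT.mem, jac_mul hS.mem, map_add, LinearMap.add_apply,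
      Finset.sum_add_distrib]
  have h5 : superSign l k = superSign k l := superSign_swap l k
  rw [h5] at h2
  have h6 : superSign k l • (opTens F n M S * jacTens E T) = superSign k l •
      ∑ i, ∑ j, mulTens F n M (S (jac i j T)) (E j i) + jacTens E T * opTens F n M S := by
    rw [h2, smul_add, smul_smul, superSign_mul_self, one_smul]
  simp only [tensorField, LinearMap.add_apply, h4]
  rw [map_sub, map_zsmul, opTens_mul, opTens_mul]
  rw [sub_eq_iff_eq_add] at h3
  simp only [add_mul, mul_add, smul_add, h1, h3, h6]
  abel

end WittSuper


/-! ### Universal property and generation of `u(L)`. -/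

namespace RestrictedLieSub

variable {p : ℕ} {F A : Type*} [Field F] [Ring A] [Algebra F A] {𝒜 : ZMod 2 → Submodule F A}

/-- The universal property of the restricted enveloping algebra. -/
noncomputable def envLift (L : RestrictedLieSub p 𝒜) {B : Type*} [Ring B] [Algebra F B]
    (f : L.carrier →ₗ[F] B)
    (hb : ∀ (i j : ZMod 2) (x y : L.carrier) (hx : (x : A) ∈ 𝒜 i) (hy : (y : A) ∈ 𝒜 j),
      f x * f y - superSign i j • (f y * f x) =
        f ⟨(x : A) * y - superSign i j • ((y : A) * x), L.bracket_mem i j x x.2 y y.2 hx hy⟩)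
    (hp : ∀ (x : L.carrier) (hx : (x : A) ∈ 𝒜 0),
      f x ^ p = f ⟨(x : A) ^ p, L.pow_mem x x.2 hx⟩) : Env L →ₐ[F] B :=
  RingQuot.liftAlgHom F
    ⟨TensorAlgebra.lift F f, by
      intro a b hab
      cases hab with
      | bracket i j x y hx hy =>
        simp only [map_sub, map_mul, map_zsmul, TensorAlgebra.lift_ι_apply]
        exact hb i j x y hx hy
      | pow x hx =>
        simp only [map_pow, TensorAlgebra.lift_ι_apply]
        exact hp x hx⟩

theorem envLift_ι (L : RestrictedLieSub p 𝒜) {B : Type*} [Ring B] [Algebra F B]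
    (f : L.carrier →ₗ[F] B) (hb hp) (x : L.carrier) : L.envLift f hb hp (L.ι x) = f x := by
  change RingQuot.liftAlgHom F _ (RingQuot.mkAlgHom F _ (TensorAlgebra.ι F x)) = _
  rw [RingQuot.liftAlgHom_mkAlgHom_apply, TensorAlgebra.lift_ι_apply]

theorem envMap_ι {L₁ L₂ : RestrictedLieSub p 𝒜} (h : L₁.carrier ≤ L₂.carrier) (x : L₁.carrier) :
    envMap h (L₁.ι x) = L₂.ι (Submodule.inclusion h x) := by
  change RingQuot.liftAlgHom F _ (RingQuot.mkAlgHom F _ (TensorAlgebra.ι F x)) = _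
  rw [RingQuot.liftAlgHom_mkAlgHom_apply, TensorAlgebra.lift_ι_apply]
  rfl

/-- `L` generates `u(L)`, so stability may be tested on `L`. Applied to the graph of a linear map,
the same statement shows that the map is `u(L)`-linear. -/
theorem env_stable (L : RestrictedLieSub p 𝒜) {N : Type*} [AddCommGroup N] [Module F N]
    (R : Env L →ₐ[F] Module.End F N) (Q : Submodule F N)
    (h : ∀ x, ∀ y ∈ Q, R (L.ι x) y ∈ Q) (u : Env L) : ∀ y ∈ Q, R u y ∈ Q := by
  obtain ⟨t, rfl⟩ : ∃ t, RingQuot.mkAlgHom F (EnvRel L) t = u :=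
    RingQuot.mkAlgHom_surjective F (EnvRel L) u
  induction t using TensorAlgebra.induction with
  | algebraMap r =>
    intro y hy
    have e : (R (RingQuot.mkAlgHom F (EnvRel L) (algebraMap F _ r))) = algebraMap F _ r := by
      rw [AlgHom.commutes]; exact AlgHom.commutes R r
    rw [e, Module.algebraMap_end_apply]
    exact Q.smul_mem _ hy
  | ι x => exact h x
  | mul a b ha hb =>
    intro y hy
    have e : R (RingQuot.mkAlgHom F (EnvRel L) (a * b)) =
        R (RingQuot.mkAlgHom F (EnvRel L) a) * R (RingQuot.mkAlgHom F (EnvRel L) b) := by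
      rw [map_mul]; exact map_mul R _ _
    rw [e]
    exact ha _ (hb _ hy)
  | add a b ha hb =>
    intro y hy
    have e : R (RingQuot.mkAlgHom F (EnvRel L) (a + b)) =
        R (RingQuot.mkAlgHom F (EnvRel L) a) + R (RingQuot.mkAlgHom F (EnvRel L) b) := by
      rw [map_add]; exact map_add R _ _
    rw [e]
    exact Q.add_mem (ha _ hy) (hb _ hy)

end RestrictedLieSub

/-! ### `p`-th powers of operators on tensor fields. -/

namespace WittSuper

/-- Left and right multiplication by `a` commute, so the `p`-th power of their difference is
computed by Frobenius. -/
theorem ad_pow_char {F A : Type*} [Field F] [Ring A] [Algebra F A] (p : ℕ) [Fact p.Prime]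
    [CharP F p] (a : A) :
    (LinearMap.mulLeft F a - LinearMap.mulRight F a) ^ p =
      LinearMap.mulLeft F (a ^ p) - LinearMap.mulRight F (a ^ p) := by
  rcases subsingleton_or_nontrivial A with h | h
  · exact LinearMap.ext fun x => Subsingleton.elim _ _
  · have : CharP (Module.End F A) p :=
      charP_of_injective_algebraMap (algebraMap F (Module.End F A)).injective p
    rw [← LinearMap.pow_mulLeft, ← LinearMap.pow_mulRight]
    exact sub_pow_char_of_commute (R := Module.End F A) p (LinearMap.commute_mulLeft_right a a)

variable {F : Type*} [Field F] {n : ℕ} {M : Type*} [AddCommGroup M] [Module F M]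

theorem D_eq_fD (i : Fin n) : D F i = fD F 1 i := by
  refine LinearMap.ext fun g => ?_
  change _ = 1 * D F i g
  rw [one_mul]

theorem D_mem_witt (i : Fin n) : D F i ∈ wittSpace F n :=
  Submodule.subset_span ⟨1, i, D_eq_fD i⟩

theorem jac_D (i j q : Fin n) : jac i j (D F q) = 0 := by
  rw [jac_apply, D_xi, tD_apply]
  split_ifs
  · rw [D_one, map_zero]
  · rw [map_zero, map_zero]

theorem tensorField_D (E : Fin n → Fin n → Module.End F M) (i : Fin n) (g : Lam F n) (m : M) :
    tensorField E (D F i) (tf g m) = tf (D F i g) m := by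
  simp [tensorField_tf, jac_D]

theorem tensorField_comm {E : Fin n → Fin n → Module.End F M} (hE : IsGlRep E)
    {T S : Module.End F (Lam F n)} (hT : IsSuperDer 0 T) (hS : S ∈ wittSpace F n) :
    tensorField E T * tensorField E S - tensorField E S * tensorField E T =
      tensorField E (T * S - S * T) := by
  obtain ⟨S₀, S₁, h0, h1, rfl⟩ := exists_superDer hS
  have a0 := tensorField_bracket hE hT h0
  have a1 := tensorField_bracket hE hT h1
  have e (i) : superSign 0 i = 1 := superSign_zero_left i
  simp only [e, one_smul] at a0 a1
  have e1 : T * (S₀ + S₁) - (S₀ + S₁) * T = (T * S₀ - S₀ * T) + (T * S₁ - S₁ * T) := by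
    noncomm_ring
  rw [e1, map_add, map_add, ← a0, ← a1]
  noncomm_ring

theorem tensorField_ad_pow {E : Fin n → Fin n → Module.End F M} (hE : IsGlRep E)
    {T S : Module.End F (Lam F n)} (hT : IsSuperDer 0 T) (hS : S ∈ wittSpace F n) (r : ℕ) :
    ((LinearMap.mulLeft F T - LinearMap.mulRight F T) ^ r) S ∈ wittSpace F n ∧
    ((LinearMap.mulLeft F (tensorField E T) - LinearMap.mulRight F (tensorField E T)) ^ r)
      (tensorField E S) =
      tensorField E (((LinearMap.mulLeft F T - LinearMap.mulRight F T) ^ r) S) := by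
  induction r with
  | zero => exact ⟨hS, rfl⟩
  | succ r ih =>
    simp only [pow_succ', Module.End.mul_apply, ih.2]
    set S' := ((LinearMap.mulLeft F T - LinearMap.mulRight F T) ^ r) S with hS'
    refine ⟨?_, tensorField_comm hE hT ih.1⟩
    obtain ⟨S₀, S₁, h0, h1, h⟩ := exists_superDer ih.1
    have a0 := (hT.bracket h0).mem
    have a1 := (hT.bracket h1).mem
    have e (i) : superSign 0 i = 1 := superSign_zero_left i
    simp only [e, one_smul] at a0 a1
    change T * S' - S' * T ∈ _
    have e1 : T * S' - S' * T = (T * S₀ - S₀ * T) + (T * S₁ - S₁ * T) := by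
      rw [h]; noncomm_ring
    rw [e1]
    exact Submodule.add_mem _ a0 a1

/-- An operator commuting with the `D_i` is determined by its values on the top component. -/
theorem eq_of_comm_D {X Y : Module.End F (TensorFields F n M)}
    (h : ∀ i, X * opTens F n M (D F i) - opTens F n M (D F i) * X =
      Y * opTens F n M (D F i) - opTens F n M (D F i) * Y)
    (h1 : ∀ m, X (tf (lamTop F n) m) = Y (tf (lamTop F n) m)) : X = Y := by
  -- In the form `hodge g`, every element of `Λ(n)` is reached from the top element by applying the
  -- `D_i`.
  have key : ∀ (g : Lam F n) (m : M), X (tf (hodge g) m) = Y (tf (hodge g) m) := by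
    intro g m
    induction g using lam_induction with
    | hr r =>
      rw [Algebra.algebraMap_eq_smul_one, map_smul, hodge_one, smul_tf, map_smul, map_smul, h1]
    | ha x y hx hy => simp only [map_add, add_tf, hx, hy]
    | hm i x hx =>
      have h2 := LinearMap.congr_fun (h i) (tf (hodge x) m)
      simp only [LinearMap.sub_apply, Module.End.mul_apply, opTens_tf, hx] at h2
      rw [hodge_xi_mul]
      exact sub_left_injective h2
  refine tf_ext fun f m => ?_
  obtain ⟨g, rfl⟩ := (hodge (F := F) (n := n)).surjective f
  exact key g m

theorem eps_of_odd (h2 : (2 : F) ≠ 0) {f : Lam F n} (hf : f ∈ lamParity F n 1) : eps f = 0 := by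
  have h := lamInv_of_mem hf
  have e : superSign 1 1 = -1 := by decide
  rw [e, neg_one_smul] at h
  have h3 := eps_lamInv f
  rw [h, map_neg] at h3
  have h4 : (2 : F) * eps f = 0 := by linear_combination -h3
  exact (mul_eq_zero.1 h4).resolve_left h2

/-- The coefficients of an even vector field are odd, hence without constant term. So all even
vector fields lie in `W(n)^0`. -/
theorem eps_apply_of_even (h2 : (2 : F) ≠ 0) {T : Module.End F (Lam F n)} (hT : IsSuperDer 0 T)
    (g : Lam F n) : eps (T g) = 0 := by
  rw [witt_apply hT.mem, map_sum]
  refine Finset.sum_eq_zero fun i _ => ?_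
  have h := eps_of_odd h2 (hT.1 1 _ (ι_mem_parity (Pi.single i 1)))
  rw [xi, map_mul, h, zero_mul]

end WittSuper

/-! ### The linear part of `W(n)^0`, the supertrace twist, and the representation of `u(W(n))`. -/

namespace WittSuper

variable {F : Type*} [Field F] {n : ℕ}

theorem fD_apply (f : Lam F n) (i : Fin n) (g : Lam F n) : fD F f i g = f * D F i g := rfl

theorem fD_mem (f : Lam F n) (i : Fin n) : fD F f i ∈ wittSpace F n :=
  Submodule.subset_span ⟨f, i, rfl⟩

theorem jac_fD (f : Lam F n) (q i j : Fin n) :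
    jac i j (fD F f q) = if q = i then tD j f else 0 := by
  rw [jac_apply, fD_apply, D_xi]
  split_ifs <;> simp

theorem tD_xi (i j : Fin n) : tD j (xi F i) = if j = i then 1 else 0 := by
  rw [tD_apply, D_xi]; split_ifs <;> simp

theorem xiD_comm (i j k l : Fin n) :
    fD F (xi F i) j * fD F (xi F k) l - fD F (xi F k) l * fD F (xi F i) j =
      (if j = k then fD F (xi F i) l else 0) - (if i = l then fD F (xi F k) j else 0) := by
  refine LinearMap.ext fun g => ?_
  have e : ∀ i j k l : Fin n, (fD F (xi F i) j * fD F (xi F k) l) g =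
      (if j = k then fD F (xi F i) l g else 0) - xi F i * (xi F k * D F j (D F l g)) := by
    intro i j k l
    rw [Module.End.mul_apply, fD_apply, fD_apply, D_xi_mul, mul_sub]
    split_ifs <;> simp [fD_apply]
  rw [LinearMap.sub_apply, e, e, D_D l j, ← mul_assoc (xi F k), xi_mul_xi k i]
  simp only [eq_comm (a := l), LinearMap.sub_apply]
  split_ifs <;> simp [mul_assoc] <;> abel

theorem xiD_sq (i j : Fin n) :
    fD F (xi F i) j * fD F (xi F i) j = if i = j then fD F (xi F i) i else 0 := by
  refine LinearMap.ext fun g => ?_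
  rw [Module.End.mul_apply, fD_apply, fD_apply, D_xi_mul, D_D_self]
  split_ifs with h1 h2 h2
  · subst h1; simp [fD_apply]
  · exact absurd h1.symm h2
  · exact absurd h2.symm h1
  · simp

theorem xiD_even (i j : Fin n) : fD F (xi F i) j ∈ endParity F n 0 := by
  have := fD_parity (ι_mem_parity (Pi.single i (1 : F))) j
  exact this

theorem eps_of_mem_power {d : ℕ} (hd : 1 ≤ d) {f : Lam F n} (hf : f ∈ ⋀[F]^d (Fin n → F)) :
    eps f = 0 := by
  obtain ⟨d, rfl⟩ : ∃ e, d = e + 1 := ⟨d - 1, by omega⟩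
  change f ∈ LinearMap.range (ExteriorAlgebra.ι F (M := Fin n → F)) ^ (d + 1) at hf
  rw [pow_succ] at hf
  induction hf using Submodule.mul_induction_on' with
  | mem_mul_mem a _ b hb =>
    obtain ⟨v, rfl⟩ := hb
    rw [map_mul, eps_ι, mul_zero]
  | add x _ y _ hx hy => rw [map_add, hx, hy, add_zero]

theorem eps_tD_of_mem_power {d : ℕ} (hd : 2 ≤ d) {f : Lam F n} (hf : f ∈ ⋀[F]^d (Fin n → F))
    (j : Fin n) : eps (tD j f) = 0 := by
  obtain ⟨d, rfl⟩ : ∃ e, d = e + 1 := ⟨d - 1, by omega⟩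
  rw [tD_apply, eps_lamInv]
  change f ∈ LinearMap.range (ExteriorAlgebra.ι F (M := Fin n → F)) ^ (d + 1) at hf
  rw [pow_succ] at hf
  induction hf using Submodule.mul_induction_on' with
  | mem_mul_mem a ha b hb =>
    obtain ⟨v, rfl⟩ := hb
    have ha' : eps a = 0 := eps_of_mem_power (d := d) (by omega) ha
    rw [D_mul, map_add, map_mul, map_mul, eps_ι, eps_lamInv, ha']
    simp
  | add x _ y _ hx hy => rw [map_add, map_add, hx, hy, add_zero]

/-- The difference of a vector field and its linear part. -/
noncomputable def subLinear : Module.End F (Lam F n) →ₗ[F] Module.End F (Lam F n) :=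
  LinearMap.id - ∑ i, ∑ j, LinearMap.smulRight (eps.toLinearMap ∘ₗ jac i j) (fD F (xi F j) i)

theorem subLinear_apply (T : Module.End F (Lam F n)) :
    subLinear T = T - ∑ i, ∑ j, eps (jac i j T) • fD F (xi F j) i := by
  simp [subLinear, LinearMap.sum_apply]

/-- On `f D_i` with `f` of degree one the linear part is the field itself; in degree at least two it
is zero and the field already lies in `W(n)^1`. -/
theorem subLinear_mem {T : Module.End F (Lam F n)} (hT : T ∈ wittFil F n 0) :
    subLinear T ∈ wittFil F n 1 := by
  have h : wittFil F n 0 ≤ (wittFil F n 1).comap subLinear := by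
    refine iSup_le fun k => Submodule.span_le.2 ?_
    rintro _ ⟨d, f, i, hd, hf, rfl⟩
    have hk := k.2
    change subLinear _ ∈ wittFil F n 1
    have e : subLinear (fD F f i) = fD F f i - ∑ j, eps (tD j f) • fD F (xi F j) i := by
      rw [subLinear_apply, Finset.sum_eq_single i]
      · simp [jac_fD]
      · intro q _ hq; simp [jac_fD, Ne.symm hq]
      · simp
    rw [e]
    rcases Nat.lt_or_ge d 2 with h2 | h2
    · obtain rfl : d = 1 := by omega
      have hf' : f ∈ LinearMap.range (ExteriorAlgebra.ι F (M := Fin n → F)) ^ 1 := hf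
      rw [pow_one] at hf'
      obtain ⟨v, rfl⟩ := hf'
      have e2 : fD F (ExteriorAlgebra.ι F v) i =
          ∑ j, eps (tD j (ExteriorAlgebra.ι F v)) • fD F (xi F j) i := by
        refine LinearMap.ext fun g => ?_
        simp only [LinearMap.sum_apply, LinearMap.smul_apply, fD_apply, tD_apply, D_ι,
          AlgHom.commutes]
        rw [xi_sum v, Finset.sum_mul]
        refine Finset.sum_congr rfl fun j _ => ?_
        rw [smul_mul_assoc]; rfl
      rw [← e2, sub_self]
      exact Submodule.zero_mem _
    · rw [Finset.sum_eq_zero fun j _ => by rw [eps_tD_of_mem_power h2 hf, zero_smul], sub_zero]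
      exact Submodule.mem_iSup_of_mem (⟨(d : ℤ) - 1, by omega⟩ : {j : ℤ // (1 : ℤ) ≤ j})
        (Submodule.subset_span ⟨d, f, i, by simp, hf, rfl⟩)
  exact h hT

variable {p : ℕ} [Fact p.Prime] [CharP F p]
  {M : Type*} [AddCommGroup M] [Module F M] [Module (RestrictedLieSub.Env (W0 F n p)) M]
  [IsScalarTower F (RestrictedLieSub.Env (W0 F n p)) M]

variable (F n p M) in
/-- The action of `W(n)^0` on a module. -/
noncomputable def act : (W0 F n p).carrier →ₗ[F] Module.End F M :=
  (Algebra.lsmul F F M : RestrictedLieSub.Env (W0 F n p) →ₐ[F] _).toLinearMap ∘ₗ (W0 F n p).ι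

variable (F n p M) in
/-- The action of the elementary matrix `ξ_i D_j`. -/
noncomputable def elem (i j : Fin n) : Module.End F M := act F n p M (xiD F p i j)

variable (F n p M) in
/-- The action of the elementary matrices twisted by the supertrace. -/
noncomputable def elemShift (i j : Fin n) : Module.End F M :=
  elem F n p M i j - if i = j then 1 else 0

theorem act_sub (x y : (W0 F n p).carrier) :
    act F n p M (x - y) = act F n p M x - act F n p M y :=
  LinearMap.map_sub (act F n p M) x y

theorem act_pow (x : (W0 F n p).carrier) (hx : (x : Module.End F (Lam F n)) ∈ endParity F n 0) :
    act F n p M x ^ p = act F n p M ⟨_, (W0 F n p).pow_mem x x.2 hx⟩ := by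
  change Algebra.lsmul F F M _ ^ p = Algebra.lsmul F F M _
  rw [← map_pow, RestrictedLieSub.ι_pow _ x hx]

theorem isGlRep_elem : IsGlRep (elem F n p M) := by
  intro i j k l
  have h := (W0 F n p).ι_bracket 0 0 (xiD F p i j) (xiD F p k l) (xiD_even i j) (xiD_even k l)
  have e : superSign 0 0 = 1 := by decide
  have h' := congrArg (Algebra.lsmul F F M : RestrictedLieSub.Env (W0 F n p) →ₐ[F] _) h
  simp only [e, one_smul, map_sub, map_mul] at h'
  refine h'.trans ?_
  have e2 : (⟨(xiD F p i j : Module.End F (Lam F n)) * xiD F p k l -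
      superSign 0 0 • ((xiD F p k l : Module.End F (Lam F n)) * xiD F p i j),
      (W0 F n p).bracket_mem 0 0 _ (xiD F p i j).2 _ (xiD F p k l).2 (xiD_even i j)
        (xiD_even k l)⟩ : (W0 F n p).carrier) =
      (if j = k then xiD F p i l else 0) - (if i = l then xiD F p k j else 0) := by
    refine Subtype.ext ?_
    simp only [e, one_smul]
    refine (xiD_comm i j k l).trans ?_
    split_ifs <;> simp [xiD]
  simp only [e, one_smul] at e2
  rw [e2]
  change act F n p M _ = _
  rw [act_sub]
  split_ifs <;> simp [elem]

/-- The subtracted scalars form the trace character of `gl_n`, which does not change commutators and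
vanishes on them. -/
theorem isGlRep_elemShift : IsGlRep (elemShift F n p M) := by
  intro i j k l
  have h := isGlRep_elem (F := F) (p := p) (M := M) i j k l
  have e : ∀ (c : Prop) [Decidable c] (x : Module.End F M),
      x * (if c then 1 else 0) = (if c then 1 else 0) * x := by
    intro c _ x; split_ifs <;> simp
  have e2 : elemShift F n p M i j * elemShift F n p M k l -
      elemShift F n p M k l * elemShift F n p M i j =
      elem F n p M i j * elem F n p M k l - elem F n p M k l * elem F n p M i j := by
    simp only [elemShift, sub_mul, mul_sub, e _ (elem F n p M _ _), e (k = l) (if i = j then _ else _)]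
    abel
  rw [e2, h]
  unfold elemShift
  by_cases h1 : j = k <;> by_cases h2 : i = l
  · subst h1 h2; simp
  · subst h1; simp [h2]
  · subst h2; simp [h1, Ne.symm h1]
  · simp [h1, h2]

/-- `ξ_i D_j` squares to zero on `Λ(n)`, so its `p`-mapping is zero. This nilpotency on `M` later
replaces an ordering of weights. -/
theorem elem_pow_of_ne {i j : Fin n} (h : i ≠ j) : elem F n p M i j ^ p = 0 := by
  rw [elem, act_pow _ (xiD_even i j)]
  rw [show (⟨_, (W0 F n p).pow_mem _ (xiD F p i j).2 (xiD_even i j)⟩ : (W0 F n p).carrier) = 0 from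
    Subtype.ext ?_, map_zero]
  have h2 : fD F (xi F i) j ^ 2 = 0 := by rw [pow_two, xiD_sq, if_neg h]
  exact pow_eq_zero_of_le (Fact.out : p.Prime).two_le h2

theorem elem_pow_self (i : Fin n) : elem F n p M i i ^ p = elem F n p M i i := by
  rw [elem, act_pow _ (xiD_even i i)]
  congr 1
  refine Subtype.ext ?_
  have h2 : IsIdempotentElem (fD F (xi F i) i) := by
    rw [IsIdempotentElem, xiD_sq, if_pos rfl]
  exact h2.pow_eq (Fact.out : p.Prime).ne_zero

/-- `W(n)^0` acts through its linear part on modules killed by `W(n)^1`. -/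
theorem act_eq_sum (hann : ∀ x : (W0 F n p).carrier,
      (x : Module.End F (Lam F n)) ∈ wittFil F n 1 → ∀ m : M, (W0 F n p).ι x • m = 0)
    (x : (W0 F n p).carrier) :
    act F n p M x = ∑ i, ∑ j, eps (jac i j (x : Module.End F (Lam F n))) • elem F n p M j i := by
  have h : act F n p M (x - ∑ i, ∑ j, eps (jac i j (x : Module.End F (Lam F n))) •
      xiD F p j i) = 0 := by
    refine LinearMap.ext fun m => hann _ ?_ m
    have := subLinear_mem x.2
    rw [subLinear_apply] at this
    convert this using 1
    simp [xiD]
  rw [act_sub, sub_eq_zero] at h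
  rw [h]
  simp [elem]

/-- A field in `W(n)^0` scales `ξ_1⋯ξ_n` by the trace of its linear part. The `-1` on the diagonal
of `elemShift` cancels exactly this factor. -/
theorem tensorField_lamTop (hann : ∀ x : (W0 F n p).carrier,
      (x : Module.End F (Lam F n)) ∈ wittFil F n 1 → ∀ m : M, (W0 F n p).ι x • m = 0)
    (x : (W0 F n p).carrier) (m : M) :
    tensorField (elemShift F n p M) x (tf (lamTop F n) m) = tf (lamTop F n) (act F n p M x m) := by
  have hx : (x : Module.End F (Lam F n)) ∈ wittFil F n 0 := x.2
  have h1 : (x : Module.End F (Lam F n)) (lamTop F n) =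
      ∑ i, eps (jac i i (x : Module.End F (Lam F n))) • lamTop F n := by
    rw [witt_apply (wittFil_le 0 hx)]
    exact Finset.sum_congr rfl fun i _ => mul_D_lamTop (algebraMapInv_of_mem hx _) i
  rw [tensorField_tf, h1, act_eq_sum hann, sum_tf, ← Finset.sum_add_distrib, LinearMap.sum_apply,
    tf_sum]
  refine Finset.sum_congr rfl fun i _ => ?_
  simp only [mul_lamTop, smul_tf, LinearMap.sum_apply, tf_sum, LinearMap.smul_apply, tf_smul,
    elemShift, LinearMap.sub_apply, tf_sub, Finset.sum_sub_distrib]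
  rw [Finset.sum_eq_single (f := fun j => eps (jac i j (x : Module.End F (Lam F n))) •
    tf (lamTop F n) ((if j = i then (1 : Module.End F M) else 0) m)) i]
  · simp
  · intro j _ hj; simp [hj]
  · simp

/-- Both sides have the same commutators with the `D_i`, since `ad(T)^p = ad(T^p)` holds for the
fields and for their images. On `ξ_1⋯ξ_n ⊗ M` they agree because `M` is a restricted module and `T`,
being even, lies in `W(n)^0`. Such operators are equal by `eq_of_comm_D`. -/
theorem tensorField_pow (h2 : (2 : F) ≠ 0) (hann : ∀ x : (W0 F n p).carrier,
      (x : Module.End F (Lam F n)) ∈ wittFil F n 1 → ∀ m : M, (W0 F n p).ι x • m = 0)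
    {T : Module.End F (Lam F n)} (hT : IsSuperDer 0 T) :
    tensorField (elemShift F n p M) T ^ p = tensorField (elemShift F n p M) (T ^ p) := by
  have hE := isGlRep_elemShift (F := F) (n := n) (p := p) (M := M)
  have hT0 : T ∈ wittFil F n 0 := hT.mem_wittFil (eps_apply_of_even h2 hT)
  have eD : ∀ i, tensorField (elemShift F n p M) (D F i) = opTens F n M (D F i) := fun i =>
    tf_ext fun g m => tensorField_D _ i g m
  refine eq_of_comm_D (fun i => ?_) fun m => ?_
  · have h3 := (tensorField_ad_pow hE hT (D_mem_witt i) p).2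
    rw [ad_pow_char, ad_pow_char] at h3
    rw [← eD, tensorField_comm hE (hT.pow_char p) (D_mem_witt i)]
    exact h3
  · have hpow : ∀ r : ℕ, (tensorField (elemShift F n p M) T ^ r) (tf (lamTop F n) m) =
        tf (lamTop F n) ((act F n p M ⟨T, hT0⟩ ^ r) m) := by
      intro r
      induction r with
      | zero => rfl
      | succ r ih =>
        rw [pow_succ', Module.End.mul_apply, ih, pow_succ', Module.End.mul_apply]
        exact tensorField_lamTop hann ⟨T, hT0⟩ _
    rw [hpow, act_pow ⟨T, hT0⟩ hT.1]
    exact (tensorField_lamTop hann ⟨T ^ p, _⟩ m).symm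

/-- The representation of `u(W(n))` on tensor fields. -/
noncomputable def tensorRep (h2 : (2 : F) ≠ 0) (hann : ∀ x : (W0 F n p).carrier,
      (x : Module.End F (Lam F n)) ∈ wittFil F n 1 → ∀ m : M, (W0 F n p).ι x • m = 0) :
    RestrictedLieSub.Env (W F n p) →ₐ[F] Module.End F (TensorFields F n M) :=
  (W F n p).envLift (tensorField (elemShift F n p M) ∘ₗ (W F n p).carrier.subtype)
    (fun _ _ x y hx hy => tensorField_bracket isGlRep_elemShift (isSuperDer_of_mem x.2 hx)
      (isSuperDer_of_mem y.2 hy))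
    (fun x hx => tensorField_pow h2 hann (isSuperDer_of_mem x.2 hx))

theorem tensorRep_ι (h2 : (2 : F) ≠ 0) (hann : ∀ x : (W0 F n p).carrier,
      (x : Module.End F (Lam F n)) ∈ wittFil F n 1 → ∀ m : M, (W0 F n p).ι x • m = 0)
    (x : (W F n p).carrier) :
    tensorRep h2 hann ((W F n p).ι x) = tensorField (elemShift F n p M) x :=
  RestrictedLieSub.envLift_ι _ _ _ _ x

end WittSuper


/-! ### Parity of `u(L)` and maps out of induced modules. -/

namespace RestrictedLieSub

variable {p : ℕ} {F A : Type*} [Field F] [Ring A] [Algebra F A] {𝒜 : ZMod 2 → Submodule F A}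

theorem one_mem_envParity (L : RestrictedLieSub p 𝒜) : 1 ∈ L.envParity 0 :=
  Submodule.subset_span ⟨[], by simp⟩

theorem ι_mul_mem_envParity (L : RestrictedLieSub p 𝒜) {i k : ZMod 2} {x : L.carrier}
    (hx : (x : A) ∈ 𝒜 i) {u : Env L} (hu : u ∈ L.envParity k) :
    L.ι x * u ∈ L.envParity (i + k) := by
  have h : L.envParity k ≤ (L.envParity (i + k)).comap (LinearMap.mulLeft F (L.ι x)) := by
    refine Submodule.span_le.2 ?_
    rintro _ ⟨l, hl, hs, rfl⟩
    refine Submodule.subset_span ⟨(i, x) :: l, ?_, ?_, ?_⟩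
    · intro q hq
      rcases List.mem_cons.1 hq with rfl | hq
      · exact hx
      · exact hl q hq
    · simp [hs]
    · simp
  exact h hu

end RestrictedLieSub

section Induced

open scoped TensorProduct

variable {F : Type*} [Field F] {B U : Type*} [Ring B] [Algebra F B] [Ring U] [Algebra F U]
  (φ : B →ₐ[F] U) {M : Type*} [AddCommGroup M] [Module F M] [Module B M]

/-- The element `a ⊗ m` of the induced module. -/
def inducedMk (a : U) (m : M) : InducedModule φ M := (inducedRel φ M).mkQ (a ⊗ₜ[F] m)

theorem inducedMk_add_left (a b : U) (m : M) :
    inducedMk φ (a + b) m = inducedMk φ a m + inducedMk φ b m := by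
  rw [inducedMk, TensorProduct.add_tmul, map_add]; rfl

theorem inducedMk_add_right (a : U) (m m' : M) :
    inducedMk φ a (m + m') = inducedMk φ a m + inducedMk φ a m' := by
  rw [inducedMk, TensorProduct.tmul_add, map_add]; rfl

theorem inducedMk_smul_left (c : F) (a : U) (m : M) :
    inducedMk φ (c • a) m = c • inducedMk φ a m := rfl

theorem inducedMk_smul_right (c : F) (a : U) (m : M) :
    inducedMk φ a (c • m) = c • inducedMk φ a m := by
  rw [inducedMk, TensorProduct.tmul_smul]; rfl

theorem smul_inducedMk (a b : U) (m : M) : a • inducedMk φ b m = inducedMk φ (a * b) m := rfl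

theorem inducedMk_mul (a : U) (b : B) (m : M) :
    inducedMk φ (a * φ b) m = inducedMk φ a (b • m) :=
  (Submodule.Quotient.eq _).2 (Submodule.subset_span ⟨a, b, m, rfl⟩)

theorem inducedMk_induction {P : InducedModule φ M → Prop} (h0 : P 0)
    (hm : ∀ a m, P (inducedMk φ a m)) (ha : ∀ x y, P x → P y → P (x + y))
    (x : InducedModule φ M) : P x := by
  obtain ⟨z, rfl⟩ := Submodule.mkQ_surjective _ x
  induction z with
  | zero => rw [map_zero]; exact h0
  | tmul a m => exact hm a m
  | add x y hx hy => rw [map_add]; exact ha _ _ hx hy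

/-- Linear maps out of the induced module. -/
noncomputable def inducedLift {N : Type*} [AddCommGroup N] [Module F N]
    (R : U →ₐ[F] Module.End F N) (f : M →ₗ[F] N) (h : ∀ b m, R (φ b) (f m) = f (b • m)) :
    InducedModule φ M →ₗ[F] N :=
  Submodule.liftQ ((inducedRel φ M).restrictScalars F)
    (TensorProduct.lift (LinearMap.lcomp F N f ∘ₗ R.toLinearMap)) (by
      have key : ∀ (a : U) (z : U ⊗[F] M),
          TensorProduct.lift (LinearMap.lcomp F N f ∘ₗ R.toLinearMap) (a • z) =
            R a (TensorProduct.lift (LinearMap.lcomp F N f ∘ₗ R.toLinearMap) z) := by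
        intro a z
        induction z with
        | zero => simp
        | tmul b m =>
          rw [TensorProduct.smul_tmul', smul_eq_mul]
          simp
        | add x y hx hy => rw [smul_add, map_add, hx, hy, map_add, map_add]
      intro z hz
      rw [Submodule.restrictScalars_mem] at hz
      rw [LinearMap.mem_ker]
      induction hz using Submodule.span_induction with
      | mem x hx =>
        obtain ⟨a, b, m, rfl⟩ := hx
        rw [map_sub]
        simp [h]
      | zero => simp
      | add x y _ _ hx hy => rw [map_add, hx, hy, add_zero]
      | smul a x _ hx => rw [key, hx, map_zero]) ∘ₗ
  (Submodule.Quotient.restrictScalarsEquiv F (inducedRel φ M)).symm.toLinearMap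

theorem inducedLift_mk {N : Type*} [AddCommGroup N] [Module F N]
    (R : U →ₐ[F] Module.End F N) (f : M →ₗ[F] N) (h : ∀ b m, R (φ b) (f m) = f (b • m))
    (a : U) (m : M) : inducedLift φ R f h (inducedMk φ a m) = R a (f m) := rfl

theorem inducedLift_smul {N : Type*} [AddCommGroup N] [Module F N]
    (R : U →ₐ[F] Module.End F N) (f : M →ₗ[F] N) (h : ∀ b m, R (φ b) (f m) = f (b • m))
    (a : U) (x : InducedModule φ M) : inducedLift φ R f h (a • x) = R a (inducedLift φ R f h x) := by
  induction x using inducedMk_induction with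
  | h0 => rw [smul_zero, map_zero, map_zero]
  | hm b m => rw [smul_inducedMk, inducedLift_mk, inducedLift_mk, map_mul]; rfl
  | ha x y hx hy => rw [smul_add, map_add, map_add, hx, hy, map_add]

end Induced

/-! ### The isomorphism of the induced module with tensor fields. -/

namespace WittSuper

variable {F : Type*} [Field F] {n : ℕ} {p : ℕ} [Fact p.Prime] [CharP F p]

variable (F n p) in
/-- The element `∑ v_i D_i` of `W(n)`. -/
noncomputable def dVec : (Fin n → F) →ₗ[F] (W F n p).carrier :=
  ∑ i, LinearMap.smulRight (LinearMap.proj i) ⟨D F i, D_mem_witt i⟩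

theorem coe_dVec (v : Fin n → F) : (dVec F n p v : Module.End F (Lam F n)) =
    CliffordAlgebra.contractLeft (Q := (0 : QuadraticForm F (Fin n → F)))
          (∑ i, v i • LinearMap.proj i) := by
  simp [dVec, D, LinearMap.sum_apply]

theorem dVec_single (i : Fin n) : dVec F n p (Pi.single i 1) = ⟨D F i, D_mem_witt i⟩ := by
  rw [dVec, LinearMap.sum_apply, Finset.sum_eq_single i]
  · simp
  · intro b _ hb; simp [hb]
  · simp

theorem dVec_odd (v : Fin n → F) : (dVec F n p v : Module.End F (Lam F n)) ∈ endParity F n 1 := by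
  have : (dVec F n p v : Module.End F (Lam F n)) = ∑ i, v i • D F i := by
    simp [dVec, LinearMap.sum_apply]
  rw [this]
  exact Submodule.sum_mem _ fun i _ => Submodule.smul_mem _ _ (D_parity i)

/-- The algebra homomorphism `Λ(n) → u(W(n))` taking `ξ_i` to `D_i`. -/
noncomputable def dEnv (h2 : (2 : F) ≠ 0) : Lam F n →ₐ[F] RestrictedLieSub.Env (W F n p) :=
  ExteriorAlgebra.lift F ⟨(W F n p).ι ∘ₗ dVec F n p, fun v => by
    have h := (W F n p).ι_bracket 1 1 (dVec F n p v) (dVec F n p v) (dVec_odd v) (dVec_odd v)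
    have e : superSign 1 1 = -1 := by decide
    have e2 : (dVec F n p v : Module.End F (Lam F n)) * dVec F n p v = 0 := by
      rw [coe_dVec]
      exact LinearMap.ext fun g => CliffordAlgebra.contractLeft_contractLeft _ _
    have e3 : (⟨(dVec F n p v : Module.End F (Lam F n)) * dVec F n p v -
        superSign 1 1 • ((dVec F n p v : Module.End F (Lam F n)) * dVec F n p v),
        (W F n p).bracket_mem 1 1 _ (dVec F n p v).2 _ (dVec F n p v).2 (dVec_odd v)
          (dVec_odd v)⟩ : (W F n p).carrier) = 0 := Subtype.ext (by simp [e2])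
    -- The bracket relation for an odd element with itself reads `2 x² = [x, x]`, here zero.
    rw [e3, map_zero, e, neg_one_smul, sub_neg_eq_add, ← two_smul F] at h
    exact (smul_eq_zero.1 h).resolve_left h2⟩

theorem dEnv_ι (h2 : (2 : F) ≠ 0) (v : Fin n → F) :
    dEnv (p := p) h2 (ExteriorAlgebra.ι F v) = (W F n p).ι (dVec F n p v) := by
  rw [dEnv, ExteriorAlgebra.lift_ι_apply]; rfl

theorem dEnv_xi (h2 : (2 : F) ≠ 0) (i : Fin n) :
    dEnv (p := p) h2 (xi F i) = (W F n p).ι ⟨D F i, D_mem_witt i⟩ := by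
  rw [xi, dEnv_ι, dVec_single]

theorem dEnv_mem (h2 : (2 : F) ≠ 0) {k : ZMod 2} {f : Lam F n} (hf : f ∈ lamParity F n k) :
    dEnv h2 f ∈ (W F n p).envParity k := by
  induction f, hf using CliffordAlgebra.evenOdd_induction with
  | range_ι_pow v hv =>
    have hl := zmod_two k
    rcases hl with rfl | rfl
    · have hv : v ∈ (1 : Submodule F (Lam F n)) := by simpa using hv
      obtain ⟨r, rfl⟩ := Submodule.mem_one.1 hv
      rw [AlgHom.commutes, Algebra.algebraMap_eq_smul_one]
      exact Submodule.smul_mem _ _ (W F n p).one_mem_envParity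
    · have e : (1 : ZMod 2).val = 1 := rfl
      rw [e, pow_one] at hv
      obtain ⟨w, rfl⟩ := hv
      have h := (W F n p).ι_mul_mem_envParity (dVec_odd w) (W F n p).one_mem_envParity
      rw [mul_one, ← dEnv_ι h2] at h
      exact h
  | add x y hx hy ihx ihy => rw [map_add]; exact Submodule.add_mem _ ihx ihy
  | ι_mul_ι_mul v w x hx ih =>
    have h := (W F n p).ι_mul_mem_envParity (dVec_odd v)
      ((W F n p).ι_mul_mem_envParity (dVec_odd w) ih)
    rw [one_add_one_add, ← mul_assoc, ← dEnv_ι h2, ← dEnv_ι h2, ← map_mul, ← map_mul] at h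
    exact h

variable {M : Type*} [AddCommGroup M] [Module F M] [Module (RestrictedLieSub.Env (W0 F n p)) M]

variable (F n p) in
/-- The element `a ⊗ m` of the induced module. -/
noncomputable abbrev kacMk (a : RestrictedLieSub.Env (W F n p)) (m : M) : KacModule F n p M :=
  inducedMk (RestrictedLieSub.envMap (W0_le_W F n p)) a m

/-- The map `Λ(n) ⊗ M → u(W(n)) ⊗ M`, `g ⊗ m ↦ g(D_1, …, D_n) ⊗ m`. -/
noncomputable def ofTensor (h2 : (2 : F) ≠ 0) : TensorFields F n M →ₗ[F] KacModule F n p M :=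
  tfLift (LinearMap.mk₂ F (fun g m => kacMk F n p (dEnv h2 g) m)
    (fun _ _ _ => by rw [map_add]; exact inducedMk_add_left _ _ _ _)
    (fun _ _ _ => by rw [map_smul]; exact inducedMk_smul_left _ _ _ _)
    (fun _ _ _ => inducedMk_add_right _ _ _ _) (fun _ _ _ => inducedMk_smul_right _ _ _ _))

theorem ofTensor_tf (h2 : (2 : F) ≠ 0) (g : Lam F n) (m : M) :
    ofTensor (p := p) h2 (tf g m) = kacMk F n p (dEnv h2 g) m := rfl

theorem D_smul_ofTensor (h2 : (2 : F) ≠ 0) (i : Fin n) (w : TensorFields F n M) :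
    (W F n p).ι ⟨D F i, D_mem_witt i⟩ • ofTensor (p := p) h2 w =
      ofTensor h2 (mulTens F n M (xi F i) 1 w) := by
  induction w using tf_induction with
  | h0 => simp
  | ht f m =>
    rw [mulTens_tf, ofTensor_tf, ofTensor_tf, smul_inducedMk, map_mul, dEnv_xi]; rfl
  | ha x y hx hy => rw [map_add, smul_add, hx, hy, map_add, map_add]

theorem smul_kac_comm (c : F) (u : RestrictedLieSub.Env (W F n p)) (x : KacModule F n p M) :
    u • c • x = c • u • x := by
  induction x using inducedMk_induction with
  | h0 => simp
  | hm a m =>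
    rw [← inducedMk_smul_left, smul_inducedMk, smul_inducedMk, ← inducedMk_smul_left,
      mul_smul_comm]
  | ha x y hx hy => simp only [smul_add, hx, hy]

theorem exists_sub_mem_wittFil {T : Module.End F (Lam F n)} (hT : T ∈ wittSpace F n) :
    T - ∑ i, eps (T (xi F i)) • D F i ∈ wittFil F n 0 := by
  have e : T - ∑ i, eps (T (xi F i)) • D F i =
      ∑ i, fD F (T (xi F i) - algebraMap F _ (eps (T (xi F i)))) i := by
    refine LinearMap.ext fun g => ?_
    rw [LinearMap.sub_apply, witt_apply hT]
    simp only [LinearMap.sum_apply, fD_apply, sub_mul, Finset.sum_sub_distrib,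
      LinearMap.smul_apply]
    simp only [Algebra.smul_def]
  rw [e]
  refine Submodule.sum_mem _ fun i _ => fD_mem_wittFil ?_ i
  change eps _ = 0
  rw [map_sub, eps_algebraMap, sub_self]

/-- Split `x` into constant coefficients and a part in `W(n)^0`: the former is a combination of the
`D_i`, the latter passes through the tensor sign and acts on `m`. -/
theorem ι_smul_kacMk_one_mem (h2 : (2 : F) ≠ 0) (x : (W F n p).carrier) (m : M) :
    (W F n p).ι x • kacMk F n p 1 m ∈ LinearMap.range (ofTensor (p := p) (M := M) h2) := by
  set y : (W0 F n p).carrier := ⟨_, exists_sub_mem_wittFil x.2⟩ with hy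
  have e : x = Submodule.inclusion (W0_le_W F n p) y +
      ∑ i, eps ((x : Module.End F (Lam F n)) (xi F i)) • (⟨D F i, D_mem_witt i⟩ :
        (W F n p).carrier) := by
    refine Subtype.ext ?_
    simp [hy]
  have e2 : (W F n p).ι x • kacMk F n p 1 m = kacMk F n p ((W F n p).ι x) m := by
    rw [smul_inducedMk, mul_one]
  have e3 : (W F n p).ι x = RestrictedLieSub.envMap (W0_le_W F n p) ((W0 F n p).ι y) +
      dEnv h2 (∑ i, eps ((x : Module.End F (Lam F n)) (xi F i)) • xi F i) := by
    rw [RestrictedLieSub.envMap_ι]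
    conv_lhs => rw [e]
    rw [map_add, map_sum, map_sum]
    simp only [map_smul, dEnv_xi]
  rw [e2, e3, kacMk, inducedMk_add_left]
  refine Submodule.add_mem _ ⟨tf 1 ((W0 F n p).ι y • m), ?_⟩ ⟨tf _ m, rfl⟩
  rw [ofTensor_tf, map_one]
  have := inducedMk_mul (RestrictedLieSub.envMap (W0_le_W F n p)) 1 ((W0 F n p).ι y) m
  rw [one_mul] at this
  exact this.symm

/-- Induction step for the spanning argument: `x D_i z` differs by `[x, D_i] z` from `± D_i x z`. -/
theorem ι_smul_D_smul_mem {N : Type*} [AddCommGroup N] [Module F N]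
    [Module (RestrictedLieSub.Env (W F n p)) N] {Q : Submodule F N} {i : Fin n} {z : N}
    (hD : ∀ y ∈ Q, (W F n p).ι ⟨D F i, D_mem_witt i⟩ • y ∈ Q)
    (hz : ∀ x : (W F n p).carrier, (W F n p).ι x • z ∈ Q) (x : (W F n p).carrier) :
    (W F n p).ι x • (W F n p).ι ⟨D F i, D_mem_witt i⟩ • z ∈ Q := by
  have hom : ∀ (k : ZMod 2) (y : (W F n p).carrier),
      (y : Module.End F (Lam F n)) ∈ endParity F n k →
      (W F n p).ι y • (W F n p).ι ⟨D F i, D_mem_witt i⟩ • z ∈ Q := by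
    intro k y hy
    have h := (W F n p).ι_bracket k 1 y ⟨D F i, D_mem_witt i⟩ hy (D_parity i)
    rw [sub_eq_iff_eq_add] at h
    rw [smul_smul, h, add_smul]
    refine Q.add_mem (hz _) ?_
    rw [smul_assoc, mul_smul]
    exact zsmul_mem (hD _ (hz y)) _
  obtain ⟨a, ha, b, hb, ha0, hb1, hab⟩ := (W F n p).graded x x.2
  have e2 : x = (⟨a, ha⟩ : (W F n p).carrier) + ⟨b, hb⟩ := Subtype.ext hab
  rw [e2, map_add, add_smul]
  exact Q.add_mem (hom 0 _ ha0) (hom 1 _ hb1)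

theorem ι_smul_mem_range (h2 : (2 : F) ≠ 0) (g : Lam F n) : ∀ (x : (W F n p).carrier) (m : M),
    (W F n p).ι x • ofTensor (p := p) h2 (tf g m) ∈
      LinearMap.range (ofTensor (p := p) (M := M) h2) := by
  induction g using lam_induction with
  | hr r =>
    intro x m
    rw [Algebra.algebraMap_eq_smul_one, smul_tf, map_smul, smul_kac_comm]
    refine Submodule.smul_mem _ _ ?_
    rw [ofTensor_tf, map_one]
    exact ι_smul_kacMk_one_mem h2 x m
  | ha f g hf hg =>
    intro x m
    rw [add_tf, map_add, smul_add]
    exact Submodule.add_mem _ (hf x m) (hg x m)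
  | hm i g hg =>
    intro x m
    have e1 : ofTensor (p := p) h2 (tf (xi F i * g) m) =
        (W F n p).ι ⟨D F i, D_mem_witt i⟩ • ofTensor (p := p) h2 (tf g m) :=
      (D_smul_ofTensor h2 i (tf g m)).symm
    rw [e1]
    refine ι_smul_D_smul_mem ?_ (fun y => hg y m) x
    rintro _ ⟨w, rfl⟩
    exact ⟨mulTens F n M (xi F i) 1 w, (D_smul_ofTensor (n := n) h2 i w).symm⟩

/-- The spanning half of a Poincaré–Birkhoff–Witt theorem. The independence half is supplied by the
representation on tensor fields. -/
theorem ofTensor_surjective (h2 : (2 : F) ≠ 0) :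
    Function.Surjective (ofTensor (p := p) (F := F) (n := n) (M := M) h2) := by
  have hst := RestrictedLieSub.env_stable (W F n p)
    (Algebra.lsmul F F (KacModule F n p M)) (LinearMap.range (ofTensor (p := p) (M := M) h2)) (by
      rintro x _ ⟨w, rfl⟩
      change (W F n p).ι x • ofTensor (p := p) (M := M) h2 w ∈ _
      induction w using tf_induction with
      | h0 => rw [map_zero, smul_zero]; exact Submodule.zero_mem _
      | ht f m => exact ι_smul_mem_range h2 f x m
      | ha y z hy hz => rw [map_add, smul_add]; exact Submodule.add_mem _ hy hz)
  intro x
  change x ∈ LinearMap.range (ofTensor (p := p) (M := M) h2)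
  induction x using inducedMk_induction with
  | h0 => exact Submodule.zero_mem _
  | hm a m =>
    have := hst a (kacMk F n p 1 m) ⟨tf 1 m, by rw [ofTensor_tf, map_one]⟩
    change a • kacMk F n p 1 m ∈ _ at this
    rwa [smul_inducedMk, mul_one] at this
  | ha y z hy hz => exact Submodule.add_mem _ hy hz

variable [IsScalarTower F (RestrictedLieSub.Env (W0 F n p)) M]

variable (h2 : (2 : F) ≠ 0) (hann : ∀ x : (W0 F n p).carrier,
      (x : Module.End F (Lam F n)) ∈ wittFil F n 1 → ∀ m : M, (W0 F n p).ι x • m = 0)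

/-- The graph of `m ↦ ξ_1⋯ξ_n ⊗ m` is stable under `W(n)^0` by `tensorField_lamTop`, hence under its
enveloping algebra. -/
theorem tensorRep_envMap (b : RestrictedLieSub.Env (W0 F n p)) (m : M) :
    tensorRep h2 hann (RestrictedLieSub.envMap (W0_le_W F n p) b) (tf (lamTop F n) m) =
      tf (lamTop F n) (b • m) := by
  let R : RestrictedLieSub.Env (W0 F n p) →ₐ[F] Module.End F (TensorFields F n M × M) :=
    (LinearMap.prodMapAlgHom F _ _).comp (AlgHom.prod
      ((tensorRep h2 hann).comp (RestrictedLieSub.envMap (W0_le_W F n p))) (Algebra.lsmul F F M))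
  have h := RestrictedLieSub.env_stable (W0 F n p) R
    (LinearMap.range ((tmulₗ F n M (lamTop F n)).prod LinearMap.id)) (by
      rintro x _ ⟨m, rfl⟩
      refine ⟨act F n p M x m, Prod.ext ?_ rfl⟩
      change _ = tensorRep h2 hann (RestrictedLieSub.envMap (W0_le_W F n p) _) _
      rw [RestrictedLieSub.envMap_ι, tensorRep_ι]
      exact (tensorField_lamTop hann x m).symm) b (tf (lamTop F n) m, m) ⟨m, rfl⟩
  obtain ⟨m', hm'⟩ := h
  have a1 := congrArg Prod.fst hm'
  have a2 : m' = b • m := congrArg Prod.snd hm'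
  rw [a2] at a1
  exact a1.symm

/-- The map from the induced module to tensor fields. -/
noncomputable def toTensor : KacModule F n p M →ₗ[F] TensorFields F n M :=
  inducedLift _ (tensorRep h2 hann) (tmulₗ F n M (lamTop F n)) (tensorRep_envMap h2 hann)

theorem toTensor_smul (a : RestrictedLieSub.Env (W F n p)) (x : KacModule F n p M) :
    toTensor h2 hann (a • x) = tensorRep h2 hann a (toTensor h2 hann x) :=
  inducedLift_smul _ _ _ _ a x

theorem tensorRep_D (i : Fin n) (g : Lam F n) (m : M) :
    tensorRep h2 hann ((W F n p).ι ⟨D F i, D_mem_witt i⟩) (tf g m) = tf (D F i g) m := by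
  rw [tensorRep_ι]; exact tensorField_D _ i g m

theorem toTensor_ofTensor (w : TensorFields F n M) :
    toTensor h2 hann (ofTensor h2 w) = mapTens F n M hodge.toLinearMap 1 w := by
  have key : ∀ (g : Lam F n) (m : M),
      tensorRep (p := p) h2 hann (dEnv h2 g) (tf (lamTop F n) m) = tf (hodge g) m := by
    intro g m
    induction g using lam_induction with
    | hr r =>
      rw [AlgHom.commutes, AlgHom.commutes, Module.algebraMap_end_apply,
        Algebra.algebraMap_eq_smul_one, map_smul, smul_tf, hodge_one]
    | ha x y hx hy => rw [map_add, map_add, LinearMap.add_apply, hx, hy, map_add, add_tf]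
    | hm i x hx =>
      rw [map_mul, map_mul, Module.End.mul_apply, hx, dEnv_xi, tensorRep_D, hodge_xi_mul]
  induction w using tf_induction with
  | h0 => simp
  | ht f m => exact key f m
  | ha x y hx hy => rw [map_add, map_add, hx, hy, map_add]

/-- `toTensor ∘ ofTensor` is `hodge ⊗ 1`, a bijection, and `ofTensor` is onto; so both maps are
bijective. -/
theorem toTensor_bijective : Function.Bijective (toTensor (p := p) h2 hann) := by
  have hl : ∀ w : TensorFields F n M,
      mapTens F n M hodge.symm.toLinearMap 1 (mapTens F n M hodge.toLinearMap 1 w) = w :=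
    fun w => LinearMap.congr_fun (g := LinearMap.id)
      (f := mapTens F n M hodge.symm.toLinearMap 1 * mapTens F n M hodge.toLinearMap 1)
      (tf_ext fun f m => by simp) w
  have hr : ∀ w : TensorFields F n M,
      mapTens F n M hodge.toLinearMap 1 (mapTens F n M hodge.symm.toLinearMap 1 w) = w :=
    fun w => LinearMap.congr_fun (g := LinearMap.id)
      (f := mapTens F n M hodge.toLinearMap 1 * mapTens F n M hodge.symm.toLinearMap 1)
      (tf_ext fun f m => by simp) w
  refine ⟨(injective_iff_map_eq_zero _).2 fun x hx => ?_, fun w => ?_⟩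
  · obtain ⟨w, rfl⟩ := ofTensor_surjective h2 x
    rw [toTensor_ofTensor] at hx
    rw [← hl w, hx, map_zero, map_zero]
  · exact ⟨ofTensor h2 (mapTens F n M hodge.symm.toLinearMap 1 w), by
      rw [toTensor_ofTensor, hr]⟩

end WittSuper

/-! ### Constant tensor fields and the typical case. -/

namespace WittSuper

variable {F : Type*} [Field F] {n : ℕ}

theorem lamTop_mul (g : Lam F n) : lamTop F n * g = eps g • lamTop F n := by
  induction g using lam_induction with
  | hr r => rw [eps_algebraMap, ← Algebra.commutes, Algebra.smul_def]
  | ha x y hx hy => rw [mul_add, hx, hy, map_add, add_smul]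
  | hm j x hx =>
    rw [← mul_assoc, mul_xi_eq, lamInv_lamTop, mul_smul_comm, xi_mul_lamTop, map_mul, eps_xi]
    simp

section

variable {M : Type*} [AddCommGroup M] [Module F M]

theorem opTens_D_mulTens (i : Fin n) (f : Lam F n) (w : TensorFields F n M) :
    opTens F n M (D F i) (mulTens F n M f 1 w) =
      mulTens F n M (D F i f) 1 w + mulTens F n M (lamInv f) 1 (opTens F n M (D F i) w) := by
  induction w using tf_induction with
  | h0 => simp
  | ht g m => rw [mulTens_tf, opTens_tf, D_mul, add_tf]; rfl
  | ha x y hx hy => simp only [map_add, hx, hy]; abel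

/-- If `D_a w = 0`, then `D_a` undoes multiplication by `ξ_a`, one factor at a time. Over all
generators this shows that `w` depends only on `ξ_1⋯ξ_n w`, which sees only the constant term. -/
theorem eq_opTens_mulTens {w : TensorFields F n M} (hw : ∀ i, opTens F n M (D F i) w = 0)
    {l : List (Fin n)} (hl : l.Nodup) :
    opTens F n M (dOp (xiProd l.reverse)) (mulTens F n M (xiProd l) 1 w) = w := by
  induction l with
  | nil =>
    have e1 : (xiProd [] : Lam F n) = 1 := rfl
    rw [List.reverse_nil, e1, map_one]
    exact LinearMap.congr_fun (g := LinearMap.id)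
      (f := opTens F n M 1 * mulTens F n M 1 1) (tf_ext fun f m => by simp) w
  | cons a l ih =>
    rw [List.nodup_cons] at hl
    have e1 : (xiProd (a :: l) : Lam F n) = xi F a * xiProd l := by simp [xiProd]
    have e2 : (xiProd (a :: l).reverse : Lam F n) = xiProd l.reverse * xi F a := by simp [xiProd]
    have e3 : opTens F n M (D F a) (mulTens F n M (xi F a * xiProd l) 1 w) =
        mulTens F n M (xiProd l) 1 w := by
      rw [opTens_D_mulTens, hw, map_zero, add_zero, D_xi_mul, if_pos rfl, D_xiProd hl.1, mul_zero,
        sub_zero]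
    rw [e1, e2, map_mul dOp, dOp_xi, opTens_mul, Module.End.mul_apply, e3, ih hl.2]

/-- Tensor fields killed by all `D_i` are constant. -/
theorem exists_eq_one_tf {w : TensorFields F n M} (hw : ∀ i, opTens F n M (D F i) w = 0) :
    ∃ m : M, w = tf 1 m := by
  have h1 : ∀ w : TensorFields F n M, ∃ m : M,
      opTens F n M (dOp (xiProd (List.finRange n).reverse))
        (mulTens F n M (lamTop F n) 1 w) = tf 1 m := by
    intro w
    induction w using tf_induction with
    | h0 => exact ⟨0, by simp⟩
    | ht g m =>
      refine ⟨eps g • m, ?_⟩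
      rw [mulTens_tf, lamTop_mul, smul_tf, map_smul, opTens_tf, tf_smul]
      have h := hodgeOp_reverse_xiProd (F := F) (List.nodup_finRange n)
      rw [hodgeOp_apply] at h
      rw [lamTop, h]; rfl
    | ha x y hx hy =>
      obtain ⟨a, ha⟩ := hx
      obtain ⟨b, hb⟩ := hy
      exact ⟨a + b, by rw [map_add, map_add, ha, hb, tf_add]⟩
  obtain ⟨m, hm⟩ := h1 w
  exact ⟨m, by rw [← hm, lamTop, eq_opTens_mulTens hw (List.nodup_finRange n)]⟩

/-- The `D_i` anticommute and square to zero: replace `w` by `D_a w` whenever the latter is nonzero,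
for each `a` in turn. -/
theorem exists_D_eq_zero {Q : Submodule F (TensorFields F n M)}
    (hQ : ∀ i, ∀ w ∈ Q, opTens F n M (D F i) w ∈ Q) (h0 : Q ≠ ⊥) :
    ∃ w ∈ Q, w ≠ 0 ∧ ∀ i, opTens F n M (D F i) w = 0 := by
  have hDD : ∀ i j, ∀ w : TensorFields F n M,
      opTens F n M (D F i) (opTens F n M (D F j) w) =
        -opTens F n M (D F j) (opTens F n M (D F i) w) := by
    intro i j w
    induction w using tf_induction with
    | h0 => simp
    | ht g m => rw [opTens_tf, opTens_tf, opTens_tf, opTens_tf, D_D, neg_tf]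
    | ha x y hx hy => simp only [map_add, hx, hy, neg_add]
  have hDself : ∀ i, ∀ w : TensorFields F n M,
      opTens F n M (D F i) (opTens F n M (D F i) w) = 0 := by
    intro i w
    induction w using tf_induction with
    | h0 => simp
    | ht g m => rw [opTens_tf, opTens_tf, D_D_self, zero_tf]
    | ha x y hx hy => simp only [map_add, hx, hy, add_zero]
  have key : ∀ s : Finset (Fin n), ∃ w ∈ Q, w ≠ 0 ∧ ∀ i ∈ s, opTens F n M (D F i) w = 0 := by
    intro s
    induction s using Finset.induction_on with
    | empty =>
      obtain ⟨w, hw, hw0⟩ := Q.ne_bot_iff.1 h0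
      exact ⟨w, hw, hw0, by simp⟩
    | insert a s _ ih =>
      obtain ⟨w, hw, hw0, hs⟩ := ih
      by_cases ha : opTens F n M (D F a) w = 0
      · exact ⟨w, hw, hw0, by simpa using ⟨ha, hs⟩⟩
      · refine ⟨_, hQ a w hw, ha, fun i hi => ?_⟩
        rcases Finset.mem_insert.1 hi with rfl | hi
        · exact hDself _ _
        · rw [hDD, hs i hi, map_zero, neg_zero]
  obtain ⟨w, hw, hw0, h⟩ := key Finset.univ
  exact ⟨w, hw, hw0, fun i => h i (Finset.mem_univ i)⟩

theorem tensorField_fD_tf (E : Fin n → Fin n → Module.End F M) (f g : Lam F n) (i : Fin n) (m : M) :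
    tensorField E (fD F f i) (tf g m) =
      tf (f * D F i g) m + ∑ j, tf (tD j f * g) (E j i m) := by
  rw [tensorField_tf, Finset.sum_eq_single i]
  · simp [jac_fD, fD_apply]
  · intro q _ hq; simp [jac_fD, Ne.symm hq]
  · simp

theorem tensorField_linear_one (E : Fin n → Fin n → Module.End F M) (i j : Fin n) (m : M) :
    tensorField E (fD F (xi F i) j) (tf 1 m) = tf 1 (E i j m) := by
  rw [tensorField_fD_tf, D_one, mul_zero, zero_tf, zero_add, Finset.sum_eq_single i]
  · simp [tD_xi]
  · intro q _ hq; simp [tD_xi, hq]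
  · simp

/-- These quadratic fields raise the degree in `Λ(n)` and carry the whole typical case. -/
theorem tensorField_quadratic (E : Fin n → Fin n → Module.End F M) (a b : Fin n)
    (g : Lam F n) (m : M) :
    tensorField E (fD F (xi F a * xi F b) b) (tf g m) =
      tf (xi F a * (xi F b * D F b g)) m + tf (xi F a * g) (E b b m) -
        tf (xi F b * g) (E a b m) := by
  have h : ∀ j, tD j (xi F a * xi F b) =
      (if j = b then xi F a else 0) - if j = a then xi F b else 0 := by
    intro j
    rw [tD_apply, D_xi_mul, D_xi]
    split_ifs <;> simp [lamInv_xi, neg_add_eq_sub]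
  have h2 : ∀ j, tf (tD j (xi F a * xi F b) * g) (E j b m) =
      (if j = b then tf (xi F a * g) (E j b m) else 0) -
        if j = a then tf (xi F b * g) (E j b m) else 0 := by
    intro j
    rw [h, sub_mul, sub_tf]
    split_ifs <;> simp
  rw [tensorField_fD_tf]
  simp only [h2, Finset.sum_sub_distrib, Finset.sum_ite_eq', Finset.mem_univ, if_true, mul_assoc]
  abel

end

variable {p : ℕ} [Fact p.Prime] [CharP F p]
  {M : Type*} [AddCommGroup M] [Module F M] [Module (RestrictedLieSub.Env (W0 F n p)) M]
  [IsScalarTower F (RestrictedLieSub.Env (W0 F n p)) M]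

theorem smul_mem_of_elem (hann : ∀ x : (W0 F n p).carrier,
      (x : Module.End F (Lam F n)) ∈ wittFil F n 1 → ∀ m : M, (W0 F n p).ι x • m = 0)
    {Q : Submodule F M} (hQ : ∀ i j, ∀ m ∈ Q, elem F n p M i j m ∈ Q)
    (u : RestrictedLieSub.Env (W0 F n p)) {m : M} (hm : m ∈ Q) : u • m ∈ Q := by
  refine RestrictedLieSub.env_stable (W0 F n p) (Algebra.lsmul F F M) Q (fun x m hm => ?_) u m hm
  change act F n p M x m ∈ Q
  rw [act_eq_sum hann]
  simp only [LinearMap.sum_apply, LinearMap.smul_apply]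
  exact Q.sum_mem fun i _ => Q.sum_mem fun j _ => Q.smul_mem _ (hQ j i m hm)

/-- A simple module killed by `W(n)^1` with a maximal vector has one parity only and is simple as
an ungraded module. -/
theorem elem_simple {𝓜 : ZMod 2 → Submodule F M} (hM : (W0 F n p).IsSupermodule 𝓜)
    (hsimple : IsSimpleSupermodule (RestrictedLieSub.Env (W0 F n p)) 𝓜)
    (hann : ∀ x : (W0 F n p).carrier,
      (x : Module.End F (Lam F n)) ∈ wittFil F n 1 → ∀ m : M, (W0 F n p).ι x • m = 0)
    {wt : Fin n → F} {v : M} (hv : IsMaximalVector (p := p) 𝓜 wt v) :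
    (∃ k, 𝓜 k = ⊤) ∧ ∀ Q : Submodule F M, (∀ i j, ∀ m ∈ Q, elem F n p M i j m ∈ Q) →
      Q = ⊥ ∨ Q = ⊤ := by
  have key : ∀ Q : Submodule F M, (∀ i j, ∀ m ∈ Q, elem F n p M i j m ∈ Q) →
      (∃ k, Q ≤ 𝓜 k) → Q = ⊥ ∨ Q = ⊤ := by
    rintro Q hQ ⟨k, hk⟩
    let N : Submodule (RestrictedLieSub.Env (W0 F n p)) M :=
      { Q with smul_mem' := fun u m hm => smul_mem_of_elem hann hQ u hm }
    have hN := hsimple.2 N fun x hx => by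
      have hk2 := zmod_two k
      rcases hk2 with rfl | rfl
      · exact ⟨x, hx, 0, N.zero_mem, hk hx, Submodule.zero_mem _, (add_zero x).symm⟩
      · exact ⟨0, N.zero_mem, x, hx, Submodule.zero_mem _, hk hx, (zero_add x).symm⟩
    rcases hN with h | h
    · left
      refine (Submodule.eq_bot_iff _).2 fun x hx => ?_
      have : x ∈ N := hx
      rw [h] at this
      exact this
    · right
      refine Submodule.eq_top_iff'.2 fun x => ?_
      have : x ∈ N := by rw [h]; trivial
      exact this
  -- The linear fields are even, so each parity component is stable; the one containing `v` is
  -- nonzero, hence everything.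
  have h𝓜 : ∃ k, 𝓜 k = ⊤ := by
    obtain ⟨k, hk⟩ : ∃ k, v ∈ 𝓜 k := hv.homogeneous.elim (fun h => ⟨0, h⟩) fun h => ⟨1, h⟩
    refine ⟨k, (key (𝓜 k) (fun i j m hm => ?_) ⟨k, le_rfl⟩).resolve_left fun h => ?_⟩
    · have := hM.smul_mem 0 k (xiD F p i j) m (xiD_even i j) hm
      rwa [zero_add] at this
    · rw [h] at hk
      exact hv.ne_zero hk
  obtain ⟨k, hk⟩ := h𝓜
  exact ⟨⟨k, hk⟩, fun Q hQ => key Q hQ ⟨k, by rw [hk]; exact le_top⟩⟩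

theorem elemShift_self (i : Fin n) (m : M) :
    elemShift F n p M i i m = elem F n p M i i m - m := by simp [elemShift]

theorem elemShift_of_ne {i j : Fin n} (h : i ≠ j) :
    elemShift F n p M i j = elem F n p M i j := by simp [elemShift, h]

theorem mem_of_lamTop_mem {Q : Submodule F (TensorFields F n M)}
    (hD : ∀ i, ∀ w ∈ Q, opTens F n M (D F i) w ∈ Q) (hQ : ∀ m : M, tf (lamTop F n) m ∈ Q) :
    Q = ⊤ := by
  have key : ∀ (g : Lam F n) (m : M), tf (hodge g) m ∈ Q := by
    intro g m
    induction g using lam_induction with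
    | hr r =>
      rw [Algebra.algebraMap_eq_smul_one, map_smul, smul_tf, hodge_one]
      exact Q.smul_mem _ (hQ m)
    | ha x y hx hy => rw [map_add, add_tf]; exact Q.add_mem hx hy
    | hm i x hx => rw [hodge_xi_mul]; exact hD i _ hx
  refine Submodule.eq_top_iff'.2 fun w => ?_
  induction w using tf_induction with
  | h0 => exact Q.zero_mem
  | ht f m =>
    obtain ⟨g, rfl⟩ := (hodge (F := F) (n := n)).surjective f
    exact key g m
  | ha x y hx hy => exact Q.add_mem hx hy

theorem eq_top_of_typical (hann : ∀ x : (W0 F n p).carrier,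
      (x : Module.End F (Lam F n)) ∈ wittFil F n 1 → ∀ m : M, (W0 F n p).ι x • m = 0)
    (hs : ∀ Q : Submodule F M, (∀ i j, ∀ m ∈ Q, elem F n p M i j m ∈ Q) → Q = ⊥ ∨ Q = ⊤)
    {v : M} {wt : Fin n → F} (hv0 : v ≠ 0)
    (hraise : ∀ i j : Fin n, i < j → elem F n p M i j v = 0)
    (hwt : ∀ i, elem F n p M i i v = wt i • v)
    (htyp : n = 0 ∨ ∃ i j, i < j ∧ wt i ≠ 0 ∧ wt j ≠ 1)
    {Q : Submodule F (TensorFields F n M)}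
    (hQ : ∀ T ∈ wittSpace F n, ∀ w ∈ Q, tensorField (elemShift F n p M) T w ∈ Q) (h0 : Q ≠ ⊥) :
    Q = ⊤ := by
  have hD : ∀ i, ∀ w ∈ Q, opTens F n M (D F i) w ∈ Q := by
    intro i w hw
    have e : tensorField (elemShift F n p M) (D F i) = opTens F n M (D F i) :=
      tf_ext fun g m => tensorField_D _ i g m
    rw [← e]
    exact hQ _ (D_mem_witt i) w hw
  have hone : ∀ m : M, tf 1 m ∈ Q := by
    obtain ⟨w, hw, hw0, hwD⟩ := exists_D_eq_zero hD h0
    obtain ⟨m, rfl⟩ := exists_eq_one_tf hwD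
    have h := (hs (Q.comap (tmulₗ F n M 1)) fun i j m hm => ?_).resolve_left fun h => ?_
    · intro m
      have : m ∈ Q.comap (tmulₗ F n M 1) := by rw [h]; trivial
      exact this
    · have h1 := hQ _ (fD_mem (xi F i) j) _ hm
      change tensorField _ _ (tf 1 m) ∈ Q at h1
      rw [tensorField_linear_one] at h1
      by_cases hij : i = j
      · subst hij
        rw [elemShift_self, tf_sub] at h1
        have := Q.add_mem h1 hm
        change _ - _ + tf 1 m ∈ Q at this
        rwa [sub_add_cancel] at this
      · rwa [elemShift_of_ne hij] at h1
    · have : m ∈ Q.comap (tmulₗ F n M 1) := hw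
      rw [h, Submodule.mem_bot] at this
      exact hw0 (by rw [this, tf_zero])
  have htop : tf (lamTop F n) v ∈ Q := by
    rcases htyp with rfl | ⟨i, j, hij, hi, hj⟩
    · exact hone v
    -- `ξ_i ξ_j D_j` takes `1 ⊗ v` to `(λ_j - 1) ξ_i ⊗ v`, as `E i j` raises and kills `v`.
    · have s1 : tf (xi F i) v ∈ Q := by
        have h1 := hQ _ (fD_mem (xi F i * xi F j) j) _ (hone v)
        rw [tensorField_quadratic, D_one, elemShift_of_ne hij.ne, hraise i j hij,
          elemShift_self, hwt] at h1
        simp only [mul_zero, zero_tf, tf_zero, mul_one, zero_add, sub_zero] at h1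
        rw [← one_smul F v, smul_smul, ← sub_smul, mul_one, tf_smul] at h1
        exact (Q.smul_mem_iff (sub_ne_zero.2 hj)).1 h1
      have s2 : ∀ f : Lam F n, tf (f * xi F i) v ∈ Q := by
        intro f
        induction f using lam_induction with
        | hr r => rw [← Algebra.smul_def, smul_tf]; exact Q.smul_mem _ s1
        | ha x y hx hy => rw [add_mul, add_tf]; exact Q.add_mem hx hy
        | hm a x hx =>
          have hz : xi F i * (x * xi F i) = 0 := by
            rw [mul_xi_eq, ← mul_assoc, xi_mul_xi_self, zero_mul]
          rw [mul_assoc]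
          by_cases ha : a = i
          · rw [ha, hz, zero_tf]; exact Q.zero_mem
          -- On a multiple of `ξ_i` the operator `ξ_i D_i` is the identity; its contribution `1` and
          -- the twisted weight `λ_i - 1` add up to `λ_i`.
          · have h1 := hQ _ (fD_mem (xi F a * xi F i) i) _ hx
            have h2 := D_xi_mul i i (x * xi F i)
            rw [hz, map_zero, if_pos rfl, eq_comm, sub_eq_zero] at h2
            rw [tensorField_quadratic, ← h2, hz, zero_tf, sub_zero, elemShift_self, hwt,
              tf_sub, add_sub_cancel, tf_smul] at h1
            exact (Q.smul_mem_iff hi).1 h1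
      obtain ⟨f, hf⟩ := lamTop_eq_mul_xi (F := F) i
      rw [hf]
      exact s2 f
  refine mem_of_lamTop_mem hD fun m => ?_
  have h := (hs (Q.comap (tmulₗ F n M (lamTop F n))) fun i j m hm => ?_).resolve_left fun h => ?_
  · have : m ∈ Q.comap (tmulₗ F n M (lamTop F n)) := by rw [h]; trivial
    exact this
  · have h1 := hQ _ (wittFil_le 0 (xiD F p i j).2) _ hm
    change tensorField _ _ (tf _ m) ∈ Q at h1
    rw [tensorField_lamTop hann] at h1
    exact h1
  · have : v ∈ Q.comap (tmulₗ F n M (lamTop F n)) := htop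
    rw [h] at this
    exact hv0 this

end WittSuper

/-! ### Highest weight modules of `gl_n` when weights are only known modulo `p`. -/

namespace WittSuper

variable {F : Type*} [Field F] {n : ℕ}

section

variable {M : Type*} [AddCommGroup M] [Module F M] (E : Fin n → Fin n → Module.End F M)

/-- The sum of the images of the lowering operators. -/
def lowRange : Submodule F M := ⨆ (i : Fin n) (j : Fin n) (_ : j < i), LinearMap.range (E i j)

theorem mem_lowRange {i j : Fin n} (h : j < i) (m : M) : E i j m ∈ lowRange E :=
  Submodule.mem_iSup_of_mem i (Submodule.mem_iSup_of_mem j (Submodule.mem_iSup_of_mem h ⟨m, rfl⟩))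

/-- The smallest subspace containing `v` and stable under the lowering operators. -/
def lowSpan (v : M) : Submodule F M :=
  sInf {Q | v ∈ Q ∧ ∀ i j, j < i → ∀ w ∈ Q, E i j w ∈ Q}

theorem mem_lowSpan (v : M) : v ∈ lowSpan E v := Submodule.mem_sInf.2 fun _ hQ => hQ.1

theorem lowSpan_le {v : M} {Q : Submodule F M} (hv : v ∈ Q)
    (h : ∀ i j, j < i → ∀ w ∈ Q, E i j w ∈ Q) : lowSpan E v ≤ Q := sInf_le ⟨hv, h⟩

theorem lowSpan_lower {v : M} {i j : Fin n} (h : j < i) {w : M} (hw : w ∈ lowSpan E v) :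
    E i j w ∈ lowSpan E v :=
  Submodule.mem_sInf.2 fun Q hQ => hQ.2 i j h w (Submodule.mem_sInf.1 hw Q hQ)

variable {E}

/-- The vectors that all `E a b` send into `lowSpan E v` include `v` and are stable under lowering,
by the commutation relations; minimality of `lowSpan` does the rest. -/
theorem lowSpan_stable (hE : IsGlRep E) {v : M} {μ : Fin n → F}
    (hraise : ∀ i j, i < j → E i j v = 0) (hμ : ∀ i, E i i v = μ i • v) (a b : Fin n) {w : M}
    (hw : w ∈ lowSpan E v) : E a b w ∈ lowSpan E v := by
  let Q : Submodule F M := lowSpan E v ⊓ ⨅ a, ⨅ b, (lowSpan E v).comap (E a b)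
  have hQ : ∀ w, w ∈ Q ↔ w ∈ lowSpan E v ∧ ∀ a b, E a b w ∈ lowSpan E v := by
    intro w; simp [Q, Submodule.mem_iInf]
  have h : lowSpan E v ≤ Q := by
    refine lowSpan_le E ((hQ v).2 ⟨mem_lowSpan E v, fun a b => ?_⟩) fun i j hij w hw => ?_
    · rcases lt_trichotomy a b with h | rfl | h
      · rw [hraise a b h]; exact Submodule.zero_mem _
      · rw [hμ]; exact Submodule.smul_mem _ _ (mem_lowSpan E v)
      · exact lowSpan_lower E h (mem_lowSpan E v)
    · obtain ⟨h1, h2⟩ := (hQ w).1 hw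
      refine (hQ _).2 ⟨lowSpan_lower E hij h1, fun a b => ?_⟩
      have h3 := LinearMap.congr_fun (hE a b i j) w
      rw [LinearMap.sub_apply, LinearMap.sub_apply, Module.End.mul_apply, Module.End.mul_apply,
        sub_eq_iff_eq_add] at h3
      rw [h3]
      refine Submodule.add_mem _ (Submodule.sub_mem _ ?_ ?_) (lowSpan_lower E hij (h2 a b))
      · split_ifs
        · exact h2 _ _
        · exact Submodule.zero_mem _
      · split_ifs
        · exact h2 _ _
        · exact Submodule.zero_mem _
  exact ((hQ w).1 (h hw)).2 a b

theorem exists_sub_mem_lowRange {v w : M} (hw : w ∈ lowSpan E v) :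
    ∃ c : F, w - c • v ∈ lowRange E := by
  have h : lowSpan E v ≤ Submodule.span F {v} ⊔ lowRange E :=
    lowSpan_le E (Submodule.mem_sup_left (Submodule.mem_span_singleton_self v))
      fun i j hij w _ => Submodule.mem_sup_right (mem_lowRange E hij w)
  obtain ⟨y, hy, z, hz, rfl⟩ := Submodule.mem_sup.1 (h hw)
  obtain ⟨c, rfl⟩ := Submodule.mem_span_singleton.1 hy
  exact ⟨c, by simpa using hz⟩

/-- A Nakayama argument: iterating `M = xM + S` gives `M = x^k M + S`. -/
theorem eq_top_of_range_sup_eq_top {x : Module.End F M} {S : Submodule F M}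
    (h : LinearMap.range x ⊔ S = ⊤) (hS : ∀ m ∈ S, x m ∈ S) {k : ℕ} (hx : x ^ k = 0) : S = ⊤ := by
  have key : ∀ k : ℕ, ∀ m : M, ∃ m' : M, m - (x ^ k) m' ∈ S := by
    intro k
    induction k with
    | zero => exact fun m => ⟨m, by simp⟩
    | succ k ih =>
      intro m
      obtain ⟨m', hm'⟩ := ih m
      have h1 : m' ∈ LinearMap.range x ⊔ S := by rw [h]; trivial
      obtain ⟨_, ⟨a, rfl⟩, b, hb, hab⟩ := Submodule.mem_sup.1 h1
      refine ⟨a, ?_⟩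
      have h2 : ∀ k : ℕ, (x ^ k) b ∈ S := by
        intro k
        induction k with
        | zero => simpa using hb
        | succ k ih => rw [pow_succ', Module.End.mul_apply]; exact hS _ ih
      have h3 : m - (x ^ (k + 1)) a = (m - (x ^ k) m') + (x ^ k) b := by
        rw [← hab, map_add, pow_succ, Module.End.mul_apply]; abel
      rw [h3]
      exact S.add_mem hm' (h2 k)
  refine Submodule.eq_top_iff'.2 fun m => ?_
  obtain ⟨m', hm'⟩ := key k m
  rwa [hx, LinearMap.zero_apply, sub_zero] at hm'

/-- Since `M` may be infinite-dimensional and weights modulo `p` are not ordered, nilpotency is used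
instead. If the lowering operators together had full image, they could be discarded one by one with
`eq_top_of_range_sup_eq_top`, row by row, until no operator is left. -/
theorem lowRange_ne_top [Nontrivial M] (hE : IsGlRep E) {k : ℕ}
    (hk : ∀ i j, i ≠ j → E i j ^ k = 0) : lowRange E ≠ ⊤ := by
  let R : ℕ → Submodule F M := fun r =>
    ⨆ (i : Fin n) (j : Fin n) (_ : r ≤ i ∧ j < i), LinearMap.range (E i j)
  have hmem : ∀ (r : ℕ) {i j : Fin n}, r ≤ i → j < i → ∀ m, E i j m ∈ R r := fun r i j h1 h2 m =>
    Submodule.mem_iSup_of_mem i (Submodule.mem_iSup_of_mem j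
      (Submodule.mem_iSup_of_mem ⟨h1, h2⟩ ⟨m, rfl⟩))
  have hle : ∀ (r : ℕ) (S : Submodule F M), (∀ i j : Fin n, r ≤ i → j < i → ∀ m, E i j m ∈ S) →
      R r ≤ S := by
    intro r S h
    refine iSup_le fun i => iSup_le fun j => iSup_le fun hij => ?_
    rintro _ ⟨m, rfl⟩
    exact h i j hij.1 hij.2 m
  have hcomm : ∀ i j a b (m : M), E i j (E a b m) = E a b (E i j m) +
      ((if j = a then E i b else 0) - (if i = b then E a j else 0) : Module.End F M) m := by
    intro i j a b m
    have h3 := LinearMap.congr_fun (hE i j a b) m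
    rw [LinearMap.sub_apply, Module.End.mul_apply, Module.End.mul_apply, sub_eq_iff_eq_add'] at h3
    exact h3
  have step : ∀ r : Fin n, R r = ⊤ → R (r + 1) = ⊤ := by
    intro r hr
    -- Lowering operators in row `r` commute with each other, and their commutators with those in
    -- lower rows stay in lower rows, so the remaining sum of images is stable under the discarded
    -- operator.
    have key : ∀ J : Finset (Fin n), (∀ j ∈ J, j < r) →
        (⨆ j ∈ J, LinearMap.range (E r j)) ⊔ R (r + 1) = ⊤ → R (r + 1) = ⊤ := by
      intro J
      induction J using Finset.induction_on with
      | empty => simp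
      | insert a J _ ih =>
        intro hJ h
        have ha : a < r := hJ a (Finset.mem_insert_self a J)
        refine ih (fun j hj => hJ j (Finset.mem_insert_of_mem hj)) ?_
        rw [Finset.iSup_insert, sup_assoc] at h
        refine eq_top_of_range_sup_eq_top h (fun m hm => ?_) (hk r a ha.ne')
        have hsub : (⨆ j ∈ J, LinearMap.range (E r j)) ⊔ R (r + 1) ≤
            ((⨆ j ∈ J, LinearMap.range (E r j)) ⊔ R (r + 1)).comap (E r a) := by
          refine sup_le (iSup_le fun j => iSup_le fun hj => ?_) (hle _ _ fun i j hi hj m => ?_)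
          · rintro _ ⟨m, rfl⟩
            have hjr : j < r := hJ j (Finset.mem_insert_of_mem hj)
            rw [Submodule.mem_comap, hcomm, if_neg ha.ne, if_neg hjr.ne', sub_zero, LinearMap.zero_apply, add_zero]
            exact Submodule.mem_sup_left (Submodule.mem_iSup_of_mem j
              (Submodule.mem_iSup_of_mem hj ⟨_, rfl⟩))
          · have hri : r < i := Fin.lt_def.2 hi
            rw [Submodule.mem_comap, hcomm, if_neg (ha.trans hri).ne, zero_sub]
            refine Submodule.mem_sup_right (Submodule.add_mem _ (hmem _ hi hj _) ?_)
            split_ifs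
            · exact Submodule.neg_mem _ (hmem _ hi (ha.trans hri) _)
            · simp
        exact hsub hm
    refine key (Finset.univ.filter (· < r)) (by simp) (eq_top_iff.2 (hr ▸ hle _ _ ?_))
    intro i j hi hj m
    rcases eq_or_lt_of_le hi with h | h
    · obtain rfl : r = i := Fin.ext h
      exact Submodule.mem_sup_left (Submodule.mem_iSup_of_mem j
        (Submodule.mem_iSup_of_mem (by simpa using hj) ⟨m, rfl⟩))
    · exact Submodule.mem_sup_right (hmem _ h hj m)
  intro h
  have hall : ∀ r : ℕ, r ≤ n → R r = ⊤ := by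
    intro r
    induction r with
    | zero =>
      intro _
      refine eq_top_iff.2 (h ▸ ?_)
      refine iSup_le fun i => iSup_le fun j => iSup_le fun hij => ?_
      rintro _ ⟨m, rfl⟩
      exact hmem 0 (Nat.zero_le _) hij m
    | succ r ih => exact fun hr => step ⟨r, hr⟩ (ih (Nat.le_of_succ_le hr))
  have hbot : R n ≤ ⊥ := hle _ _ fun i j hi _ _ => absurd i.2 (not_lt.2 hi)
  rw [hall n le_rfl] at hbot
  exact top_ne_bot (le_bot_iff.1 hbot)

/-- By simplicity `v` generates `M` under lowering, so `M` is `F v` plus the images of the lowering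
operators. Were `v` in these images, they would fill `M`. -/
theorem notMem_lowRange [Nontrivial M] (hE : IsGlRep E) {k : ℕ}
    (hk : ∀ i j, i ≠ j → E i j ^ k = 0)
    (hs : ∀ Q : Submodule F M, (∀ i j, ∀ m ∈ Q, E i j m ∈ Q) → Q = ⊥ ∨ Q = ⊤)
    {v : M} {μ : Fin n → F} (hv : v ≠ 0)
    (hraise : ∀ i j, i < j → E i j v = 0) (hμ : ∀ i, E i i v = μ i • v) : v ∉ lowRange E := by
  intro hmem
  have h := (hs (lowSpan E v) fun i j m hm => lowSpan_stable hE hraise hμ i j hm).resolve_left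
    fun h => hv ((Submodule.mem_bot F).1 (h ▸ mem_lowSpan E v))
  refine lowRange_ne_top hE hk (Submodule.eq_top_iff'.2 fun w => ?_)
  have hw : w ∈ lowSpan E v := by rw [h]; trivial
  obtain ⟨c, hc⟩ := exists_sub_mem_lowRange hw
  have := Submodule.add_mem _ hc (Submodule.smul_mem _ c hmem)
  rwa [sub_add_cancel] at this

end

/-- A simple highest weight module embeds into any module with a maximal vector of the same weight
which lies in every nonzero submodule and is not in the image of the lowering operators. -/
theorem exists_intertwiner {M T : Type*} [AddCommGroup M] [Module F M] [AddCommGroup T] [Module F T]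
    {E : Fin n → Fin n → Module.End F M} {E' : Fin n → Fin n → Module.End F T} (hE : IsGlRep E)
    (hE' : IsGlRep E') {v : M} {v' : T} {μ : Fin n → F} (hv : v ≠ 0)
    (hraise : ∀ i j, i < j → E i j v = 0) (hμ : ∀ i, E i i v = μ i • v)
    (hraise' : ∀ i j, i < j → E' i j v' = 0) (hμ' : ∀ i, E' i i v' = μ i • v')
    (hs : ∀ Q : Submodule F M, (∀ i j, ∀ m ∈ Q, E i j m ∈ Q) → Q = ⊥ ∨ Q = ⊤)
    (hlow : v ∉ lowRange E) (hlow' : v' ∉ lowRange E') {G : Submodule F T} (hG : v' ∈ G)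
    (hGs : ∀ i j, ∀ t ∈ G, E' i j t ∈ G)
    (hs' : ∀ Q : Submodule F T, Q ≤ G → (∀ i j, ∀ t ∈ Q, E' i j t ∈ Q) → Q ≠ ⊥ → v' ∈ Q) :
    ∃ θ : M →ₗ[F] T, θ v = v' ∧ ∀ i j m, θ (E i j m) = E' i j (θ m) := by
  let P : Fin n → Fin n → Module.End F (M × T) := fun i j => (E i j).prodMap (E' i j)
  have hP : IsGlRep P := by
    intro i j k l
    refine LinearMap.ext fun w => Prod.ext ?_ ?_
    · have := LinearMap.congr_fun (hE i j k l) w.1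
      refine Eq.trans this ?_
      split_ifs <;> simp [P]
    · have := LinearMap.congr_fun (hE' i j k l) w.2
      refine Eq.trans this ?_
      split_ifs <;> simp [P]
  -- `N`, generated by `(v, v')`, will be the graph of the intertwiner: it projects onto `M`, and it
  -- remains to see that it contains no `(0, t)` with `t ≠ 0`.
  set N := lowSpan P (v, v') with hN
  have hNs : ∀ i j, ∀ w ∈ N, P i j w ∈ N := fun i j w hw =>
    lowSpan_stable hP (v := (v, v')) (μ := μ)
      (fun i j h => Prod.ext (hraise i j h) (hraise' i j h))
      (fun i => Prod.ext (hμ i) (hμ' i)) i j hw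
  have hvN : (v, v') ∈ N := mem_lowSpan P _
  have hNG : N ≤ G.comap (LinearMap.snd F M T) := lowSpan_le P hG fun i j _ w hw => hGs i j _ hw
  have hsurj : Function.Surjective ((LinearMap.fst F M T).domRestrict N) := by
    have h := (hs (N.map (LinearMap.fst F M T)) ?_).resolve_left fun h => ?_
    · intro m
      have hm : m ∈ N.map (LinearMap.fst F M T) := by rw [h]; trivial
      obtain ⟨w, hw, rfl⟩ := hm
      exact ⟨⟨w, hw⟩, rfl⟩
    · rintro i j _ ⟨w, hw, rfl⟩
      exact ⟨_, hNs i j w hw, rfl⟩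
    · have : v ∈ N.map (LinearMap.fst F M T) := ⟨_, hvN, rfl⟩
      rw [h] at this
      exact hv this
  have hinj : Function.Injective ((LinearMap.fst F M T).domRestrict N) := by
    rw [injective_iff_map_eq_zero]
    rintro ⟨⟨m, t⟩, hw⟩ (h0 : m = 0)
    subst h0
    by_contra hne
    have ht : t ≠ 0 := by
      rintro rfl
      exact hne rfl
    -- Otherwise `(0, v') ∈ N`. Modulo images of lowering operators this is `c • (v, v')`, which
    -- forces `v` (if `c ≠ 0`) or `v'` (if `c = 0`) into such an image.
    have h1 := hs' (N.comap (LinearMap.inr F M T)) (fun y hy => hNG hy) (fun i j y hy => ?_) ?_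
    · obtain ⟨c, hc⟩ := exists_sub_mem_lowRange (E := P) (v := (v, v')) (w := (0, v')) h1
      have hl : lowRange P ≤ (lowRange E).prod (lowRange E') := by
        refine iSup_le fun i => iSup_le fun j => iSup_le fun hij => ?_
        rintro _ ⟨w, rfl⟩
        exact ⟨mem_lowRange E hij _, mem_lowRange E' hij _⟩
      obtain ⟨h2, h3⟩ := hl hc
      have h2' : (0 : M) - c • v ∈ lowRange E := h2
      have h3' : v' - c • v' ∈ lowRange E' := h3
      rw [zero_sub, Submodule.neg_mem_iff] at h2'
      by_cases hc0 : c = 0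
      · rw [hc0, zero_smul, sub_zero] at h3'
        exact hlow' h3'
      · exact hlow ((Submodule.smul_mem_iff _ hc0).1 h2')
    · have := hNs i j _ hy
      have e : P i j (LinearMap.inr F M T y) = LinearMap.inr F M T (E' i j y) := by
        simp [P]
      rw [e] at this
      exact this
    · intro h
      have : t ∈ N.comap (LinearMap.inr F M T) := hw
      rw [h] at this
      exact ht this
  let e := LinearEquiv.ofBijective _ ⟨hinj, hsurj⟩
  have he : ∀ w (hw : w ∈ N), e.symm w.1 = ⟨w, hw⟩ := fun w hw =>
    (LinearEquiv.symm_apply_eq _).2 rfl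
  refine ⟨LinearMap.snd F M T ∘ₗ N.subtype ∘ₗ e.symm.toLinearMap, ?_, fun i j m => ?_⟩
  · change ((e.symm (v, v').1 : N) : M × T).2 = v'
    rw [he _ hvN]
  · change ((e.symm (E i j m) : N) : M × T).2 = E' i j ((e.symm m : N) : M × T).2
    obtain ⟨⟨w, hw⟩, rfl⟩ := hsurj m
    change ((e.symm (E i j w.1) : N) : M × T).2 = E' i j ((e.symm w.1 : N) : M × T).2
    have h1 := he _ (hNs i j w hw)
    change e.symm (E i j w.1) = _ at h1
    rw [h1, he _ hw]
    rfl

end WittSuper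

/-! ### The truncated divided power algebra as a `gl_n`-module. -/

namespace WittSuper

variable (F : Type*) [Field F] (n p : ℕ)

/-- The truncated divided power algebra on `n` variables: the function `f` stands for
`∑ f(α) y^{(α)}`. -/
abbrev DivPow : Type _ := (Fin n → ZMod p) → F

section

variable {F n p}

/-- The total degree of an exponent. -/
def expDeg (α : Fin n → ZMod p) : ℕ := ∑ i, (α i).val

variable (F) in
/-- The homogeneous elements of degree `k`. -/
def divDeg (k : ℕ) : Submodule F (DivPow F n p) where
  carrier := {f | ∀ α, f α ≠ 0 → expDeg α = k}
  add_mem' := fun {f g} hf hg α h => by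
    by_cases h1 : f α = 0
    · exact hg α fun h2 => h (by simp [h1, h2])
    · exact hf α h1
  zero_mem' := fun α h => absurd rfl h
  smul_mem' := fun c f hf α h => hf α fun h1 => h (by simp [h1])

theorem single_mem_divDeg (μ : Fin n → ZMod p) : Pi.single μ 1 ∈ divDeg F (expDeg μ) := by
  intro α h
  by_cases hα : α = μ
  · rw [hα]
  · exact absurd (Pi.single_eq_of_ne hα _) h

end

section

variable {n p} [Fact p.Prime]

theorem val_add_one {a : ZMod p} (h : a + 1 ≠ 0) : (a + 1).val = a.val + 1 := by
  rw [ZMod.val_add, ZMod.val_one, Nat.mod_eq_of_lt]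
  have h1 := ZMod.val_lt a
  refine lt_of_le_of_ne h1 fun h2 => h ?_
  have h3 : ((a.val + 1 : ℕ) : ZMod p) = 0 := by rw [h2, ZMod.natCast_self]
  simpa using h3

/-- The degree is a natural number, so the two conditions are needed to prevent exponents from
wrapping around modulo `p`. -/
theorem expDeg_move {α : Fin n → ZMod p} {i j : Fin n} (hij : i ≠ j) (hj : α j ≠ 0)
    (hi : α i + 1 ≠ 0) : expDeg (α - Pi.single j 1 + Pi.single i 1) = expDeg α := by
  have hj' : (α j).val = (α j - 1).val + 1 := by
    rw [← val_add_one (by simpa using hj), sub_add_cancel]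
  have hsum : ∀ β : Fin n → ZMod p, expDeg β =
      (β i).val + ((β j).val + ∑ k ∈ (Finset.univ.erase i).erase j, (β k).val) := by
    intro β
    rw [expDeg, ← Finset.add_sum_erase _ _ (Finset.mem_univ i),
      ← Finset.add_sum_erase _ _ (Finset.mem_erase.2 ⟨hij.symm, Finset.mem_univ j⟩)]
  rw [hsum, hsum]
  have h1 : ((α - Pi.single j 1 + Pi.single i 1 : Fin n → ZMod p) i).val = (α i).val + 1 := by
    simp only [Pi.add_apply, Pi.sub_apply, Pi.single_eq_same, Pi.single_eq_of_ne hij, sub_zero]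
    exact val_add_one hi
  have h2 : (α - Pi.single j 1 + Pi.single i 1 : Fin n → ZMod p) j = α j - 1 := by
    simp [hij.symm]
  rw [h1, h2, hj', Finset.sum_congr rfl (g := fun k => (α k).val)]
  · ring
  · intro k hk
    simp only [Finset.mem_erase] at hk
    simp [hk.1, hk.2.1]

end

section

variable {n}

/-- The derivation `∂ / ∂ y_j`. -/
noncomputable def derVar (j : Fin n) : Module.End F (DivPow F n p) where
  -- Exponents live in `ZMod p`; the test removes the wrap-around from exponent `p - 1` to `0`.
  toFun f α := if α j + 1 = 0 then 0 else f (α + Pi.single j 1)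
  map_add' _ _ := funext fun α => by
    by_cases h : α j + 1 = 0 <;> simp [h]
  map_smul' _ _ := funext fun α => by
    by_cases h : α j + 1 = 0 <;> simp [h]

variable {F p}

theorem derVar_apply (j : Fin n) (f : DivPow F n p) (α : Fin n → ZMod p) :
    derVar F p j f α = if α j + 1 = 0 then 0 else f (α + Pi.single j 1) := rfl

theorem derVar_comm (i j : Fin n) : derVar F p i * derVar F p j = derVar F p j * derVar F p i := by
  by_cases h : i = j
  · rw [h]
  refine LinearMap.ext fun f => funext fun α => ?_
  simp only [Module.End.mul_apply, derVar_apply, Pi.add_apply, Pi.single_eq_of_ne (Ne.symm h),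
    Pi.single_eq_of_ne h, add_zero]
  rw [add_right_comm]
  split_ifs <;> rfl

theorem derVar_single (j : Fin n) (μ : Fin n → ZMod p) :
    derVar F p j (Pi.single μ 1) = if μ j = 0 then 0 else Pi.single (μ - Pi.single j 1) 1 := by
  refine funext fun α => ?_
  rw [derVar_apply, Pi.single_apply]
  by_cases h : α + Pi.single j 1 = μ
  · subst h
    by_cases h0 : α j + 1 = 0 <;> simp [h0]
  · have h' : α ≠ μ - Pi.single j 1 := fun h' => h (by rw [h', sub_add_cancel])
    by_cases h0 : μ j = 0 <;> simp [h0, h, h']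

end

variable [CharP F p]

/-- The inclusion of the prime field. -/
noncomputable abbrev primeCast : ZMod p →+* F := ZMod.castHom (dvd_refl p) F

variable {n} [Fact p.Prime]

/-- Multiplication by the variable `y_i`. -/
noncomputable def mulVar (i : Fin n) : Module.End F (DivPow F n p) where
  -- From `y_i y^{(β)} = (β_i + 1) y^{(β + e_i)}`. The factor vanishes at `α i = 0`, so wrap-around
  -- needs no separate test.
  toFun f α := primeCast F p (α i) * f (α - Pi.single i 1)
  map_add' _ _ := funext fun _ => mul_add _ _ _
  map_smul' _ _ := funext fun _ => mul_left_comm _ _ _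

/-- The action of elementary matrices on the divided power algebra. -/
noncomputable def divElem (i j : Fin n) : Module.End F (DivPow F n p) :=
  mulVar F p i * derVar F p j

variable {F p}

theorem mulVar_apply (i : Fin n) (f : DivPow F n p) (α : Fin n → ZMod p) :
    mulVar F p i f α = primeCast F p (α i) * f (α - Pi.single i 1) := rfl

theorem divElem_apply (i j : Fin n) (f : DivPow F n p) (α : Fin n → ZMod p) :
    divElem F p i j f α = primeCast F p (α i) *
      if (α - Pi.single i 1 : Fin n → ZMod p) j + 1 = 0 then 0 else f (α - Pi.single i 1 + Pi.single j 1) := rfl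

theorem mulVar_comm (i j : Fin n) : mulVar F p i * mulVar F p j = mulVar F p j * mulVar F p i := by
  by_cases h : i = j
  · rw [h]
  refine LinearMap.ext fun f => funext fun α => ?_
  simp only [Module.End.mul_apply, mulVar_apply, Pi.sub_apply, Pi.single_eq_of_ne (Ne.symm h),
    Pi.single_eq_of_ne h, sub_zero]
  rw [sub_right_comm]
  ring

theorem derVar_mulVar (i j : Fin n) :
    derVar F p i * mulVar F p j = mulVar F p j * derVar F p i + if i = j then 1 else 0 := by
  refine LinearMap.ext fun f => funext fun α => ?_
  by_cases h : i = j
  · subst h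
    simp only [Module.End.mul_apply, mulVar_apply, derVar_apply, Pi.sub_apply, Pi.add_apply,
      Pi.single_eq_same, if_true, LinearMap.add_apply, Module.End.one_apply, add_sub_cancel_right,
      sub_add_cancel]
    by_cases h1 : α i + 1 = 0 <;> by_cases h2 : α i = 0
    · simp [h2] at h1
    · rw [eq_neg_of_add_eq_zero_left h1]; simp
    · simp [h2]
    · simp [h1, h2, add_mul]
  · simp only [Module.End.mul_apply, mulVar_apply, derVar_apply, Pi.sub_apply, Pi.add_apply,
      Pi.single_eq_of_ne (Ne.symm h), Pi.single_eq_of_ne h, if_neg h, add_zero, sub_zero]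
    rw [add_sub_right_comm]
    split_ifs <;> simp

theorem isGlRep_divElem : IsGlRep (divElem F p (n := n)) := by
  intro i j k l
  have e : ∀ i j k l : Fin n, divElem F p i j * divElem F p k l =
      mulVar F p i * mulVar F p k * derVar F p j * derVar F p l +
        if j = k then divElem F p i l else 0 := by
    intro i j k l
    have h : divElem F p i j * divElem F p k l =
        mulVar F p i * (derVar F p j * mulVar F p k) * derVar F p l := by
      simp only [divElem, mul_assoc]
    rw [h, derVar_mulVar]
    split_ifs
    · simp only [mul_add, add_mul, mul_assoc, one_mul]; rfl
    · simp only [mul_add, add_mul, mul_assoc, zero_mul, mul_zero]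
  rw [e, e, mulVar_comm k i, mul_assoc _ (derVar F p l), derVar_comm l j, ← mul_assoc]
  simp only [eq_comm (a := l)]
  abel

theorem divElem_self (i : Fin n) (f : DivPow F n p) (α : Fin n → ZMod p) :
    divElem F p i i f α = primeCast F p (α i) * f α := by
  rw [divElem_apply]
  by_cases h : α i = 0
  · simp [h]
  · simp [h]

theorem primeCast_eq_zero {a : ZMod p} : primeCast F p a = 0 ↔ a = 0 :=
  map_eq_zero _

theorem mulVar_single (i : Fin n) (μ : Fin n → ZMod p) :
    mulVar F p i (Pi.single μ 1) =
      primeCast F p (μ i + 1) • Pi.single (μ + Pi.single i 1) 1 := by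
  refine funext fun α => ?_
  rw [mulVar_apply, Pi.smul_apply, smul_eq_mul, Pi.single_apply, Pi.single_apply]
  by_cases h : α = μ + Pi.single i 1
  · subst h; simp
  · have h' : α - Pi.single i 1 ≠ μ := fun h' => h (by rw [← h', sub_add_cancel])
    rw [if_neg h, if_neg h', mul_zero, mul_zero]

theorem divElem_single (i j : Fin n) (μ : Fin n → ZMod p) :
    divElem F p i j (Pi.single μ 1) = if μ j = 0 then 0 else
      primeCast F p ((μ - Pi.single j 1 : Fin n → ZMod p) i + 1) •
        Pi.single (μ - Pi.single j 1 + Pi.single i 1) 1 := by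
  rw [divElem, Module.End.mul_apply, derVar_single]
  split_ifs
  · rw [map_zero]
  · rw [mulVar_single]

theorem divElem_single_eq_zero {i j : Fin n} (hij : i ≠ j) {μ : Fin n → ZMod p}
    (h : μ i = -1 ∨ μ j = 0) : divElem F p i j (Pi.single μ 1) = 0 := by
  rw [divElem_single]
  rcases h with h | h
  · simp [h, hij]
  · rw [if_pos h]

theorem divElem_apply_eq_zero {i j : Fin n} (hij : i ≠ j) {μ : Fin n → ZMod p}
    (h : μ i = 0 ∨ μ j = -1) (f : DivPow F n p) : divElem F p i j f μ = 0 := by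
  rw [divElem_apply]
  rcases h with h | h
  · simp [h]
  · simp [h, hij.symm]

/-- The coefficient at `μ` vanishes on every image `E i j f` with `j < i`: reaching `y^{(μ)}` would
require `μ_i ≠ 0` and an exponent `μ_j + 1 < p`. -/
theorem single_notMem_lowRange {μ : Fin n → ZMod p} (hμ : ∀ i j, i < j → μ i = -1 ∨ μ j = 0) :
    Pi.single μ 1 ∉ lowRange (divElem F p (n := n)) := by
  have h : lowRange (divElem F p (n := n)) ≤
      LinearMap.ker (LinearMap.proj μ : DivPow F n p →ₗ[F] F) := by
    refine iSup_le fun i => iSup_le fun j => iSup_le fun hij => ?_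
    rintro _ ⟨f, rfl⟩
    exact divElem_apply_eq_zero hij.ne' (hμ j i hij).symm f
  intro hmem
  have := h hmem
  simp at this

theorem divElem_mem_divDeg {k : ℕ} (i j : Fin n) {f : DivPow F n p} (hf : f ∈ divDeg F k) :
    divElem F p i j f ∈ divDeg F k := by
  intro α h
  by_cases hij : i = j
  · subst hij
    rw [divElem_self] at h
    exact hf α (right_ne_zero_of_mul h)
  · rw [divElem_apply] at h
    have h1 : α i ≠ 0 := fun h0 => left_ne_zero_of_mul h (by rw [h0, map_zero])
    have h2 := right_ne_zero_of_mul h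
    have h3 : α j + 1 ≠ 0 := by
      intro h0
      apply h2
      rw [if_pos]
      simpa [Ne.symm hij] using h0
    rw [← expDeg_move (Ne.symm hij) h1 h3]
    exact hf _ fun h0 => h2 (by rw [h0, ite_self])

/-- Stable subspaces contain the monomials of their elements. -/
theorem single_mem_of_stable {Q : Submodule F (DivPow F n p)}
    (hQ : ∀ i, ∀ f ∈ Q, divElem F p i i f ∈ Q) {f : DivPow F n p} (hf : f ∈ Q)
    {β : Fin n → ZMod p} (hβ : f β ≠ 0) : Pi.single β 1 ∈ Q := by
  have key : ∀ s : Finset (Fin n), ∃ g ∈ Q, g β ≠ 0 ∧ ∀ α, g α ≠ 0 → ∀ i ∈ s, α i = β i := by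
    intro s
    induction s using Finset.induction_on with
    | empty => exact ⟨f, hf, hβ, by simp⟩
    | insert a s _ ih =>
      obtain ⟨g, hg, hgβ, hgs⟩ := ih
      -- By Fermat, `1 - x ^ (p - 1)` is the projection onto the eigenspace where the `a`-th
      -- exponent is `β a`. Doing this for all `a` isolates a single monomial.
      let x : Module.End F (DivPow F n p) := divElem F p a a - primeCast F p (β a) • 1
      have hx : ∀ (r : ℕ) (α : Fin n → ZMod p), (x ^ r) g α = primeCast F p ((α a - β a) ^ r) * g α := by
        intro r
        induction r with
        | zero => intro α; simp
        | succ r ih =>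
          intro α
          rw [pow_succ', Module.End.mul_apply]
          change divElem F p a a ((x ^ r) g) α - primeCast F p (β a) * (x ^ r) g α = _
          rw [divElem_self, ih, map_pow, map_pow, map_sub]
          ring
      have hxQ : ∀ r : ℕ, (x ^ r) g ∈ Q := by
        intro r
        induction r with
        | zero => exact hg
        | succ r ih =>
          rw [pow_succ', Module.End.mul_apply]
          exact Q.sub_mem (hQ a _ ih) (Q.smul_mem _ ih)
      have hp1 : p - 1 ≠ 0 := by have := (Fact.out : p.Prime).two_le; omega
      refine ⟨g - (x ^ (p - 1)) g, Q.sub_mem hg (hxQ _), ?_, fun α hα i hi => ?_⟩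
      · rw [Pi.sub_apply, hx, sub_self, zero_pow hp1, map_zero, zero_mul, sub_zero]
        exact hgβ
      · rw [Pi.sub_apply, hx] at hα
        have hgα : g α ≠ 0 := fun h0 => hα (by rw [h0, mul_zero, sub_zero])
        rcases Finset.mem_insert.1 hi with rfl | hi
        · by_contra hne
          rw [ZMod.pow_card_sub_one_eq_one (sub_ne_zero.2 hne), map_one, one_mul, sub_self] at hα
          exact hα rfl
        · exact hgs α hgα i hi
  obtain ⟨g, hg, hgβ, h⟩ := key Finset.univ
  have e : g = g β • Pi.single β 1 := by
    refine funext fun α => ?_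
    by_cases hα : α = β
    · subst hα; simp
    · rw [Pi.smul_apply, Pi.single_eq_of_ne hα, smul_zero]
      by_contra hne
      exact hα (funext fun i => h α hne i (Finset.mem_univ i))
  rw [e] at hg
  exact (Q.smul_mem_iff hgβ).1 hg

/-- Monomials of the same degree generate the same stable subspace. -/
theorem single_mem_of_single_mem {Q : Submodule F (DivPow F n p)}
    (hQ : ∀ i j, ∀ f ∈ Q, divElem F p i j f ∈ Q) {μ : Fin n → ZMod p} :
    ∀ (d : ℕ) (α : Fin n → ZMod p), ∑ i, ((α i).val - (μ i).val) = d → expDeg α = expDeg μ →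
      Pi.single α 1 ∈ Q → Pi.single μ 1 ∈ Q := by
  intro d
  induction d using Nat.strong_induction_on with
  | _ d ih =>
    intro α hd hdeg hα
    by_cases hle : ∀ i, (α i).val ≤ (μ i).val
    · have : α = μ := by
        have h := (Finset.sum_eq_sum_iff_of_le fun i _ => hle i).1 hdeg
        exact funext fun i => ZMod.val_injective p (h i (Finset.mem_univ i))
      rwa [← this]
    · push Not at hle
      obtain ⟨j, hj⟩ := hle
      -- The degrees agree, so an excess at `j` is matched by a deficit at some `i`. Then `E i j`
      -- moves one unit from `j` to `i`; its coefficient `α_i + 1` is nonzero because `α_i < μ_i <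
      -- p`, and the total excess `d` drops.
      obtain ⟨i, hi⟩ : ∃ i, (α i).val < (μ i).val := by
        by_contra hcon
        push Not at hcon
        exact absurd hdeg (Finset.sum_lt_sum (fun i _ => hcon i) ⟨j, Finset.mem_univ j, hj⟩).ne'
      have hij : i ≠ j := by rintro rfl; exact lt_asymm hi hj
      have hj0 : α j ≠ 0 := by intro h; rw [h, ZMod.val_zero] at hj; exact Nat.not_lt_zero _ hj
      have hi0 : α i + 1 ≠ 0 := by
        intro h
        have h1 : ((α i).val + 1 : ℕ) < p := lt_of_le_of_lt hi (ZMod.val_lt _)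
        have h2 : (((α i).val + 1 : ℕ) : ZMod p) = 0 := by simpa using h
        have h3 := (ZMod.natCast_eq_zero_iff _ _).1 h2
        exact absurd (Nat.le_of_dvd (Nat.succ_pos _) h3) (not_le.2 h1)
      have h1 := hQ i j _ hα
      rw [divElem_single, if_neg hj0] at h1
      have h2 : (α - Pi.single j 1 : Fin n → ZMod p) i = α i := by simp [hij]
      rw [h2] at h1
      have h3 := (Q.smul_mem_iff (mt primeCast_eq_zero.1 hi0)).1 h1
      refine ih _ ?_ _ rfl ((expDeg_move hij hj0 hi0).trans hdeg) h3
      rw [← hd]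
      have hj' : (α j).val = (α j - 1).val + 1 := by
        rw [← val_add_one (by simpa using hj0), sub_add_cancel]
      refine Finset.sum_lt_sum (fun k _ => ?_) ⟨j, Finset.mem_univ j, ?_⟩
      · by_cases hki : k = i
        · subst hki
          simp only [Pi.add_apply, Pi.sub_apply, Pi.single_eq_same, Pi.single_eq_of_ne hij,
            sub_zero]
          rw [val_add_one hi0]
          omega
        · by_cases hkj : k = j
          · subst hkj
            simp only [Pi.add_apply, Pi.sub_apply, Pi.single_eq_same, Pi.single_eq_of_ne hki,
              add_zero]
            omega
          · simp [hki, hkj]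
      · simp only [Pi.add_apply, Pi.sub_apply, Pi.single_eq_same, Pi.single_eq_of_ne hij.symm,
          add_zero]
        omega

theorem single_mem_of_ne_bot {Q : Submodule F (DivPow F n p)} {μ : Fin n → ZMod p}
    (hQG : Q ≤ divDeg F (expDeg μ)) (hQ : ∀ i j, ∀ f ∈ Q, divElem F p i j f ∈ Q) (h0 : Q ≠ ⊥) :
    Pi.single μ 1 ∈ Q := by
  obtain ⟨f, hf, hf0⟩ := Q.ne_bot_iff.1 h0
  obtain ⟨β, hβ⟩ := Function.ne_iff.1 hf0
  exact single_mem_of_single_mem hQ _ β rfl (hQG hf β hβ)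
    (single_mem_of_stable (fun i => hQ i i) hf hβ)

end WittSuper

/-! ### The de Rham differential, atypical weights, and transfer of simplicity to the induced
module. -/

namespace WittSuper

variable {F : Type*} [Field F] {n : ℕ} {p : ℕ} [Fact p.Prime] [CharP F p]

section

variable {M : Type*} [AddCommGroup M] [Module F M]

/-- The map `g ⊗ m ↦ φ(g) • m` attached to a functional `φ` on `Λ(n)`. -/
noncomputable def evalTens (φ : Lam F n →ₗ[F] F) : TensorFields F n M →ₗ[F] M :=
  tfLift ((LinearMap.lsmul F M).comp φ)

theorem evalTens_tf (φ : Lam F n →ₗ[F] F) (f : Lam F n) (m : M) :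
    evalTens φ (tf f m) = φ f • m := rfl

theorem one_tf_ne_zero {m : M} (hm : m ≠ 0) : tf (1 : Lam F n) m ≠ 0 := by
  intro h
  have h1 := congrArg (evalTens (F := F) (n := n) (M := M) eps.toLinearMap) h
  rw [evalTens_tf, map_zero] at h1
  simp only [AlgHom.toLinearMap_apply, map_one, one_smul] at h1
  exact hm h1

/-- The map of tensor fields induced by a linear map of the fibres. -/
noncomputable def fibreMap {T : Type*} [AddCommGroup T] [Module F T] (θ : M →ₗ[F] T) :
    TensorFields F n M →ₗ[F] TensorFields F n T :=
  tfLift ((tmulₗ F n T).compl₁₂ LinearMap.id θ)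

theorem fibreMap_tf {T : Type*} [AddCommGroup T] [Module F T] (θ : M →ₗ[F] T) (f : Lam F n)
    (m : M) : fibreMap θ (tf f m) = tf f (θ m) := rfl

theorem fibreMap_tensorField {T : Type*} [AddCommGroup T] [Module F T] {θ : M →ₗ[F] T}
    {E : Fin n → Fin n → Module.End F M} {E' : Fin n → Fin n → Module.End F T}
    (hθ : ∀ i j m, θ (E i j m) = E' i j (θ m)) (S : Module.End F (Lam F n))
    (w : TensorFields F n M) :
    fibreMap θ (tensorField E S w) = tensorField E' S (fibreMap θ w) := by
  induction w using tf_induction with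
  | h0 => simp
  | ht f m =>
    rw [fibreMap_tf, tensorField_tf, tensorField_tf, map_add, fibreMap_tf, map_sum]
    congr 1
    refine Finset.sum_congr rfl fun i _ => ?_
    rw [map_sum]
    exact Finset.sum_congr rfl fun j _ => by rw [fibreMap_tf, hθ]
  | ha x y hx hy => simp only [map_add, hx, hy]

theorem fibreMap_opTens {T : Type*} [AddCommGroup T] [Module F T] (θ : M →ₗ[F] T)
    (S : Module.End F (Lam F n)) (w : TensorFields F n M) :
    fibreMap θ (opTens F n M S w) = opTens F n T S (fibreMap θ w) := by
  induction w using tf_induction with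
  | h0 => simp
  | ht f m => rfl
  | ha x y hx hy => simp only [map_add, hx, hy]

end

variable (F n p) in
/-- The de Rham differential `∑ D_a ⊗ y_a`. -/
noncomputable def deRham : Module.End F (TensorFields F n (DivPow F n p)) :=
  ∑ a, mapTens F n (DivPow F n p) (D F a) (mulVar F p a)

theorem deRham_tf (f : Lam F n) (t : DivPow F n p) :
    deRham F n p (tf f t) = ∑ a, tf (D F a f) (mulVar F p a t) := by
  rw [deRham, LinearMap.sum_apply]; rfl

theorem deRham_lamInv (w : TensorFields F n (DivPow F n p)) :
    deRham F n p (opTens F n _ lamInv.toLinearMap w) =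
      -opTens F n _ lamInv.toLinearMap (deRham F n p w) := by
  induction w using tf_induction with
  | h0 => simp
  | ht f t =>
    rw [opTens_tf, deRham_tf, deRham_tf, map_sum, ← Finset.sum_neg_distrib]
    refine Finset.sum_congr rfl fun a _ => ?_
    rw [opTens_tf, AlgHom.toLinearMap_apply, AlgHom.toLinearMap_apply, lamInv_D, neg_tf, neg_neg]
  | ha x y hx hy => simp only [map_add, hx, hy]; abel

/-- Invariance of the exterior derivative. The minus sign and `lamInv` are the sign rule for moving
the odd operator `d` past `f D_i`. The terms containing `[∂_i, y_a] = δ_{ia}` match those where `d`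
differentiates `f` once, and the second derivatives of `f` cancel. -/
theorem deRham_tensorField (h2 : (2 : F) ≠ 0) (f : Lam F n) (i : Fin n)
    (w : TensorFields F n (DivPow F n p)) :
    deRham F n p (tensorField (divElem F p) (fD F f i) w) =
      -tensorField (divElem F p) (fD F (lamInv f) i) (deRham F n p w) := by
  induction w using tf_induction with
  | h0 => simp
  | ht g t =>
    -- Second derivatives of `f` are antisymmetric in `a, j` while `y_a y_j` is symmetric, so the
    -- sum equals its negative.
    have hanti : ∑ j, ∑ a, tf (D F a (tD j f) * g) (mulVar F p a (mulVar F p j (derVar F p i t))) =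
        0 := by
      have e : ∑ j, ∑ a, tf (D F a (tD j f) * g)
          (mulVar F p a (mulVar F p j (derVar F p i t))) =
          -∑ j, ∑ a, tf (D F a (tD j f) * g)
            (mulVar F p a (mulVar F p j (derVar F p i t))) := by
        conv_lhs => rw [Finset.sum_comm]
        rw [← Finset.sum_neg_distrib]
        refine Finset.sum_congr rfl fun j _ => ?_
        rw [← Finset.sum_neg_distrib]
        refine Finset.sum_congr rfl fun a _ => ?_
        have e1 : D F j (tD a f) = -D F a (tD j f) := by
          rw [tD_apply, tD_apply, ← neg_eq_iff_eq_neg.2 (lamInv_D j (D F a f)),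
            ← neg_eq_iff_eq_neg.2 (lamInv_D a (D F j f)), D_D, map_neg]
        rw [e1, neg_mul, neg_tf]
        congr 2
        exact LinearMap.congr_fun (mulVar_comm (F := F) j a) _
      have e3 := add_eq_zero_iff_eq_neg.2 e
      rw [← two_smul F] at e3
      exact (smul_eq_zero.1 e3).resolve_left h2
    have e1 : deRham F n p (tensorField (divElem F p) (fD F f i) (tf g t)) =
        ∑ a, (tf (D F a f * D F i g) (mulVar F p a t) +
          tf (lamInv f * D F a (D F i g)) (mulVar F p a t)) +
        ∑ j, ∑ a, (tf (D F a (tD j f) * g) (mulVar F p a (mulVar F p j (derVar F p i t))) +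
          tf (D F j f * D F a g) (mulVar F p a (mulVar F p j (derVar F p i t)))) := by
      rw [tensorField_fD_tf, map_add, deRham_tf, map_sum]
      congr 1
      · refine Finset.sum_congr rfl fun a _ => ?_
        rw [D_mul, add_tf]
      · refine Finset.sum_congr rfl fun j _ => ?_
        rw [deRham_tf]
        refine Finset.sum_congr rfl fun a _ => ?_
        rw [D_mul, add_tf, tD_apply, lamInv_lamInv]
        rfl
    have e2 : tensorField (divElem F p) (fD F (lamInv f) i) (deRham F n p (tf g t)) =
        ∑ a, (tf (lamInv f * D F i (D F a g)) (mulVar F p a t) -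
          ∑ j, tf (D F j f * D F a g) (mulVar F p j (mulVar F p a (derVar F p i t)))) -
        ∑ j, tf (D F j f * D F i g) (mulVar F p j t) := by
      have e3 : ∀ j, tD j (lamInv f) = -D F j f := by
        intro j
        rw [tD_apply, ← neg_eq_iff_eq_neg.2 (lamInv_D j f), map_neg, lamInv_lamInv]
      have e4 : ∀ j a, divElem F p j i (mulVar F p a t) =
          mulVar F p j (mulVar F p a (derVar F p i t)) + if i = a then mulVar F p j t else 0 := by
        intro j a
        have := LinearMap.congr_fun (derVar_mulVar (F := F) i a) t
        rw [Module.End.mul_apply] at this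
        rw [divElem, Module.End.mul_apply, this, LinearMap.add_apply, map_add]
        split_ifs <;> simp
      have e5 : ∀ a j, tf (tD j (lamInv f) * D F a g) (divElem F p j i (mulVar F p a t)) =
          -tf (D F j f * D F a g) (mulVar F p j (mulVar F p a (derVar F p i t))) -
            if i = a then tf (D F j f * D F a g) (mulVar F p j t) else 0 := by
        intro a j
        rw [e3, e4, neg_mul, neg_tf, tf_add, neg_add, ← sub_eq_add_neg]
        split_ifs <;> simp
      rw [deRham_tf, map_sum]
      simp only [tensorField_fD_tf, e5, Finset.sum_add_distrib, Finset.sum_sub_distrib,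
        Finset.sum_neg_distrib]
      rw [Finset.sum_comm (f := fun a j => if i = a then tf (D F j f * D F a g) (mulVar F p j t)
        else 0)]
      simp only [Finset.sum_ite_eq, Finset.mem_univ, if_true]
      abel
    rw [e1, e2]
    simp only [Finset.sum_add_distrib, Finset.sum_sub_distrib, hanti, D_D _ i, mul_neg, neg_tf,
      Finset.sum_neg_distrib]
    rw [Finset.sum_comm (f := fun j a => tf (D F j f * D F a g)
      (mulVar F p a (mulVar F p j (derVar F p i t))))]
    have e6 : ∀ a j (t : DivPow F n p),
        mulVar F p a (mulVar F p j t) = mulVar F p j (mulVar F p a t) :=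
      fun a j t => LinearMap.congr_fun (mulVar_comm (F := F) a j) t
    have e7 : ∑ a, ∑ j, tf (D F j f * D F a g) (mulVar F p a (mulVar F p j (derVar F p i t))) =
        ∑ a, ∑ j, tf (D F j f * D F a g) (mulVar F p j (mulVar F p a (derVar F p i t))) :=
      Finset.sum_congr rfl fun a _ => Finset.sum_congr rfl fun j _ => by rw [e6]
    rw [e7]
    abel
  | ha x y hx hy => rw [map_add, map_add, hx, hy, map_add, map_add, neg_add]

variable {M : Type*} [AddCommGroup M] [Module F M] [Module (RestrictedLieSub.Env (W0 F n p)) M]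

theorem ofTensor_even_mem (h2 : (2 : F) ≠ 0) {𝓜 : ZMod 2 → Submodule F M} {k : ZMod 2}
    (hk : 𝓜 k = ⊤) (w : TensorFields F n M) :
    ofTensor (p := p) h2 (w + opTens F n M lamInv.toLinearMap w) ∈ kacParity F n p 𝓜 k ∧
    ofTensor (p := p) h2 (w - opTens F n M lamInv.toLinearMap w) ∈ kacParity F n p 𝓜 (1 + k) := by
  have hm : ∀ (l : ZMod 2) (f : Lam F n) (m : M), f ∈ lamParity F n l →
      ofTensor (p := p) h2 (tf f m) ∈ kacParity F n p 𝓜 (l + k) := fun l f m hf =>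
    Submodule.subset_span ⟨l, k, dEnv h2 f, m, rfl, dEnv_mem h2 hf, by rw [hk]; trivial, rfl⟩
  induction w using tf_induction with
  | h0 => simp
  | ht f m =>
    obtain ⟨a, ha, b, hb, rfl⟩ := exists_parity f
    have e0 : superSign 0 1 = 1 := by decide
    have e1 : superSign 1 1 = -1 := by decide
    have h1 : lamInv (a + b) = a - b := by
      rw [map_add, lamInv_of_mem ha, lamInv_of_mem hb, e0, e1, one_smul, neg_one_smul,
        sub_eq_add_neg]
    have h3 : a + b + (a - b) = a + a := by abel
    have h4 : a + b - (a - b) = b + b := by abel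
    have h5 : tf (a + b) m + opTens F n M lamInv.toLinearMap (tf (a + b) m) = tf (a + a) m := by
      rw [opTens_tf, AlgHom.toLinearMap_apply, h1, ← add_tf, h3]
    have h6 : tf (a + b) m - opTens F n M lamInv.toLinearMap (tf (a + b) m) = tf (b + b) m := by
      rw [opTens_tf, AlgHom.toLinearMap_apply, h1, ← sub_tf, h4]
    rw [h5, h6]
    have h7 := hm 0 (a + a) m (Submodule.add_mem _ ha ha)
    rw [zero_add] at h7
    exact ⟨h7, hm 1 (b + b) m (Submodule.add_mem _ hb hb)⟩
  | ha x y hx hy =>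
    have e1 : x + y + opTens F n M lamInv.toLinearMap (x + y) =
        (x + opTens F n M lamInv.toLinearMap x) + (y + opTens F n M lamInv.toLinearMap y) := by
      rw [map_add]; abel
    have e2 : x + y - opTens F n M lamInv.toLinearMap (x + y) =
        (x - opTens F n M lamInv.toLinearMap x) + (y - opTens F n M lamInv.toLinearMap y) := by
      rw [map_add]; abel
    constructor
    · rw [e1, (ofTensor h2).map_add]
      exact Submodule.add_mem _ hx.1 hy.1
    · rw [e2, (ofTensor h2).map_add]
      exact Submodule.add_mem _ hx.2 hy.2

variable [IsScalarTower F (RestrictedLieSub.Env (W0 F n p)) M]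

/-- `ξ_i D_i` is idempotent on `Λ(n)`, hence fixed by the `p`-mapping, and its eigenvalues satisfy
`c ^ p = c`. -/
theorem IsMaximalVector.exists_weight {𝓜 : ZMod 2 → Submodule F M} {wt : Fin n → F} {v : M}
    (hv : IsMaximalVector (p := p) 𝓜 wt v) (i : Fin n) : ∃ a : ZMod p, wt i = primeCast F p a := by
  have h1 : ∀ r : ℕ, (elem F n p M i i ^ r) v = wt i ^ r • v := by
    intro r
    induction r with
    | zero => simp
    | succ r ih =>
      have : elem F n p M i i v = wt i • v := hv.weight i
      rw [pow_succ', Module.End.mul_apply, ih, map_smul, this, smul_smul, pow_succ]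
  have h2 := h1 p
  rw [elem_pow_self] at h2
  have h3 : elem F n p M i i v = wt i • v := hv.weight i
  rw [h3] at h2
  have h4 : wt i ^ p = wt i := (smul_left_injective F hv.ne_zero h2).symm
  have h5 := (Subfield.mem_bot_iff_pow_eq_self (p := p) (F := F)).2 h4
  rw [← ZMod.fieldRange_castHom_eq_bot p] at h5
  obtain ⟨a, ha⟩ := h5
  exact ⟨a, ha.symm⟩

theorem mem_atypicalWeights_iff {a : Fin n → ZMod p} :
    (fun i => primeCast F p (a i)) ∈ atypicalWeights F n p ↔
      n ≠ 0 ∧ ∀ i j, i < j → a i = 0 ∨ a j = 1 := by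
  have hval : ∀ (i : Fin n) (b : ZMod p) (k : Fin n),
      (ZMod.castHom (dvd_refl p) F b • Pi.single i 1 + ∑ j ∈ Finset.Ioi i, Pi.single j 1 :
        Fin n → F) k = primeCast F p (if k < i then 0 else if i < k then 1 else b) := by
    intro i b k
    rw [Pi.add_apply, Finset.sum_apply, Pi.smul_apply]
    simp only [Pi.single_apply, Finset.sum_ite_eq, Finset.mem_Ioi]
    rcases lt_trichotomy k i with h | h | h
    · simp [h, h.ne, h.not_gt]
    · simp [h]
    · simp [h, h.ne', h.not_gt]
  constructor
  · rintro ⟨i, b, h⟩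
    refine ⟨fun h0 => ?_, fun k l hkl => ?_⟩
    · subst h0; exact i.elim0
    · have hk := congrFun h k
      have hl := congrFun h l
      rw [hval] at hk hl
      replace hk := (primeCast F p).injective hk
      replace hl := (primeCast F p).injective hl
      rcases lt_or_ge k i with hki | hki
      · left; rw [hk, if_pos hki]
      · right; rw [hl, if_neg (hki.trans hkl.le).not_gt, if_pos (hki.trans_lt hkl)]
  · rintro ⟨hn, h⟩
    -- `i` is the first index with `a i ≠ 0`, or the last index if `a = 0`.
    obtain ⟨i, hi1, hi2⟩ : ∃ i : Fin n, (∀ k < i, a k = 0) ∧ ∀ l, i < l → a l = 1 := by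
      by_cases hz : ∃ i, a i ≠ 0
      · have hne : (Finset.univ.filter fun i => a i ≠ 0).Nonempty := by
          obtain ⟨i, hi⟩ := hz
          exact ⟨i, by simpa using hi⟩
        have hm := Finset.min'_mem _ hne
        refine ⟨_, fun k hk => ?_, fun l hl => (h _ l hl).resolve_left (by simpa using hm)⟩
        by_contra hk0
        exact absurd (Finset.min'_le (Finset.univ.filter fun i => a i ≠ 0) k (by simpa using hk0))
          (not_le.2 hk)
      · push Not at hz
        refine ⟨⟨n - 1, by omega⟩, fun k _ => hz k, fun l hl => ?_⟩
        have h1 := l.2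
        have h2 : n - 1 < l.1 := hl
        omega
    refine ⟨i, a i, funext fun k => ?_⟩
    rw [hval]
    congr 1
    rcases lt_trichotomy k i with hk | hk | hk
    · rw [if_pos hk, hi1 k hk]
    · subst hk; simp
    · rw [if_neg hk.not_gt, if_pos hk, hi2 k hk]

theorem isSimple_kac [Nontrivial M] (h2 : (2 : F) ≠ 0) (hann : ∀ x : (W0 F n p).carrier,
      (x : Module.End F (Lam F n)) ∈ wittFil F n 1 → ∀ m : M, (W0 F n p).ι x • m = 0)
    (𝓜 : ZMod 2 → Submodule F M)
    (h : ∀ Q : Submodule F (TensorFields F n M),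
      (∀ T ∈ wittSpace F n, ∀ w ∈ Q, tensorField (elemShift F n p M) T w ∈ Q) → Q ≠ ⊥ → Q = ⊤) :
    IsSimpleSupermodule (RestrictedLieSub.Env (W F n p)) (kacParity F n p 𝓜) := by
  have hb := toTensor_bijective h2 hann
  refine ⟨?_, fun N _ => ?_⟩
  · obtain ⟨m, hm⟩ := exists_ne (0 : M)
    obtain ⟨x, hx⟩ := hb.2 (tf 1 m)
    refine ⟨x, 0, fun h0 => one_tf_ne_zero (F := F) (n := n) hm ?_⟩
    rw [← hx, h0, map_zero]
  · by_cases hN : N = ⊥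
    · exact Or.inl hN
    right
    let Q : Submodule F (TensorFields F n M) :=
      { carrier := {w | ∃ x ∈ N, toTensor h2 hann x = w}
        add_mem' := by
          rintro _ _ ⟨x, hx, rfl⟩ ⟨y, hy, rfl⟩
          exact ⟨x + y, N.add_mem hx hy, map_add _ _ _⟩
        zero_mem' := ⟨0, N.zero_mem, map_zero _⟩
        smul_mem' := by
          rintro c _ ⟨x, hx, rfl⟩
          refine ⟨algebraMap F (RestrictedLieSub.Env (W F n p)) c • x, N.smul_mem _ hx, ?_⟩
          rw [toTensor_smul, AlgHom.commutes]; rfl }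
    have hQ := h Q (by
      rintro T hT _ ⟨x, hx, rfl⟩
      refine ⟨(W F n p).ι ⟨T, hT⟩ • x, N.smul_mem _ hx, ?_⟩
      rw [toTensor_smul, tensorRep_ι]) (by
      obtain ⟨x, hx, hx0⟩ := N.ne_bot_iff.1 hN
      refine (Q.ne_bot_iff).2 ⟨_, ⟨x, hx, rfl⟩, fun h0 => hx0 (hb.1 ?_)⟩
      rw [h0, map_zero])
    refine Submodule.eq_top_iff'.2 fun x => ?_
    have hx : toTensor h2 hann x ∈ Q := by rw [hQ]; trivial
    obtain ⟨y, hy, hyx⟩ := hx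
    rwa [← hb.1 hyx]

/-- Stability under the grading involution makes the submodule graded: the components of an element
are half its sum and half its difference with its image. Since `M` has one parity `k`, the parity of
the induced module is that of `Λ(n)` shifted by `k`. -/
theorem not_isSimple_kac (h2 : (2 : F) ≠ 0) (hann : ∀ x : (W0 F n p).carrier,
      (x : Module.End F (Lam F n)) ∈ wittFil F n 1 → ∀ m : M, (W0 F n p).ι x • m = 0)
    {𝓜 : ZMod 2 → Submodule F M} {k : ZMod 2} (hk : 𝓜 k = ⊤)
    {Q : Submodule F (TensorFields F n M)}
    (hQ : ∀ T ∈ wittSpace F n, ∀ w ∈ Q, tensorField (elemShift F n p M) T w ∈ Q)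
    (hα : ∀ w ∈ Q, opTens F n M lamInv.toLinearMap w ∈ Q) (h0 : Q ≠ ⊥) (h1 : Q ≠ ⊤) :
    ¬IsSimpleSupermodule (RestrictedLieSub.Env (W F n p)) (kacParity F n p 𝓜) := by
  have hb := toTensor_bijective h2 hann
  rintro ⟨-, hsimple⟩
  let N : Submodule (RestrictedLieSub.Env (W F n p)) (KacModule F n p M) :=
    { carrier := {x | toTensor h2 hann x ∈ Q}
      add_mem' := fun {x y} hx hy => by
        change toTensor h2 hann (x + y) ∈ Q
        rw [map_add]; exact Q.add_mem hx hy
      zero_mem' := by change toTensor h2 hann 0 ∈ Q; rw [map_zero]; exact Q.zero_mem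
      smul_mem' := fun u x hx => by
        change toTensor h2 hann (u • x) ∈ Q
        rw [toTensor_smul]
        refine RestrictedLieSub.env_stable (W F n p) (tensorRep h2 hann) Q (fun y w hw => ?_) u _ hx
        rw [tensorRep_ι]
        exact hQ _ y.2 w hw }
  have hN : ∀ x, x ∈ N ↔ toTensor h2 hann x ∈ Q := fun x => Iff.rfl
  have hgr : ∀ x ∈ N, ∃ y ∈ N, ∃ z ∈ N, y ∈ kacParity F n p 𝓜 k ∧ z ∈ kacParity F n p 𝓜 (1 + k) ∧
      x = y + z := by
    intro x hx
    obtain ⟨w, rfl⟩ := ofTensor_surjective h2 x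
    have hx' := (hN _).1 hx
    have hαw : toTensor h2 hann (ofTensor h2 (opTens F n M lamInv.toLinearMap w)) ∈ Q := by
      rw [toTensor_ofTensor] at hx' ⊢
      have e : mapTens F n M hodge.toLinearMap 1 (opTens F n M lamInv.toLinearMap w) =
          (-1 : F) ^ n • opTens F n M lamInv.toLinearMap
            (mapTens F n M hodge.toLinearMap 1 w) := by
        clear hx hx'
        induction w using tf_induction with
        | h0 => simp
        | ht f m =>
          rw [opTens_tf, mapTens_tf, mapTens_tf, opTens_tf, ← smul_tf]
          congr 1
          have h3 := lamInv_hodge f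
          change hodge (lamInv f) = (-1 : F) ^ n • lamInv (hodge f)
          rw [h3, smul_smul, ← mul_pow]
          simp
        | ha x y hx hy => simp only [map_add, hx, hy, smul_add]
      rw [e]
      exact Q.smul_mem _ (hα _ hx')
    have hp := ofTensor_even_mem (p := p) h2 hk w
    refine ⟨(2 : F)⁻¹ • ofTensor h2 (w + opTens F n M lamInv.toLinearMap w), ?_,
      (2 : F)⁻¹ • ofTensor h2 (w - opTens F n M lamInv.toLinearMap w), ?_,
      Submodule.smul_mem _ _ hp.1, Submodule.smul_mem _ _ hp.2, ?_⟩
    · rw [hN, map_smul, map_add, map_add]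
      exact Q.smul_mem _ (Q.add_mem hx' hαw)
    · rw [hN, map_smul, map_sub, map_sub]
      exact Q.smul_mem _ (Q.sub_mem hx' hαw)
    · rw [← smul_add, ← map_add, add_add_sub_cancel, ← two_smul F w, map_smul, smul_smul,
        inv_mul_cancel₀ h2, one_smul]
  rcases hsimple N (fun x hx => by
    obtain ⟨y, hy, z, hz, hyk, hzk, hyz⟩ := hgr x hx
    have hk2 := zmod_two k
    rcases hk2 with rfl | rfl
    · exact ⟨y, hy, z, hz, hyk, hzk, hyz⟩
    · exact ⟨z, hz, y, hy, hzk, hyk, hyz.trans (add_comm _ _)⟩) with h | h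
  · refine h0 ((Submodule.eq_bot_iff _).2 fun w hw => ?_)
    obtain ⟨x, rfl⟩ := hb.2 w
    have : x ∈ N := hw
    rw [h, Submodule.mem_bot] at this
    rw [this, map_zero]
  · refine h1 (Submodule.eq_top_iff'.2 fun w => ?_)
    obtain ⟨x, rfl⟩ := hb.2 w
    have : x ∈ N := by rw [h]; trivial
    exact this

end WittSuper

/-! ### The atypical case. -/

namespace WittSuper

variable {F : Type*} [Field F] {n : ℕ} {p : ℕ} [Fact p.Prime] [CharP F p]
  {M : Type*} [AddCommGroup M] [Module F M] [Module (RestrictedLieSub.Env (W0 F n p)) M]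
  [IsScalarTower F (RestrictedLieSub.Env (W0 F n p)) M]

/-- A simple module whose highest weight is atypical embeds, after twisting by the supertrace, into
the divided powers. -/
theorem exists_divPow_embedding
    (hs : ∀ Q : Submodule F M, (∀ i j, ∀ m ∈ Q, elem F n p M i j m ∈ Q) → Q = ⊥ ∨ Q = ⊤)
    {v : M} {μ : Fin n → ZMod p} (hv : v ≠ 0)
    (hraise : ∀ i j : Fin n, i < j → elem F n p M i j v = 0)
    (hwt : ∀ i, elem F n p M i i v = primeCast F p (μ i + 1) • v)
    (hμ : ∀ i j, i < j → μ i = -1 ∨ μ j = 0) :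
    ∃ θ : M →ₗ[F] DivPow F n p, θ v = Pi.single μ 1 ∧
      ∀ i j m, θ (elemShift F n p M i j m) = divElem F p i j (θ m) := by
  have : Nontrivial M := ⟨v, 0, hv⟩
  have hs' : ∀ Q : Submodule F M, (∀ i j, ∀ m ∈ Q, elemShift F n p M i j m ∈ Q) →
      Q = ⊥ ∨ Q = ⊤ := fun Q hQ => hs Q fun i j m hm => by
    by_cases hij : i = j
    · subst hij
      have := Q.add_mem (hQ i i m hm) hm
      rwa [elemShift_self, sub_add_cancel] at this
    · rw [← elemShift_of_ne hij]
      exact hQ i j m hm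
  have hraise' : ∀ i j : Fin n, i < j → elemShift F n p M i j v = 0 := fun i j hij => by
    rw [elemShift_of_ne hij.ne, hraise i j hij]
  have hwt' : ∀ i, elemShift F n p M i i v = primeCast F p (μ i) • v := fun i => by
    rw [elemShift_self, hwt, map_add, map_one, add_smul, one_smul, add_sub_cancel_right]
  refine exists_intertwiner isGlRep_elemShift isGlRep_divElem (μ := fun i => primeCast F p (μ i))
    hv hraise' hwt' (fun i j hij => divElem_single_eq_zero hij.ne (hμ i j hij)) (fun i => ?_) hs'
    (notMem_lowRange isGlRep_elemShift
      (fun i j hij => by rw [elemShift_of_ne hij]; exact elem_pow_of_ne hij) hs' hv hraise' hwt')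
    (single_notMem_lowRange hμ) (single_mem_divDeg μ) (fun i j t ht => divElem_mem_divDeg i j ht)
    fun Q hQ hQs h0 => single_mem_of_ne_bot hQ hQs h0
  refine funext fun α => ?_
  rw [divElem_self, Pi.smul_apply, smul_eq_mul, Pi.single_apply]
  split_ifs with h
  · rw [h]
  · rw [mul_zero, mul_zero]

/-- The subspace consists of the closed forms among the fields. It contains the constants, while
`d(ξ_a ⊗ v) = (μ_a + 1) ⊗ y^{(μ + e_a)}` is nonzero. -/
theorem exists_stable_of_ne (h2 : (2 : F) ≠ 0) {v : M} {μ : Fin n → ZMod p} (hv : v ≠ 0)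
    {θ : M →ₗ[F] DivPow F n p} (hθv : θ v = Pi.single μ 1)
    (hθ : ∀ i j m, θ (elemShift F n p M i j m) = divElem F p i j (θ m)) {a : Fin n}
    (ha : μ a ≠ -1) :
    ∃ Q : Submodule F (TensorFields F n M),
      (∀ T ∈ wittSpace F n, ∀ w ∈ Q, tensorField (elemShift F n p M) T w ∈ Q) ∧
      (∀ w ∈ Q, opTens F n M lamInv.toLinearMap w ∈ Q) ∧ Q ≠ ⊥ ∧ Q ≠ ⊤ := by
  have hmem : ∀ w, w ∈ LinearMap.ker (deRham F n p ∘ₗ fibreMap θ) ↔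
      deRham F n p (fibreMap θ w) = 0 := fun w => Iff.rfl
  refine ⟨LinearMap.ker (deRham F n p ∘ₗ fibreMap θ), fun T hT w hw => ?_, fun w hw => ?_,
    fun h => ?_, fun h => ?_⟩
  · rw [hmem] at hw
    induction hT using Submodule.span_induction with
    | mem T hT =>
      obtain ⟨f, i, rfl⟩ := hT
      rw [hmem, fibreMap_tensorField hθ, deRham_tensorField h2, hw, map_zero, neg_zero]
    | zero => rw [map_zero]; exact Submodule.zero_mem _
    | add S T _ _ hS hT => rw [map_add]; exact Submodule.add_mem _ hS hT
    | smul c T _ hT => rw [map_smul]; exact Submodule.smul_mem _ c hT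
  · rw [hmem] at hw ⊢
    rw [fibreMap_opTens, deRham_lamInv, hw, map_zero, neg_zero]
  · have h1 : tf (1 : Lam F n) v ∈ LinearMap.ker (deRham F n p ∘ₗ fibreMap θ) := by
      rw [hmem, fibreMap_tf, deRham_tf]
      exact Finset.sum_eq_zero fun i _ => by rw [D_one, zero_tf]
    rw [h] at h1
    exact one_tf_ne_zero hv h1
  · have h1 : tf (xi F a) v ∈ LinearMap.ker (deRham F n p ∘ₗ fibreMap θ) := by rw [h]; trivial
    rw [hmem, fibreMap_tf, deRham_tf, Finset.sum_eq_single a, D_xi, if_pos rfl, hθv,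
      mulVar_single] at h1
    · refine one_tf_ne_zero (smul_ne_zero ?_ ?_) h1
      · rw [Ne, primeCast_eq_zero]
        exact fun h => ha (eq_neg_of_add_eq_zero_left h)
      · exact fun h => one_ne_zero ((Pi.single_eq_same _ _).symm.trans (congrFun h _))
    · intro b _ hb; rw [D_xi, if_neg hb, zero_tf]
    · simp

/-- Here the fields are volume forms and the subspace is that of total divergences. It contains `D_1
ξ_1 ⊗ v = 1 ⊗ v`, and it is proper because the coefficient of `ξ_1⋯ξ_n`, the Berezin integral,
vanishes on it. -/
theorem exists_stable_of_eq (hn : n ≠ 0)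
    (hE : ∀ i j m, elemShift F n p M i j m = if i = j then -m else 0) [Nontrivial M] :
    ∃ Q : Submodule F (TensorFields F n M),
      (∀ T ∈ wittSpace F n, ∀ w ∈ Q, tensorField (elemShift F n p M) T w ∈ Q) ∧
      (∀ w ∈ Q, opTens F n M lamInv.toLinearMap w ∈ Q) ∧ Q ≠ ⊥ ∧ Q ≠ ⊤ := by
  obtain ⟨v, hv⟩ := exists_ne (0 : M)
  have hmem : ∀ i (g : Lam F n) (m : M),
      tf (D F i g) m ∈ ⨆ i, LinearMap.range (opTens F n M (D F i)) := fun i g m =>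
    Submodule.mem_iSup_of_mem i ⟨tf g m, rfl⟩
  have hfield : ∀ (f g : Lam F n) (i : Fin n) (m : M),
      tensorField (elemShift F n p M) (fD F f i) (tf g m) = tf (D F i (lamInv f * g)) m := by
    intro f g i m
    rw [tensorField_fD_tf, Finset.sum_eq_single i, hE, if_pos rfl, D_mul, lamInv_lamInv, add_tf,
      tD_apply, lamInv_D, neg_mul, neg_tf, ← neg_one_smul F m,
      tf_smul, neg_one_smul, neg_neg, add_comm]
    · intro j _ hj; rw [hE, if_neg hj, tf_zero]
    · simp
  refine ⟨⨆ i, LinearMap.range (opTens F n M (D F i)), fun T hT w hw => ?_, fun w hw => ?_,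
    fun h => ?_, fun h => ?_⟩
  · clear hw
    induction hT using Submodule.span_induction with
    | mem T hT =>
      obtain ⟨f, i, rfl⟩ := hT
      induction w using tf_induction with
      | h0 => rw [map_zero]; exact Submodule.zero_mem _
      | ht g m => rw [hfield]; exact hmem _ _ _
      | ha x y hx hy => rw [map_add]; exact Submodule.add_mem _ hx hy
    | zero => rw [map_zero]; exact Submodule.zero_mem _
    | add S T _ _ hS hT => rw [map_add]; exact Submodule.add_mem _ hS hT
    | smul c T _ hT => rw [map_smul]; exact Submodule.smul_mem _ c hT
  · have hle : (⨆ i, LinearMap.range (opTens F n M (D F i))) ≤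
        (⨆ i, LinearMap.range (opTens F n M (D F i))).comap (opTens F n M lamInv.toLinearMap) := by
      refine iSup_le fun i => ?_
      rintro _ ⟨w, rfl⟩
      induction w using tf_induction with
      | h0 => rw [map_zero]; exact Submodule.zero_mem _
      | ht g m =>
        rw [Submodule.mem_comap, opTens_tf, opTens_tf, AlgHom.toLinearMap_apply, lamInv_D, neg_tf]
        exact Submodule.neg_mem _ (hmem _ _ _)
      | ha x y hx hy => rw [map_add]; exact Submodule.add_mem _ hx hy
    exact hle hw
  · have h1 := hmem ⟨0, Nat.pos_of_ne_zero hn⟩ (xi F ⟨0, Nat.pos_of_ne_zero hn⟩) v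
    rw [h, D_xi, if_pos rfl] at h1
    exact one_tf_ne_zero hv h1
  -- The Berezin integral is written `eps ∘ hodge⁻¹`; under `hodge` the images of the `D_i`
  -- correspond to multiples of the `ξ_i`.
  · have hle : (⨆ i, LinearMap.range (opTens F n M (D F i))) ≤
        LinearMap.ker (evalTens (F := F) (n := n) (M := M)
          (eps.toLinearMap ∘ₗ hodge.symm.toLinearMap)) := by
      refine iSup_le fun i => ?_
      rintro _ ⟨w, rfl⟩
      induction w using tf_induction with
      | h0 => rw [map_zero]; exact Submodule.zero_mem _
      | ht g m =>
        obtain ⟨g, rfl⟩ := hodge.surjective g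
        rw [opTens_tf, LinearMap.mem_ker, evalTens_tf, ← hodge_xi_mul, LinearMap.comp_apply,
          LinearEquiv.coe_coe, LinearEquiv.symm_apply_apply, AlgHom.toLinearMap_apply, map_mul,
          eps_xi, zero_mul, zero_smul]
      | ha x y hx hy => rw [map_add]; exact Submodule.add_mem _ hx hy
    have h1 : tf (lamTop F n) v ∈ LinearMap.ker (evalTens (F := F) (n := n) (M := M)
          (eps.toLinearMap ∘ₗ hodge.symm.toLinearMap)) := hle (by rw [h]; trivial)
    rw [LinearMap.mem_ker, evalTens_tf, ← hodge_one, LinearMap.comp_apply,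
      LinearEquiv.coe_coe, LinearEquiv.symm_apply_apply, AlgHom.toLinearMap_apply, map_one,
      one_smul] at h1
    exact hv h1

/-- If the highest weight of `M` is atypical, the tensor fields are reducible. -/
theorem exists_stable_of_atypical (h2 : (2 : F) ≠ 0) (hn : n ≠ 0)
    (hs : ∀ Q : Submodule F M, (∀ i j, ∀ m ∈ Q, elem F n p M i j m ∈ Q) → Q = ⊥ ∨ Q = ⊤)
    {v : M} {μ : Fin n → ZMod p} (hv : v ≠ 0)
    (hraise : ∀ i j : Fin n, i < j → elem F n p M i j v = 0)
    (hwt : ∀ i, elem F n p M i i v = primeCast F p (μ i + 1) • v)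
    (hμ : ∀ i j, i < j → μ i = -1 ∨ μ j = 0) :
    ∃ Q : Submodule F (TensorFields F n M),
      (∀ T ∈ wittSpace F n, ∀ w ∈ Q, tensorField (elemShift F n p M) T w ∈ Q) ∧
      (∀ w ∈ Q, opTens F n M lamInv.toLinearMap w ∈ Q) ∧ Q ≠ ⊥ ∧ Q ≠ ⊤ := by
  obtain ⟨θ, hθv, hθ⟩ := exists_divPow_embedding hs hv hraise hwt hμ
  by_cases ha : ∃ a, μ a ≠ -1
  · obtain ⟨a, ha⟩ := ha
    exact exists_stable_of_ne h2 hv hθv hθ ha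
  push Not at ha
  have : Nontrivial M := ⟨v, 0, hv⟩
  have hv1 : ∀ i j, elem F n p M i j v = 0 := by
    intro i j
    by_cases hij : i = j
    · subst hij
      rw [hwt, ha, neg_add_cancel, map_zero, zero_smul]
    -- `θ` is injective by simplicity, and `y^{(p-1, …, p-1)}` is killed by all off-diagonal `E i
    -- j`; so `v` is killed by all of `gl_n` and spans `M`.
    · have hker : LinearMap.ker θ = ⊥ := by
        refine (hs _ fun i j m hm => ?_).resolve_right fun h => ?_
        · have e : elem F n p M i j m = elemShift F n p M i j m + if i = j then m else 0 := by
            rw [elemShift, LinearMap.sub_apply]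
            split_ifs <;> simp
          rw [LinearMap.mem_ker] at hm ⊢
          rw [e, map_add, hθ, hm, map_zero, zero_add]
          split_ifs
          · exact hm
          · exact map_zero _
        · have hv' : v ∈ LinearMap.ker θ := by rw [h]; trivial
          rw [LinearMap.mem_ker, hθv] at hv'
          exact one_ne_zero ((Pi.single_eq_same _ _).symm.trans (congrFun hv' μ))
      refine LinearMap.ker_eq_bot.1 hker ?_
      rw [← elemShift_of_ne hij, hθ, hθv, map_zero]
      exact divElem_single_eq_zero hij (Or.inl (ha i))
  have hspan := (hs (Submodule.span F {v}) fun i j m hm => by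
    obtain ⟨c, rfl⟩ := Submodule.mem_span_singleton.1 hm
    rw [map_smul, hv1, smul_zero]
    exact Submodule.zero_mem _).resolve_left fun h => hv (Submodule.span_singleton_eq_bot.1 h)
  refine exists_stable_of_eq hn fun i j m => ?_
  have hm : m ∈ Submodule.span F {v} := by rw [hspan]; trivial
  obtain ⟨c, rfl⟩ := Submodule.mem_span_singleton.1 hm
  rw [elemShift, LinearMap.sub_apply, map_smul, hv1, smul_zero, zero_sub]
  split_ifs <;> simp

end WittSuper

theorem corollary3p15 {F : Type*} [Field F] [IsAlgClosed F] (p : ℕ) [Fact p.Prime] [CharP F p]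
    (hp : 2 < p) (n : ℕ)
    {M : Type*} [AddCommGroup M] [Module F M]
    [Module (RestrictedLieSub.Env (WittSuper.W0 F n p)) M]
    [IsScalarTower F (RestrictedLieSub.Env (WittSuper.W0 F n p)) M]
    (𝓜 : ZMod 2 → Submodule F M)
    (hM : (WittSuper.W0 F n p).IsSupermodule 𝓜)
    (hsimple : IsSimpleSupermodule (RestrictedLieSub.Env (WittSuper.W0 F n p)) 𝓜)
    (hann : ∀ x : (WittSuper.W0 F n p).carrier,
      (x : Module.End F (WittSuper.Lam F n)) ∈ WittSuper.wittFil F n 1 →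
        ∀ m : M, (WittSuper.W0 F n p).ι x • m = 0)
    (wt : Fin n → F)
    (hwt : ∃ v : M, WittSuper.IsMaximalVector (p := p) 𝓜 wt v) :
    IsSimpleSupermodule (RestrictedLieSub.Env (WittSuper.W F n p))
        (WittSuper.kacParity F n p 𝓜) ↔
      wt ∉ WittSuper.atypicalWeights F n p := by
  have h2 : (2 : F) ≠ 0 := by
    intro h
    have h' : ((2 : ℕ) : F) = 0 := by exact_mod_cast h
    exact absurd (Nat.le_of_dvd two_pos ((CharP.cast_eq_zero_iff F p 2).1 h')) (not_le.2 hp)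
  obtain ⟨v, hv⟩ := hwt
  obtain ⟨⟨k, hk⟩, hs⟩ := WittSuper.elem_simple hM hsimple hann hv
  choose a ha using fun i => hv.exists_weight i
  obtain rfl : wt = fun i => WittSuper.primeCast F p (a i) := funext ha
  have : Nontrivial M := hsimple.1
  rw [WittSuper.mem_atypicalWeights_iff]
  constructor
  · rintro h ⟨hn, hat⟩
    -- `a i - 1` is the weight after the supertrace twist; atypicality becomes `μ_i = -1` or `μ_j =
    -- 0` for `i < j`.
    obtain ⟨Q, hQ, hα, h0, h1⟩ := WittSuper.exists_stable_of_atypical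
      (μ := fun i => a i - 1) h2 hn hs hv.ne_zero hv.raising
      (fun i => by rw [sub_add_cancel]; exact hv.weight i)
      (fun i j hij => (hat i j hij).imp (fun h => by rw [h, zero_sub]) fun h => by rw [h, sub_self])
    exact WittSuper.not_isSimple_kac h2 hann hk hQ hα h0 h1 h
  · intro hat
    refine WittSuper.isSimple_kac h2 hann 𝓜 fun Q hQ h0 =>
      WittSuper.eq_top_of_typical hann hs hv.ne_zero hv.raising hv.weight ?_ hQ h0
    by_cases hn : n = 0
    · exact Or.inl hn
    push Not at hat
    obtain ⟨i, j, hij, hi, hj⟩ := hat hn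
    refine Or.inr ⟨i, j, hij, ?_, ?_⟩
    · rwa [Ne, WittSuper.primeCast_eq_zero]
    · rw [Ne, ← map_one (WittSuper.primeCast F p)]
      exact fun h => hj ((WittSuper.primeCast F p).injective h)
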